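/- **Setting.** Let $\Omega=[a,b]$, $p\ge 1$, and impose at each end of $\Omega$ a Dirichlet or a Neumann condition, at least one of them Dirichlet; $n_\gamma=\mp1$ is the outward normal at a left/right end. Let $\lambda>0$ on $\Omega$ and let $U,\psi$ solve $$-(\lambda U')'=F,\quad U|_{\Gamma^D}=u_D,\quad n_\gamma\lambda U'|_{\Gamma^N}=u_N,\qquad -(\lambda \psi')'=G,\quad \psi|_{\Gamma^D}=\psi_D,\quad n_\gamma\lambda\psi'|_{\Gamma^N}=\psi_N ,$$ with $U,\psi\in C^{2p+2}(\Omega)$, $\lambda\in C^{2p+1}(\Omega)$, $F,G\in C^{2p}(\Omega)$. Put $$I(U)=\int_\Omega GU\,dx-\psi_D[n_\gamma\lambda U']_{\Gamma^D}+\psi_N U|_{\Gamma^N},\qquad I(\psi)=\int_\Omega \psi F\,dx-u_D[n_\gamma\lambda \psi']_{\Gamma^D}+u_N\psi|_{\Gamma^N}$$ (boundary terms summed over the ends concerned). **Operators.** Tessellate $\Omega$ by elements $\Omega_k$ with $n$ nodes each, all in $\Omega$; $h_k$ is the largest distance between two nodes of $\Omega_k$ and $h=\max_k h_k$. Each element carries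 a diagonal positive definite $H$, row vectors $R_\ell,R_r$ that extrapolate polynomials of degree $\le p$ exactly to its ends, $E=R_r^TR_r-R_\ell^TR_\ell$, and $D=H^{-1}(S+\frac12E)$, $S^T=-S$, exact for the derivative on degree $\le p$. With $\Lambda=\mathrm{diag}(\lambda(x_i))$ the second-derivative operator is $D^{(2)}=H^{-1}(-M+E\Lambda D_b)$, $M=\sum_i\lambda(x_i)\bar M_i$, and is either (narrow stencil, degree $p+1$) with $\bar M_i$ symmetric positive semidefinite, $D^{(2)}(\lambda)P=(\lambda P')'$ at the nodes for all polynomials $\lambda,P$ with $\deg(\lambda P)\le p+1$, and $D_b$ exact for the derivative on degree $\le p+1$ (in the rows seen by $R_\ell$ or $R_r$); or (wide stencil, degree $p$) $D^{(2)}=D\Lambda D$, i.e. $D_b=D$, $M=D^TH\Lambda D$. Put $D_\gamma=n_\gamma R_\gamma\Lambda D_b$. **Discretizations.** The discrete primal problem is $D^{(2)}_ku_{h,k}+f_k-H_k^{-1}s_k(u_h)=0$ for all $k$, where $s_k$ is the sum of $$R_{\gamma k}^T\big(T^{(1)}_{\gamma k}j+T^{(3)}_{\gamma k}q\big)+D_{\gamma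 k}^T\big(T^{(2)}_{\gamma k}j+T^{(4)}_{\gamma k}q\big),\quad j=R_{\gamma k}u_{h,k}-R_{\gamma v}u_{h,v},\ q=D_{\gamma k}u_{h,k}+D_{\gamma v}u_{h,v},$$ over the interfaces $\gamma$ of $\Omega_k$ with neighbours $\Omega_v$, of $(T^{(D)}_\gamma R_{\gamma k}^T-D_{\gamma k}^T)(R_{\gamma k}u_{h,k}-u_D)$ at a Dirichlet end and of $R_{\gamma k}^T(D_{\gamma k}u_{h,k}-u_N)$ at a Neumann end. The discrete adjoint problem is $D^{(2)}_k\psi_{h,k}+g_k+H_k^{-1}(M_k-M_k^T)\psi_{h,k}-H_k^{-1}s_k^*(\psi_h)=0$, where $s_k^*$ has the same boundary terms with $\psi_D,\psi_N$ and the interface terms $$R_{\gamma k}^T\big(T^{(1)}_{\gamma k}R_{\gamma k}\psi_{h,k}-T^{(1)}_{\gamma v}R_{\gamma v}\psi_{h,v}+(T^{(2)}_{\gamma k}+1)D_{\gamma k}\psi_{h,k}-T^{(2)}_{\gamma v}D_{\gamma v}\psi_{h,v}\big)+D_{\gamma k}^T\big((T^{(3)}_{\gamma k}-1)R_{\gamma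 k}\psi_{h,k}+T^{(3)}_{\gamma v}R_{\gamma v}\psi_{h,v}+T^{(4)}_{\gamma k}D_{\gamma k}\psi_{h,k}+T^{(4)}_{\gamma v}D_{\gamma v}\psi_{h,v}\big).$$ Here $f,g,u,\psi$ as vectors denote restrictions of $F,G,U,\psi$ to the nodes. The discrete functionals are $$I_h(u_h)=\sum_k g_k^TH_ku_{h,k}+\sum_{\gamma\in\Gamma^D}\big(-\psi_DD_\gamma u_h+\psi_DT^{(D)}_\gamma(R_\gamma u_h-u_D)\big)+\sum_{\gamma\in\Gamma^N}\psi_NR_\gamma u_h,$$ and $I_h(\psi_h)$, obtained by exchanging $g,\psi_D,\psi_N,u_h,u_D$ for $f,u_D,u_N,\psi_h,\psi_D$. **Assumptions on the discretizations.** (i) Scaling with a constant $C$: entries of $R_\gamma$ are bounded by $C$; $H\le Ch_k$; entries of $D,D_b,\bar M_i$ are at most $C/h_k$; at interfaces $|T^{(1)}|\le C/h_k$, $|T^{(2)}|,|T^{(3)}|\le C$, $|T^{(4)}|\le Ch_k$; at Dirichlet ends $|T^{(D)}|\le C/h_k$; $h_k\le C|\Omega_k|$ and $h_k\le Ch_v$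 for neighbours. (ii) Adjoint consistency: at every interface $T^{(1)}_{\gamma k}=T^{(1)}_{\gamma v}$, $T^{(2)}_{\gamma k}+1=-T^{(2)}_{\gamma v}$, $T^{(3)}_{\gamma k}-1=-T^{(3)}_{\gamma v}$, $T^{(4)}_{\gamma k}=T^{(4)}_{\gamma v}$, and $M_k=M_k^T$. (iii) $u_h,\psi_h$ solve the discrete primal and adjoint problems and $\|u-u_h\|_\infty\le Ch^{p+1}$, $\|\psi-\psi_h\|_\infty\le Ch^{p+1}$. **Theorem.** $I(U)=I(\psi)$, and for every $C$ there is a constant $K$, depending only on $p$, $n$, $C$ and the continuous problem, such that for every such discretization $$|I(U)-I_h(u_h)|\le K h^{2p},\qquad |I(\psi)-I_h(\psi_h)|\le K h^{2p}.$$ -/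

import Mathlib

open Set Matrix Polynomial

noncomputable section

/-- The two ends of an interval (a subdomain or the whole domain). -/
inductive Side
  | left
  | right
  deriving DecidableEq

instance : Fintype Side := ⟨{Side.left, Side.right}, fun γ => by cases γ <;> simp⟩

namespace Side

/-- The opposite end. -/
def opp : Side → Side
  | left => right
  | right => left

/-- The outward unit normal: `-1` at the left end, `1` at the right end. -/
def normal : Side → ℝ
  | left => -1
  | right => 1

end Side

/-- The type of boundary condition imposed at an end of the domain. -/
inductive BC
  | dirichlet
  | neumann
  deriving DecidableEq

/-! ### The continuous problem on `Ω = [a, b]` -/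

/-- The end points of `[a, b]`. -/
def domainEnd (a b : ℝ) : Side → ℝ
  | Side.left => a
  | Side.right => b

/-- The flux `λ dV/dx` on `[a, b]` (one-sided derivatives at the end points). -/
def flux (a b : ℝ) (lam V : ℝ → ℝ) (x : ℝ) : ℝ :=
  lam x * derivWithin V (Icc a b) x

/-- The normal flux `n_γ λ dV/dx` at an end of the domain. -/
def normalFlux (a b : ℝ) (lam V : ℝ → ℝ) (γ : Side) : ℝ :=
  γ.normal * flux a b lam V (domainEnd a b γ)

/-- The steady diffusion problem `-(λ V')' = S` on `[a, b]`, with `V = data γ` at a Dirichlet end `γ`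
and `n_γ λ V' = data γ` at a Neumann end `γ`. The primal problem is the case `V = U`, `S = F`,
the adjoint problem the case `V = ψ`, `S = G`. -/
structure SolvesDiffusion (a b : ℝ) (bc : Side → BC) (lam S V : ℝ → ℝ) (data : Side → ℝ) :
    Prop where
  pde : ∀ x ∈ Icc a b, -derivWithin (flux a b lam V) (Icc a b) x = S x
  dirichlet : ∀ γ, bc γ = BC.dirichlet → V (domainEnd a b γ) = data γ
  neumann : ∀ γ, bc γ = BC.neumann → normalFlux a b lam V γ = data γ

/-- The linear functional
`∫ W V dx - ∑_{Dirichlet ends} data γ (n_γ λ V')(γ) + ∑_{Neumann ends} data γ V(γ)`.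
`I(U)` is the case `W = G`, `data = (ψ_D, ψ_N)`, and `I(ψ)` the case `W = F`,
`data = (u_D, u_N)`. -/
def functional (a b : ℝ) (bc : Side → BC) (lam W : ℝ → ℝ) (data : Side → ℝ) (V : ℝ → ℝ) : ℝ :=
  (∫ x in a..b, W x * V x) +
    ∑ γ : Side, match bc γ with
      | BC.dirichlet => -(data γ * normalFlux a b lam V γ)
      | BC.neumann => data γ * V (domainEnd a b γ)

/-! ### Generalized SBP operators on one element -/

/-- The data of diagonal-norm first- and second-derivative operators on an element with `n` nodes.
The laws they have to satisfy are `IsSBP`, `IsNarrow` and `IsWide` below. -/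
structure SBPElement (n : ℕ) where
  /-- the end points of the element -/
  bdry : Side → ℝ
  /-- the nodes -/
  node : Fin n → ℝ
  /-- the diagonal of the norm matrix `H` -/
  w : Fin n → ℝ
  /-- the first-derivative operator `D` -/
  D : Matrix (Fin n) (Fin n) ℝ
  /-- the extrapolation row vectors `R_γ` -/
  R : Side → Fin n → ℝ
  /-- the matrix `D_b` -/
  Db : Matrix (Fin n) (Fin n) ℝ
  /-- the matrices `M̄_i` of the decomposition `M = ∑ i, λ(x_i) M̄_i` -/
  Mbar : Fin n → Matrix (Fin n) (Fin n) ℝ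

namespace SBPElement

variable {n : ℕ} (E : SBPElement n)

/-- Restriction of a function to the nodes. -/
def restrict (f : ℝ → ℝ) : Fin n → ℝ := fun i => f (E.node i)

/-- The size of the element: the largest distance between two of its nodes. -/
def size : ℝ := Metric.diam (Set.range E.node)

/-- The norm matrix. -/
def H : Matrix (Fin n) (Fin n) ℝ := Matrix.diagonal E.w

/-- `E = R_rᵀ R_r - R_ℓᵀ R_ℓ`. -/
def Emat : Matrix (Fin n) (Fin n) ℝ :=
  ∑ γ : Side, γ.normal • Matrix.vecMulVec (E.R γ) (E.R γ)

/-- `Λ = diag(λ(x_1), …, λ(x_n))`. -/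
def Lam (lam : ℝ → ℝ) : Matrix (Fin n) (Fin n) ℝ := Matrix.diagonal (E.restrict lam)

/-- `M = ∑ i, λ(x_i) M̄_i`. -/
def M (lam : ℝ → ℝ) : Matrix (Fin n) (Fin n) ℝ := ∑ i, lam (E.node i) • E.Mbar i

/-- The second-derivative operator `D⁽²⁾(λ) = H⁻¹ (-M + E Λ D_b)`. -/
def D2 (lam : ℝ → ℝ) : Matrix (Fin n) (Fin n) ℝ :=
  (E.H)⁻¹ * (-(E.M lam) + E.Emat * E.Lam lam * E.Db)

/-- The row vector `D_γ = n_γ R_γ Λ D_b`. -/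
def Dn (lam : ℝ → ℝ) (γ : Side) : Fin n → ℝ :=
  γ.normal • (E.R γ ᵥ* (E.Lam lam * E.Db))

/-- `D` is a degree `p` diagonal-norm generalized SBP operator on the element. The nodes need not be
uniform, nor include the end points, nor lie in the element. Exactness of `R_γ` for a degree
`τ ≥ p` is the same as exactness for degree `p`, in its weakest case. -/
structure IsSBP (p : ℕ) : Prop where
  bdry_lt : E.bdry Side.left < E.bdry Side.right
  node_injective : Function.Injective E.node
  w_pos : ∀ i, 0 < E.w i
  accurate : ∀ P : ℝ[X], P.natDegree ≤ p →
    E.D *ᵥ E.restrict (fun x => P.eval x) = E.restrict (fun x => P.derivative.eval x)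
  decomposition : ∃ S : Matrix (Fin n) (Fin n) ℝ, Sᵀ = -S ∧
    E.D = (E.H)⁻¹ * (S + (1 / 2 : ℝ) • E.Emat)
  extrapolation : ∀ γ, ∀ P : ℝ[X], P.natDegree ≤ p →
    E.R γ ⬝ᵥ E.restrict (fun x => P.eval x) = P.eval (E.bdry γ)

/-- `D⁽²⁾` is a narrow-stencil second-derivative operator of degree `p + 1`, order-matched with the
degree `p` operator `D` (it uses the same `H`, `R_γ` and nodes). Only those rows of `D_b` enter the
operator, and are asked to approximate the derivative, that are seen by an extrapolation vector. -/
structure IsNarrow (p : ℕ) : Prop where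
  accurate : ∀ lam P : ℝ[X], (lam * P).natDegree ≤ p + 1 →
    E.D2 (fun x => lam.eval x) *ᵥ E.restrict (fun x => P.eval x) =
      E.restrict (fun x => (lam * P.derivative).derivative.eval x)
  posSemidef : ∀ i, (E.Mbar i).PosSemidef
  Db_accurate : ∀ P : ℝ[X], P.natDegree ≤ p + 1 → ∀ i, (∃ γ, E.R γ i ≠ 0) →
    (E.Db *ᵥ E.restrict (fun x => P.eval x)) i = P.derivative.eval (E.node i)

/-- The second-derivative operator is the wide-stencil one: `D_b = D` and `M = Dᵀ H Λ D`, so that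
`D⁽²⁾ = D Λ D` (see `D2_eq_of_isWide`). -/
structure IsWide : Prop where
  Db_eq : E.Db = E.D
  Mbar_eq : ∀ i, E.Mbar i = E.w i • Matrix.vecMulVec (E.D i) (E.D i)

theorem M_eq_of_isWide (hw : E.IsWide) (lam : ℝ → ℝ) :
    E.M lam = E.Dᵀ * E.H * E.Lam lam * E.D := by
  ext i j
  simp only [M, hw.Mbar_eq, H, Lam, Matrix.sum_apply, Matrix.smul_apply, Matrix.vecMulVec_apply,
    smul_eq_mul, Matrix.mul_assoc, Matrix.mul_apply (M := E.Dᵀ), Matrix.diagonal_mul,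
    Matrix.transpose_apply, restrict]
  exact Finset.sum_congr rfl fun k _ => by ring

theorem D2_eq_of_isWide {p : ℕ} (hE : E.IsSBP p) (hw : E.IsWide) (lam : ℝ → ℝ) :
    E.D2 lam = E.D * E.Lam lam * E.D := by
  obtain ⟨S, hS, hD⟩ := hE.decomposition
  have hdet : IsUnit E.H.det := by
    rw [H, Matrix.det_diagonal]
    exact (Finset.prod_ne_zero_iff.mpr fun i _ => (hE.w_pos i).ne').isUnit
  have hHt : (E.H)ᵀ = E.H := Matrix.diagonal_transpose _
  have hEt : (E.Emat)ᵀ = E.Emat := by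
    simp [Emat, Matrix.transpose_sum, Matrix.transpose_vecMulVec]
  have hHD : E.H * E.D = S + (1 / 2 : ℝ) • E.Emat := by
    rw [hD, Matrix.mul_nonsing_inv_cancel_left _ _ hdet]
  have hDH : E.Dᵀ * E.H = -S + (1 / 2 : ℝ) • E.Emat := by
    have := congrArg Matrix.transpose hHD
    rwa [Matrix.transpose_mul, hHt, Matrix.transpose_add, hS, Matrix.transpose_smul, hEt] at this
  have hsum : E.Emat = E.H * E.D + E.Dᵀ * E.H := by
    rw [hHD, hDH]
    module
  have key : -(E.Dᵀ * E.H * E.Lam lam * E.D) + E.Emat * E.Lam lam * E.D =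
      E.H * (E.D * E.Lam lam * E.D) := by
    rw [hsum]
    noncomm_ring
  rw [D2, M_eq_of_isWide E hw, hw.Db_eq, key, Matrix.nonsing_inv_mul_cancel_left _ _ hdet]

end SBPElement

/-! ### The SBP-SAT discretization -/

/-- A chain of `ne` elements with `n` nodes each, with the SAT coefficients: `T1 γ k`, …, `T4 γ k`
belong to the interface `γ` of element `k`, and `TD γ` to the end `γ` of the domain. -/
structure Discretization (n : ℕ) where
  ne : ℕ
  elem : Fin ne → SBPElement n
  T1 : Side → Fin ne → ℝ
  T2 : Side → Fin ne → ℝ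
  T3 : Side → Fin ne → ℝ
  T4 : Side → Fin ne → ℝ
  TD : Side → ℝ

namespace Discretization

variable {n : ℕ} (d : Discretization n)

/-- The element on the other side of the end `γ` of element `k`, if that end is not an end of the
domain. -/
def nbr (γ : Side) (k : Fin d.ne) : Option (Fin d.ne) :=
  match γ with
  | Side.left =>
      if 0 < (k : ℕ) then some ⟨(k : ℕ) - 1, lt_of_le_of_lt (Nat.sub_le _ _) k.isLt⟩ else none
  | Side.right => if h : (k : ℕ) + 1 < d.ne then some ⟨(k : ℕ) + 1, h⟩ else none

/-- The elements are numbered from left to right and tessellate `[a, b]`; all nodes lie in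
`[a, b]`, so that functions on `[a, b]` can be restricted to them. -/
structure Tessellates (a b : ℝ) : Prop where
  ne_pos : 0 < d.ne
  interior : ∀ γ k v, d.nbr γ k = some v → (d.elem k).bdry γ = (d.elem v).bdry γ.opp
  boundary : ∀ γ k, d.nbr γ k = none → (d.elem k).bdry γ = domainEnd a b γ
  node_mem : ∀ k i, (d.elem k).node i ∈ Icc a b

/-- The mesh size `h`: the largest element size. -/
def h : ℝ := ⨆ k, (d.elem k).size

/-- The operators scale as if they were mapped affinely from a reference
element, and the SAT coefficients have the usual magnitude: `R_γ = O(1)`, `H = O(h)`,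
`D, D_b, M̄_i = O(h⁻¹)`, `T⁽¹⁾, T⁽ᴰ⁾ = O(h⁻¹)`, `T⁽²⁾, T⁽³⁾ = O(1)`, `T⁽⁴⁾ = O(h)`, all with
the constant `C`; elements are comparable in size with the distance of their end points and with
their neighbours. -/
structure Scaled (bc : Side → BC) (C : ℝ) : Prop where
  size_le : ∀ k, (d.elem k).size ≤
    C * ((d.elem k).bdry Side.right - (d.elem k).bdry Side.left)
  size_le_nbr : ∀ γ k v, d.nbr γ k = some v → (d.elem k).size ≤ C * (d.elem v).size
  R_le : ∀ k γ i, |(d.elem k).R γ i| ≤ C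
  w_le : ∀ k i, (d.elem k).w i ≤ C * (d.elem k).size
  D_le : ∀ k i j, |(d.elem k).D i j| * (d.elem k).size ≤ C
  Db_le : ∀ k i j, |(d.elem k).Db i j| * (d.elem k).size ≤ C
  Mbar_le : ∀ k l i j, |(d.elem k).Mbar l i j| * (d.elem k).size ≤ C
  T1_le : ∀ γ k v, d.nbr γ k = some v → |d.T1 γ k| * (d.elem k).size ≤ C
  T2_le : ∀ γ k v, d.nbr γ k = some v → |d.T2 γ k| ≤ C
  T3_le : ∀ γ k v, d.nbr γ k = some v → |d.T3 γ k| ≤ C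
  T4_le : ∀ γ k v, d.nbr γ k = some v → |d.T4 γ k| ≤ C * (d.elem k).size
  TD_le : ∀ γ k, d.nbr γ k = none → bc γ = BC.dirichlet → |d.TD γ| * (d.elem k).size ≤ C

/-- The conditions on the SAT coefficients at the interfaces, and the symmetry of the matrices `M`,
under which the discrete adjoint problem is a consistent discretization of the adjoint problem. -/
structure AdjointConsistent (lam : ℝ → ℝ) : Prop where
  T1_eq : ∀ γ k v, d.nbr γ k = some v → d.T1 γ k = d.T1 γ.opp v
  T2_eq : ∀ γ k v, d.nbr γ k = some v → d.T2 γ k + 1 = -d.T2 γ.opp v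
  T3_eq : ∀ γ k v, d.nbr γ k = some v → d.T3 γ k - 1 = -d.T3 γ.opp v
  T4_eq : ∀ γ k v, d.nbr γ k = some v → d.T4 γ k = d.T4 γ.opp v
  M_symm : ∀ k, (d.elem k).M lam = ((d.elem k).M lam)ᵀ

variable (bc : Side → BC) (lam : ℝ → ℝ) (data : Side → ℝ) (v : Fin d.ne → Fin n → ℝ)

/-- `R_γ v` on element `k`. -/
def tr (γ : Side) (k : Fin d.ne) : ℝ := (d.elem k).R γ ⬝ᵥ v k

/-- `D_γ v` on element `k`. -/
def fl (γ : Side) (k : Fin d.ne) : ℝ := (d.elem k).Dn lam γ ⬝ᵥ v k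

/-- The boundary SAT at the end `γ` of the domain, which belongs to element `k`; the same for the
primal and the adjoint problem. -/
def boundarySAT (γ : Side) (k : Fin d.ne) : Fin n → ℝ :=
  match bc γ with
  | BC.dirichlet =>
      (d.tr v γ k - data γ) • (d.TD γ • (d.elem k).R γ - (d.elem k).Dn lam γ)
  | BC.neumann => (d.fl lam v γ k - data γ) • (d.elem k).R γ

/-- The interface SAT of the primal problem at the end `γ` of element `k`, with neighbour `m`. -/
def interfaceSAT (γ : Side) (k m : Fin d.ne) : Fin n → ℝ :=
  (d.T1 γ k * (d.tr v γ k - d.tr v γ.opp m) +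
    d.T3 γ k * (d.fl lam v γ k + d.fl lam v γ.opp m)) • (d.elem k).R γ +
  (d.T2 γ k * (d.tr v γ k - d.tr v γ.opp m) +
    d.T4 γ k * (d.fl lam v γ k + d.fl lam v γ.opp m)) • (d.elem k).Dn lam γ

/-- The interface SAT of the adjoint problem at the end `γ` of element `k`, with neighbour `m`. -/
def interfaceSATAdj (γ : Side) (k m : Fin d.ne) : Fin n → ℝ :=
  (d.T1 γ k * d.tr v γ k - d.T1 γ.opp m * d.tr v γ.opp m +
    (d.T2 γ k + 1) * d.fl lam v γ k - d.T2 γ.opp m * d.fl lam v γ.opp m) • (d.elem k).R γ +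
  ((d.T3 γ k - 1) * d.tr v γ k + d.T3 γ.opp m * d.tr v γ.opp m +
    d.T4 γ k * d.fl lam v γ k + d.T4 γ.opp m * d.fl lam v γ.opp m) • (d.elem k).Dn lam γ

/-- The sum of the interface and boundary SATs of the primal problem on element `k`. -/
def sat (k : Fin d.ne) : Fin n → ℝ :=
  ∑ γ : Side, match d.nbr γ k with
    | some m => d.interfaceSAT lam v γ k m
    | none => d.boundarySAT bc lam data v γ k

/-- The sum of the interface and boundary SATs of the adjoint problem on element `k`. -/
def satAdj (k : Fin d.ne) : Fin n → ℝ :=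
  ∑ γ : Side, match d.nbr γ k with
    | some m => d.interfaceSATAdj lam v γ k m
    | none => d.boundarySAT bc lam data v γ k

/-- `v` solves the steady SBP-SAT discretization of the primal problem with source `F` and boundary
data `data = (u_D, u_N)`. -/
def SolvesPrimal (F : ℝ → ℝ) : Prop :=
  ∀ k, (d.elem k).D2 lam *ᵥ v k + (d.elem k).restrict F
    - ((d.elem k).H)⁻¹ *ᵥ d.sat bc lam data v k = 0

/-- `v` solves the discrete adjoint problem with source `G` and boundary data
`data = (ψ_D, ψ_N)`. -/
def SolvesAdjoint (G : ℝ → ℝ) : Prop :=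
  ∀ k, (d.elem k).D2 lam *ᵥ v k + (d.elem k).restrict G
    + ((d.elem k).H)⁻¹ *ᵥ (((d.elem k).M lam - ((d.elem k).M lam)ᵀ) *ᵥ v k)
    - ((d.elem k).H)⁻¹ *ᵥ d.satAdj bc lam data v k = 0

/-- `v` approximates the function `V` to order `h ^ r` in the maximum norm, with constant `C`. -/
def Accurate (V : ℝ → ℝ) (r : ℕ) (C : ℝ) : Prop :=
  ∀ k i, |V ((d.elem k).node i) - v k i| ≤ C * d.h ^ r

/-- The discrete functional
`∑_k wᵀ H v_k + ∑_{Dirichlet ends} (-dataF D_γ v + dataF T⁽ᴰ⁾ (R_γ v - data))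
  + ∑_{Neumann ends} dataF R_γ v`, where `w` is the restriction of `W`.
`I_h(u_h)` is the case `W = G`, `dataF = (ψ_D, ψ_N)`, `data = (u_D, u_N)`, and `I_h(ψ_h)` the case
`W = F`, `dataF = (u_D, u_N)`, `data = (ψ_D, ψ_N)`. -/
def discreteFunctional (W : ℝ → ℝ) (dataF : Side → ℝ) : ℝ :=
  (∑ k, (d.elem k).restrict W ⬝ᵥ ((d.elem k).H *ᵥ v k)) +
    ∑ k, ∑ γ : Side, match d.nbr γ k, bc γ with
      | some _, _ => 0
      | none, BC.dirichlet =>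
          -(dataF γ * d.fl lam v γ k) + dataF γ * d.TD γ * (d.tr v γ k - data γ)
      | none, BC.neumann => dataF γ * d.tr v γ k

end Discretization

end

/-! Write u for the nodal values of U, and r(x, v) for the residual of the primal discretization at
x tested with v. Adjoint consistency and the symmetry of M give I_h(u) - I_h(u_h) = r(u, ψ_h)
(`discreteFunctional_sub`), hence I(U) - I_h(u_h) = [I(U) - I_h(u) + r(u, ψ)] - r(u, ψ - ψ_h).

In the last term the test vector is O(h^(p+1)), and on an element of scale ρ the residual is of
order ρ^p times the test vector (`residual_estimate`, `abs_face_le`). Summation over the elements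
costs one power of h, which leaves h^(p+1) h^(p-1) = h^(2p).

The bracket is rewritten exactly (`functional_sub_add_residual`) as a sum over elements of three
kinds of terms, each O(ρ^(2p+1)): quadrature errors, since H integrates degree 2p-1 exactly; face
terms, which contain only products of a primal and an adjoint error, because all terms linear in the
errors cancel; and the defect of M(λ) as an approximation of ∫ λ U' ψ'.

The last is the crux: M must be accurate to order 2p although D⁽²⁾ is exact only to low degree.
`formDefect_mono` shows that the defect, trilinear in (λ, U, ψ), vanishes on monomials of total
degree at most 2p+1. If the monomial for U or ψ has degree above p, the other two have low degree,
and exactness of D⁽²⁾ with summation by parts suffices. Otherwise λ may have a degree that exactness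
does not reach; there positive semidefiniteness of the M̄_s forces each M̄_s to see a polynomial of
degree at most p only through its derivative at the node s (`Mbar_mulVec_mono`). A Bramble–Hilbert
argument (`jet_estimate`) passes from monomials to smooth functions.

The second bound is the first one applied to `dual`: under adjoint consistency the discrete adjoint
problem is itself a primal discretization with other SAT coefficients. -/

noncomputable section

/-! ### Taylor expansion and a Bramble–Hilbert estimate for functionals of jets. -/

/-- A function together with its derivative, as a pair of functions. -/
abbrev Jet := (ℝ → ℝ) × (ℝ → ℝ)

namespace Jet

/-- The jet of a function on `[a, b]`. -/
def of (a b : ℝ) (V : ℝ → ℝ) : Jet := (V, derivWithin V (Icc a b))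

/-- The jet of the monomial `(x - c) ^ i`. -/
def mono (c : ℝ) (i : ℕ) : Jet := (fun x => (x - c) ^ i, fun x => i * (x - c) ^ (i - 1))

/-- The jet is bounded by `μ` near `c`, where derivatives are scaled by `ρ`. -/
def BoundedBy (a b c ρ : ℝ) (f : Jet) (μ : ℝ) : Prop :=
  ∀ x ∈ Icc a b, |x - c| ≤ ρ → |f.1 x| ≤ μ ∧ ρ * |f.2 x| ≤ μ

theorem boundedBy_mono (a b c : ℝ) {ρ : ℝ} (hρ : 0 < ρ) (i : ℕ) :
    BoundedBy a b c ρ (mono c i) ((i + 1) * ρ ^ i) := by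
  intro x _ hx
  constructor
  · have : |x - c| ^ i ≤ ρ ^ i := pow_le_pow_left₀ (abs_nonneg _) hx i
    have h2 : 0 ≤ (i : ℝ) * ρ ^ i := by positivity
    simp only [mono, abs_pow]
    linarith
  · rcases i with _ | i
    · simp [mono]
    · have : |x - c| ^ i ≤ ρ ^ i := pow_le_pow_left₀ (abs_nonneg _) hx i
      have h3 : 0 ≤ ρ ^ (i + 1) := by positivity
      simp only [mono, abs_mul, abs_pow, Nat.add_sub_cancel, Nat.abs_cast]
      calc ρ * (((i + 1 : ℕ) : ℝ) * |x - c| ^ i) ≤ ρ * (((i + 1 : ℕ) : ℝ) * ρ ^ i) := by gcongr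
        _ = ((i + 1 : ℕ) : ℝ) * ρ ^ (i + 1) := by ring
        _ ≤ _ := by linarith

end Jet

section Taylor

variable {a b : ℝ}

theorem exists_abs_le_of_continuousOn {V : ℝ → ℝ} (hV : ContinuousOn V (Icc a b)) :
    ∃ K, 0 ≤ K ∧ ∀ x ∈ Icc a b, |V x| ≤ K := by
  obtain ⟨K, hK⟩ := isCompact_Icc.exists_bound_of_continuousOn hV
  exact ⟨|K|, abs_nonneg _, fun x hx => (hK x hx).trans (le_abs_self _)⟩

/-- Mean value inequality on the segment from c to x, where the remainder of W is at most its bound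
at x. -/
theorem taylor_antiderivative {V W : ℝ → ℝ} {N : ℕ} {K c : ℝ} (hK : 0 ≤ K) {t : ℕ → ℝ}
    (hV : ∀ x ∈ Icc a b, HasDerivWithinAt V (W x) (Icc a b) x) (hc : c ∈ Icc a b)
    (hW : ∀ x ∈ Icc a b, |W x - ∑ i ∈ Finset.range N, t i * (x - c) ^ i| ≤ K * |x - c| ^ N)
    {x : ℝ} (hx : x ∈ Icc a b) :
    |V x - V c - ∑ i ∈ Finset.range N, t i / (i + 1) * (x - c) ^ (i + 1)|
      ≤ K * |x - c| ^ (N + 1) := by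
  have hsub : uIcc c x ⊆ Icc a b := uIcc_subset_Icc hc hx
  have key := (convex_uIcc c x).norm_image_sub_le_of_norm_hasDerivWithin_le
    (f := fun y => V y - V c - ∑ i ∈ Finset.range N, t i / (i + 1) * (y - c) ^ (i + 1))
    (f' := fun y => W y - ∑ i ∈ Finset.range N, t i * (y - c) ^ i) (C := K * |x - c| ^ N)
    (x := c) (y := x) ?_ ?_ left_mem_uIcc right_mem_uIcc
  · simp only [Real.norm_eq_abs, sub_self] at key
    rw [pow_succ, ← mul_assoc]
    simpa using key
  · intro y hy
    refine (((hV y (hsub hy)).mono hsub).sub_const _).sub ?_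
    refine HasDerivWithinAt.fun_sum fun i _ => ?_
    have h1 := ((((hasDerivAt_id y).sub_const c).pow (i + 1)).const_mul
      (t i / ((i : ℝ) + 1))).hasDerivWithinAt (s := uIcc c x)
    refine h1.congr_deriv ?_
    have : (i : ℝ) + 1 ≠ 0 := by positivity
    simp
    field_simp
  · intro y hy
    refine (hW y (hsub hy)).trans ?_
    have : |y - c| ≤ |x - c| := abs_sub_left_of_mem_uIcc hy
    gcongr

theorem ContDiffOn.hasDerivWithinAt_Icc {V : ℝ → ℝ} {N : ℕ}
    (hV : ContDiffOn ℝ ((N + 1 : ℕ) : WithTop ℕ∞) V (Icc a b)) {x : ℝ} (hx : x ∈ Icc a b) :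
    HasDerivWithinAt V (derivWithin V (Icc a b) x) (Icc a b) x :=
  ((hV.differentiableOn (by simp)) x hx).hasDerivWithinAt

theorem ContDiffOn.derivWithin_Icc (hab : a < b) {V : ℝ → ℝ} {N : ℕ}
    (hV : ContDiffOn ℝ ((N + 1 : ℕ) : WithTop ℕ∞) V (Icc a b)) :
    ContDiffOn ℝ (N : WithTop ℕ∞) (derivWithin V (Icc a b)) (Icc a b) :=
  hV.derivWithin (uniqueDiffOn_Icc hab) (by push_cast; rfl)

/-- The expansion of V' is integrated termwise, so one polynomial serves both V and V'. What matters
later is that K does not depend on the centre c. -/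
theorem exists_taylor (hab : a < b) (N : ℕ) : ∀ V : ℝ → ℝ,
    ContDiffOn ℝ (N : WithTop ℕ∞) V (Icc a b) → ∃ K, 0 ≤ K ∧ ∀ c ∈ Icc a b, ∃ s : ℕ → ℝ,
      (∀ i, |s i| ≤ K) ∧
      (∀ x ∈ Icc a b, |V x - ∑ i ∈ Finset.range N, s i * (x - c) ^ i| ≤ K * |x - c| ^ N) ∧
      (1 ≤ N → ∀ x ∈ Icc a b, |derivWithin V (Icc a b) x -
        ∑ i ∈ Finset.range N, s i * (i * (x - c) ^ (i - 1))| ≤ K * |x - c| ^ (N - 1)) := by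
  induction N with
  | zero =>
    intro V hV
    obtain ⟨K, hK0, hK⟩ := exists_abs_le_of_continuousOn hV.continuousOn
    exact ⟨K, hK0, fun c _ => ⟨0, by simpa using hK0, by simpa using hK, by simp⟩⟩
  | succ N ih =>
    intro V hV
    obtain ⟨K, hK0, hK⟩ := ih _ (hV.derivWithin_Icc hab)
    obtain ⟨K', hK0', hK'⟩ := exists_abs_le_of_continuousOn hV.continuousOn
    refine ⟨K + K', by positivity, fun c hc => ?_⟩
    obtain ⟨t, ht, htW, -⟩ := hK c hc
    refine ⟨fun i => if i = 0 then V c else t (i - 1) / i, fun i => ?_, fun x hx => ?_,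
      fun _ x hx => ?_⟩
    · rcases i with _ | i
      · simpa using (hK' c hc).trans (by linarith)
      · have h1 : |t i| / |((i + 1 : ℕ) : ℝ)| ≤ |t i| := by
          apply div_le_self (abs_nonneg _)
          rw [Nat.abs_cast]
          exact_mod_cast Nat.succ_le_succ (Nat.zero_le i)
        have h2 := ht i
        simp only [Nat.add_eq_zero_iff, one_ne_zero, and_false, if_false, Nat.add_sub_cancel,
          abs_div]
        linarith
    · have h1 := taylor_antiderivative hK0 (fun x hx => hV.hasDerivWithinAt_Icc hx) hc htW hx
      rw [Finset.sum_range_succ']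
      have h2 : V x - (∑ i ∈ Finset.range N, (if i + 1 = 0 then V c else
          t (i + 1 - 1) / ((i + 1 : ℕ) : ℝ)) * (x - c) ^ (i + 1) +
          (if (0 : ℕ) = 0 then V c else t (0 - 1) / ((0 : ℕ) : ℝ)) * (x - c) ^ 0) =
          V x - V c - ∑ i ∈ Finset.range N, t i / (i + 1) * (x - c) ^ (i + 1) := by
        simp
        ring
      rw [h2]
      refine h1.trans ?_
      gcongr
      linarith
    · have h1 := htW x hx
      rw [Finset.sum_range_succ']
      have h2 : ∑ i ∈ Finset.range N, (if i + 1 = 0 then V c else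
          t (i + 1 - 1) / ((i + 1 : ℕ) : ℝ)) * (((i + 1 : ℕ) : ℝ) * (x - c) ^ (i + 1 - 1)) +
          (if (0 : ℕ) = 0 then V c else t (0 - 1) / ((0 : ℕ) : ℝ)) *
            (((0 : ℕ) : ℝ) * (x - c) ^ (0 - 1)) = ∑ i ∈ Finset.range N, t i * (x - c) ^ i := by
        simp only [Nat.cast_zero, zero_mul, mul_zero, add_zero]
        refine Finset.sum_congr rfl fun i _ => ?_
        have : ((i + 1 : ℕ) : ℝ) ≠ 0 := by positivity
        simp only [Nat.add_eq_zero_iff, one_ne_zero, and_false, if_false, Nat.add_sub_cancel]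
        field_simp
      rw [h2]
      refine h1.trans ?_
      simp only [Nat.add_sub_cancel]
      gcongr
      linarith

/-- A linear functional of jets that is small on monomials of degree less than `m` and bounded is
small on functions of class `C ^ m`. -/
theorem jet_estimate (hab : a < b) {V : ℝ → ℝ} {N : ℕ}
    (hV : ContDiffOn ℝ (N : WithTop ℕ∞) V (Icc a b)) :
    ∃ K, 0 ≤ K ∧ ∀ m, 1 ≤ m → m ≤ N → ∀ c ∈ Icc a b, ∀ ρ, 0 < ρ → ∀ L : Jet → ℝ,
      IsLinearMap ℝ L → ∀ B B' : ℝ, 0 ≤ B' → (∀ i < m, |L (Jet.mono c i)| ≤ B) →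
      (∀ f μ, Jet.BoundedBy a b c ρ f μ → |L f| ≤ B' * μ) → B' * ρ ^ m ≤ B →
      |L (Jet.of a b V)| ≤ K * B := by
  -- All orders m ≤ N are treated with one constant: for multilinear forms the order used in one
  -- argument depends on the monomials in the others.
  have hT : ∀ m : ℕ, m ≤ N → _ := fun m hm =>
    exists_taylor hab m V (hV.of_le (by exact_mod_cast hm))
  choose! K hK0 hK using hT
  have hKnn : ∀ m ∈ Finset.range (N + 1), 0 ≤ K m := fun m hm =>
    hK0 m (Nat.lt_succ_iff.mp (Finset.mem_range.mp hm))
  refine ⟨(N + 1) * ∑ m ∈ Finset.range (N + 1), K m,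
    mul_nonneg (by positivity) (Finset.sum_nonneg hKnn), ?_⟩
  intro m hm1 hmN c hc ρ hρ L hL B B' hB' hmono hbdd hB
  obtain ⟨s, hs, hs0, hs1⟩ := hK m hmN c hc
  have hBnn : 0 ≤ B := le_trans (by positivity) hB
  have hKm : K m ≤ ∑ m ∈ Finset.range (N + 1), K m :=
    Finset.single_le_sum hKnn (Finset.mem_range.mpr (Nat.lt_succ_of_le hmN))
  set P : Jet := ∑ i ∈ Finset.range m, s i • Jet.mono c i with hP
  have hLP : L P = ∑ i ∈ Finset.range m, s i * L (Jet.mono c i) := by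
    have : L P = (hL.mk' L) P := rfl
    rw [this, hP, map_sum]
    simp
  have hsplit : L (Jet.of a b V) = L P + L (Jet.of a b V - P) := by
    rw [← hL.map_add]; congr 1; abel
  have hP1 : ∀ x, P.1 x = ∑ i ∈ Finset.range m, s i * (x - c) ^ i := by
    intro x; simp [hP, Jet.mono, Prod.fst_sum, Finset.sum_apply]
  have hP2 : ∀ x, P.2 x = ∑ i ∈ Finset.range m, s i * (i * (x - c) ^ (i - 1)) := by
    intro x; simp [hP, Jet.mono, Prod.snd_sum, Finset.sum_apply]
  have hrem : Jet.BoundedBy a b c ρ (Jet.of a b V - P) (K m * ρ ^ m) := by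
    intro x hx hxc
    have hKm0 := hK0 m hmN
    constructor
    · have : (Jet.of a b V - P).1 x = V x - ∑ i ∈ Finset.range m, s i * (x - c) ^ i := by
        rw [← hP1]; rfl
      rw [this]
      refine (hs0 x hx).trans ?_
      gcongr
    · have : (Jet.of a b V - P).2 x = derivWithin V (Icc a b) x -
          ∑ i ∈ Finset.range m, s i * (i * (x - c) ^ (i - 1)) := by
        rw [← hP2]; rfl
      rw [this]
      calc _ ≤ ρ * (K m * |x - c| ^ (m - 1)) := by
            gcongr; exact hs1 hm1 x hx
        _ ≤ ρ * (K m * ρ ^ (m - 1)) := by gcongr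
        _ = K m * ρ ^ m := by
            obtain ⟨k, rfl⟩ : ∃ k, m = k + 1 := ⟨m - 1, by omega⟩
            simp only [Nat.add_sub_cancel]; ring
  have h1 : |L P| ≤ m * (K m * B) := by
    rw [hLP]
    refine (Finset.abs_sum_le_sum_abs _ _).trans ?_
    refine (Finset.sum_le_card_nsmul _ _ (K m * B) fun i hi => ?_).trans (by simp)
    rw [abs_mul]
    exact mul_le_mul (hs i) (hmono i (Finset.mem_range.mp hi)) (abs_nonneg _) (hK0 m hmN)
  have h2 : |L (Jet.of a b V - P)| ≤ K m * B := by
    refine (hbdd _ _ hrem).trans ?_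
    calc B' * (K m * ρ ^ m) = K m * (B' * ρ ^ m) := by ring
      _ ≤ _ := mul_le_mul_of_nonneg_left hB (hK0 m hmN)
  have hmN' : (m : ℝ) ≤ N := by exact_mod_cast hmN
  calc |L (Jet.of a b V)| ≤ |L P| + |L (Jet.of a b V - P)| := by
        rw [hsplit]; exact abs_add_le _ _
    _ ≤ (m + 1) * (K m * B) := by linarith
    _ ≤ (N + 1) * ((∑ m ∈ Finset.range (N + 1), K m) * B) := by
        have := hK0 m hmN
        gcongr
    _ = _ := by ring

end Taylor

end

/-! ### Exactness of the operators of one element on monomials. -/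

noncomputable section

theorem pow_mul_pow_derivative (y : ℝ) (s t : ℕ) :
    ((s + t : ℕ) : ℝ) * y ^ (s + t - 1) =
      (s * y ^ (s - 1)) * y ^ t + y ^ s * (t * y ^ (t - 1)) := by
  rcases s with _ | s
  · simp
  rcases t with _ | t
  · simp
  · have : s + 1 + (t + 1) - 1 = s + t + 1 := by omega
    simp only [this, Nat.add_sub_cancel]
    push_cast
    ring

namespace SBPElement

variable {n : ℕ} (E : SBPElement n)

@[simp] theorem restrict_apply (f : ℝ → ℝ) (i : Fin n) : E.restrict f i = f (E.node i) := rfl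

theorem dotProduct_H_mulVec (v q : Fin n → ℝ) : v ⬝ᵥ (E.H *ᵥ q) = ∑ i, E.w i * v i * q i := by
  simp only [dotProduct, H, mulVec_diagonal]
  exact Finset.sum_congr rfl fun i _ => by ring

theorem dotProduct_Emat_mulVec (v q : Fin n → ℝ) :
    v ⬝ᵥ (E.Emat *ᵥ q) = ∑ γ : Side, γ.normal * ((E.R γ ⬝ᵥ v) * (E.R γ ⬝ᵥ q)) := by
  simp only [Emat, Matrix.sum_mulVec, dotProduct_sum, Matrix.smul_mulVec, dotProduct_smul,
    smul_eq_mul]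
  refine Finset.sum_congr rfl fun γ _ => ?_
  rw [Matrix.vecMulVec_mulVec]
  simp only [dotProduct_smul, MulOpposite.smul_eq_mul_unop, MulOpposite.unop_op]
  rw [dotProduct_comm v]

theorem dotProduct_M_mulVec (lam : ℝ → ℝ) (v u : Fin n → ℝ) :
    v ⬝ᵥ (E.M lam *ᵥ u) = ∑ l, lam (E.node l) * (v ⬝ᵥ (E.Mbar l *ᵥ u)) := by
  simp only [M, Matrix.sum_mulVec, dotProduct_sum, Matrix.smul_mulVec, dotProduct_smul,
    smul_eq_mul]

theorem dotProduct_Dn (lam : ℝ → ℝ) (γ : Side) (u : Fin n → ℝ) :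
    E.Dn lam γ ⬝ᵥ u =
      γ.normal * ∑ i, E.R γ i * (lam (E.node i) * (E.Db *ᵥ u) i) := by
  rw [Dn, smul_dotProduct, smul_eq_mul, ← Matrix.dotProduct_mulVec, ← Matrix.mulVec_mulVec]
  simp only [dotProduct, Lam, mulVec_diagonal, restrict_apply]

variable {E} {p : ℕ}

namespace IsSBP

theorem isUnit_det_H (hE : E.IsSBP p) : IsUnit E.H.det := by
  rw [H, Matrix.det_diagonal]
  exact (Finset.prod_ne_zero_iff.mpr fun i _ => (hE.w_pos i).ne').isUnit

/-- H D = S + E/2, and adding the transpose cancels the skew part. -/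
theorem Emat_eq (hE : E.IsSBP p) : E.Emat = E.H * E.D + E.Dᵀ * E.H := by
  obtain ⟨S, hS, hD⟩ := hE.decomposition
  have hHt : (E.H)ᵀ = E.H := Matrix.diagonal_transpose _
  have hEt : (E.Emat)ᵀ = E.Emat := by
    simp [Emat, Matrix.transpose_sum, Matrix.transpose_vecMulVec]
  have hHD : E.H * E.D = S + (1 / 2 : ℝ) • E.Emat := by
    rw [hD, Matrix.mul_nonsing_inv_cancel_left _ _ hE.isUnit_det_H]
  have hDH : E.Dᵀ * E.H = -S + (1 / 2 : ℝ) • E.Emat := by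
    have := congrArg Matrix.transpose hHD
    rwa [Matrix.transpose_mul, hHt, Matrix.transpose_add, hS, Matrix.transpose_smul, hEt] at this
  rw [hHD, hDH]
  module

/-- Summation by parts. -/
theorem sum_by_parts (hE : E.IsSBP p) (v q : Fin n → ℝ) :
    ∑ i, E.w i * (E.D *ᵥ v) i * q i + ∑ i, E.w i * v i * (E.D *ᵥ q) i =
      ∑ γ : Side, γ.normal * ((E.R γ ⬝ᵥ v) * (E.R γ ⬝ᵥ q)) := by
  rw [← dotProduct_Emat_mulVec, hE.Emat_eq, ← dotProduct_H_mulVec, ← dotProduct_H_mulVec,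
    Matrix.add_mulVec, dotProduct_add, ← Matrix.mulVec_mulVec, ← Matrix.mulVec_mulVec,
    Matrix.dotProduct_mulVec v E.Dᵀ, Matrix.vecMul_transpose, add_comm]

theorem H_mulVec_D2 (hE : E.IsSBP p) (lam : ℝ → ℝ) (v u : Fin n → ℝ) :
    ∑ i, E.w i * v i * (E.D2 lam *ᵥ u) i =
      -(v ⬝ᵥ (E.M lam *ᵥ u)) + ∑ γ : Side, (E.R γ ⬝ᵥ v) * (E.Dn lam γ ⬝ᵥ u) := by
  rw [← dotProduct_H_mulVec, Matrix.mulVec_mulVec, D2,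
    Matrix.mul_nonsing_inv_cancel_left _ _ hE.isUnit_det_H, Matrix.add_mulVec, dotProduct_add,
    Matrix.neg_mulVec, dotProduct_neg, Matrix.mul_assoc, ← Matrix.mulVec_mulVec,
    dotProduct_Emat_mulVec]
  congr 1
  refine Finset.sum_congr rfl fun γ _ => ?_
  rw [Dn, smul_dotProduct, smul_eq_mul, ← Matrix.dotProduct_mulVec]
  ring

theorem D_mono (hE : E.IsSBP p) (c : ℝ) {m : ℕ} (hm : m ≤ p) :
    E.D *ᵥ E.restrict (Jet.mono c m).1 = E.restrict (Jet.mono c m).2 := by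
  have := hE.accurate ((X - C c) ^ m) (by simpa using hm)
  simpa [Polynomial.derivative_X_sub_C_pow, Jet.mono] using this

theorem R_mono (hE : E.IsSBP p) (c : ℝ) {m : ℕ} (hm : m ≤ p) (γ : Side) :
    E.R γ ⬝ᵥ E.restrict (Jet.mono c m).1 = (Jet.mono c m).1 (E.bdry γ) := by
  have := hE.extrapolation γ ((X - C c) ^ m) (by simpa using hm)
  simpa [Jet.mono] using this

/-- The norm matrix is a quadrature rule of degree `2 p - 1`. -/
theorem quadrature_mono (hE : E.IsSBP p) (c : ℝ) {m : ℕ} (hm : m ≤ 2 * p) :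
    ∑ i, E.w i * (Jet.mono c m).2 (E.node i) =
      ∑ γ : Side, γ.normal * (Jet.mono c m).1 (E.bdry γ) := by
  -- Two factors of degree at most p, on which D and R are exact, are fed to summation by parts;
  -- this doubles the degree.
  obtain ⟨s, t, hs, ht, rfl⟩ : ∃ s t, s ≤ p ∧ t ≤ p ∧ m = s + t :=
    ⟨min m p, m - min m p, by omega, by omega, by omega⟩
  have h := hE.sum_by_parts (E.restrict (Jet.mono c s).1) (E.restrict (Jet.mono c t).1)
  rw [hE.D_mono c hs, hE.D_mono c ht, ← Finset.sum_add_distrib] at h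
  simp only [hE.R_mono c hs, hE.R_mono c ht] at h
  calc _ = _ := Finset.sum_congr rfl fun i _ => ?_
    _ = _ := h
    _ = _ := Finset.sum_congr rfl fun γ _ => ?_
  · simp only [Jet.mono, restrict_apply, pow_mul_pow_derivative]
    ring
  · simp only [Jet.mono, pow_add]

theorem Mbar_posSemidef (hE : E.IsSBP p) (hk : E.IsNarrow p ∨ E.IsWide) (l : Fin n) :
    (E.Mbar l).PosSemidef := by
  rcases hk with hk | hk
  · exact hk.posSemidef l
  · rw [hk.Mbar_eq]
    have := Matrix.posSemidef_vecMulVec_self_star (R := ℝ) (E.D l)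
    rw [star_trivial] at this
    exact this.smul (hE.w_pos l).le

theorem Mbar_symm (hE : E.IsSBP p) (hk : E.IsNarrow p ∨ E.IsWide) (l : Fin n)
    (u v : Fin n → ℝ) : v ⬝ᵥ (E.Mbar l *ᵥ u) = u ⬝ᵥ (E.Mbar l *ᵥ v) := by
  have h := (hE.Mbar_posSemidef hk l).isHermitian
  rw [Matrix.IsHermitian, Matrix.conjTranspose_eq_transpose_of_trivial] at h
  rw [Matrix.dotProduct_mulVec, ← Matrix.mulVec_transpose, h, dotProduct_comm]

theorem M_symm (hE : E.IsSBP p) (hk : E.IsNarrow p ∨ E.IsWide) (lam : ℝ → ℝ)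
    (u v : Fin n → ℝ) : v ⬝ᵥ (E.M lam *ᵥ u) = u ⬝ᵥ (E.M lam *ᵥ v) := by
  simp only [dotProduct_M_mulVec, hE.Mbar_symm hk _ u v]

/-- The discrete form of ∫ λ P' v' = [λ P' v] - ∫ (λ P')' v with arbitrary v. For the narrow stencil
this is exactness of D⁽²⁾ and D_b; for the wide one, λ P' has degree at most p and D is exact on P
and on λ P'. From here on the two kinds of operators need no distinction in degree. -/
theorem M_mulVec_mono (hE : E.IsSBP p) (hk : E.IsNarrow p ∨ E.IsWide) (c : ℝ) {i j : ℕ}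
    (hi : i ≤ p) (hij : i + j ≤ p + 1) (v : Fin n → ℝ) :
    v ⬝ᵥ (E.M (Jet.mono c j).1 *ᵥ E.restrict (Jet.mono c i).1) =
      ∑ γ : Side, γ.normal * ((E.R γ ⬝ᵥ v) * (i * (Jet.mono c (j + (i - 1))).1 (E.bdry γ))) -
      ∑ l, E.w l * v l * (i * (Jet.mono c (j + (i - 1))).2 (E.node l)) := by
  have hprod : ((X - C c) ^ j * derivative ((X - C c) ^ i) : ℝ[X]) =
      C (i : ℝ) * (X - C c) ^ (j + (i - 1)) := by
    rw [Polynomial.derivative_X_sub_C_pow, pow_add]; ring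
  have hdeg : (C (i : ℝ) * (X - C c) ^ (j + (i - 1)) : ℝ[X]).natDegree ≤ p := by
    rcases i with _ | i
    · simp
    · exact (natDegree_C_mul_le _ _).trans (by simp; omega)
  have heval : ∀ x, (C (i : ℝ) * (X - C c) ^ (j + (i - 1)) : ℝ[X]).eval x =
      i * (Jet.mono c (j + (i - 1))).1 x := by
    intro x; simp [Jet.mono]
  have heval' : ∀ x, (derivative (C (i : ℝ) * (X - C c) ^ (j + (i - 1)) : ℝ[X])).eval x =
      i * (Jet.mono c (j + (i - 1))).2 x := by
    intro x
    rw [Polynomial.derivative_C_mul, Polynomial.derivative_X_sub_C_pow]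
    simp [Jet.mono]
  have hR : ∀ γ, E.R γ ⬝ᵥ E.restrict (fun x => i * (Jet.mono c (j + (i - 1))).1 x) =
      i * (Jet.mono c (j + (i - 1))).1 (E.bdry γ) := by
    intro γ
    have := hE.extrapolation γ _ hdeg
    simpa only [heval] using this
  rcases hk with hk | hk
  · have h := hk.accurate ((X - C c) ^ j) ((X - C c) ^ i) (by
      rw [← pow_add]; simpa [add_comm] using hij)
    rw [hprod] at h
    simp only [heval'] at h
    have e1 : (fun x => ((X - C c) ^ j : ℝ[X]).eval x) = (Jet.mono c j).1 := by
      ext; simp [Jet.mono]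
    have e2 : (fun x => ((X - C c) ^ i : ℝ[X]).eval x) = (Jet.mono c i).1 := by
      ext; simp [Jet.mono]
    rw [e1, e2] at h
    have h2 := hE.H_mulVec_D2 (Jet.mono c j).1 v (E.restrict (Jet.mono c i).1)
    rw [h] at h2
    have h3 : ∀ γ, E.Dn (Jet.mono c j).1 γ ⬝ᵥ E.restrict (Jet.mono c i).1 =
        γ.normal * (i * (Jet.mono c (j + (i - 1))).1 (E.bdry γ)) := by
      intro γ
      rw [dotProduct_Dn, ← hR, dotProduct]
      congr 1
      refine Finset.sum_congr rfl fun l _ => ?_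
      -- Exactness of D_b is known only in rows that some R sees; this row drops out of the sum
      -- otherwise.
      by_cases hl : E.R γ l = 0
      · simp [hl]
      · have h4 := hk.Db_accurate ((X - C c) ^ i) (by simp; omega) l ⟨γ, hl⟩
        rw [e2] at h4
        rw [h4, Polynomial.derivative_X_sub_C_pow]
        simp only [eval_mul, eval_C, eval_pow, eval_sub, eval_X, Jet.mono, pow_add, restrict_apply]
        ring
    simp only [h3, restrict_apply] at h2
    rw [h2]
    simp only [mul_left_comm]
    ring
  · have h5 : E.D *ᵥ E.restrict (fun x => i * (Jet.mono c (j + (i - 1))).1 x) =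
        E.restrict (fun x => i * (Jet.mono c (j + (i - 1))).2 x) := by
      have := hE.accurate _ hdeg
      simpa only [heval, heval'] using this
    have h6 := hE.sum_by_parts v (E.restrict (fun x => i * (Jet.mono c (j + (i - 1))).1 x))
    rw [h5] at h6
    simp only [hR, restrict_apply] at h6
    rw [← h6, add_sub_cancel_right, M_eq_of_isWide E hk, ← Matrix.mulVec_mulVec,
      hE.D_mono c hi, Matrix.mul_assoc, ← Matrix.mulVec_mulVec, Matrix.dotProduct_mulVec,
      Matrix.vecMul_transpose, ← Matrix.mulVec_mulVec, dotProduct_H_mulVec]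
    refine Finset.sum_congr rfl fun l _ => ?_
    simp only [Lam, mulVec_diagonal, restrict_apply, Jet.mono, pow_add]
    ring

/-- The integration by parts in `M_mulVec_mono` is undone by the quadrature rule, exact for the
derivative of the product of degree i+j+l-1 ≤ 2p. -/
theorem M_mono_mono (hE : E.IsSBP p) (hk : E.IsNarrow p ∨ E.IsWide) (c : ℝ) {i j l : ℕ}
    (hi : i ≤ p) (hl : l ≤ p) (hij : i + j ≤ p + 1) (hijl : i + j + l ≤ 2 * p + 1) :
    ∑ s, (Jet.mono c j).1 (E.node s) * (E.restrict (Jet.mono c l).1 ⬝ᵥ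
        (E.Mbar s *ᵥ E.restrict (Jet.mono c i).1)) =
      ∑ s, E.w s * ((Jet.mono c j).1 (E.node s) *
        ((Jet.mono c l).2 (E.node s) * (Jet.mono c i).2 (E.node s))) := by
  rw [← dotProduct_M_mulVec, hE.M_mulVec_mono hk c hi hij]
  simp only [hE.R_mono c hl]
  rcases i with _ | i
  · simp [Jet.mono]
  have hq := hE.quadrature_mono c (m := l + (j + i)) (by omega)
  have e : ∀ γ : Side, γ.normal * ((Jet.mono c l).1 (E.bdry γ) *
      (((i + 1 : ℕ) : ℝ) * (Jet.mono c (j + (i + 1 - 1))).1 (E.bdry γ))) =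
      ((i + 1 : ℕ) : ℝ) * (γ.normal * (Jet.mono c (l + (j + i))).1 (E.bdry γ)) := by
    intro γ
    simp only [Jet.mono, Nat.add_sub_cancel, pow_add]
    ring
  simp only [e]
  rw [← Finset.mul_sum, ← hq, Finset.mul_sum, ← Finset.sum_sub_distrib]
  refine Finset.sum_congr rfl fun s _ => ?_
  simp only [Jet.mono, Nat.add_sub_cancel, pow_mul_pow_derivative _ l (j + i), restrict_apply]
  rw [pow_add _ j i]
  ring

/-- A vanishing sum of nonnegative quadratic forms vanishes term by term, and a null vector of a
semidefinite form lies in its kernel. One scalar identity thus gives information on every M̄_s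
separately. -/
theorem Mbar_mulVec_eq_zero (hE : E.IsSBP p) (hk : E.IsNarrow p ∨ E.IsWide)
    {z : Fin n → Fin n → ℝ} (hz : ∑ s, z s ⬝ᵥ (E.Mbar s *ᵥ z s) = 0) (s : Fin n) :
    E.Mbar s *ᵥ z s = 0 := by
  have hnn : ∀ s ∈ Finset.univ, 0 ≤ z s ⬝ᵥ (E.Mbar s *ᵥ z s) := fun s _ => by
    simpa using (hE.Mbar_posSemidef hk s).dotProduct_mulVec_nonneg (z s)
  have h := (Finset.sum_eq_zero_iff_of_nonneg hnn).mp hz s (Finset.mem_univ s)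
  exact ((hE.Mbar_posSemidef hk s).dotProduct_mulVec_zero_iff (z s)).mp (by simpa using h)

theorem Mbar_mulVec_one (hE : E.IsSBP p) (hk : E.IsNarrow p ∨ E.IsWide) (c : ℝ) (s : Fin n) :
    E.Mbar s *ᵥ E.restrict (Jet.mono c 0).1 = 0 := by
  refine hE.Mbar_mulVec_eq_zero hk (z := fun _ => E.restrict (Jet.mono c 0).1) ?_ s
  have := hE.M_mono_mono hk c (i := 0) (j := 0) (l := 0) (by omega) (by omega) (by omega)
    (by omega)
  simpa [Jet.mono] using this

/-- The polynomial m (x-c)^(m+1) - (m+1)(x_s-c)(x-c)^m has zero derivative at x_s, hence should be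
in the kernel of M̄_s. The sum over s of its quadratic forms expands into terms where λ has degree
at most 2, within reach of `M_mono_mono`, and the corresponding quadrature sum is zero node by node.
-/
theorem Mbar_mulVec_succ (hE : E.IsSBP p) (hk : E.IsNarrow p ∨ E.IsWide) (c : ℝ) {m : ℕ}
    (hm : 1 ≤ m) (hmp : m + 1 ≤ p) (s : Fin n) :
    (m : ℝ) • (E.Mbar s *ᵥ E.restrict (Jet.mono c (m + 1)).1) =
      ((m + 1) * (E.node s - c)) • (E.Mbar s *ᵥ E.restrict (Jet.mono c m).1) := by
  set y := E.restrict (Jet.mono c m).1 with hy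
  set y' := E.restrict (Jet.mono c (m + 1)).1 with hy'
  have key := hE.Mbar_mulVec_eq_zero hk
    (z := fun s => (m : ℝ) • y' - (((m : ℝ) + 1) * (E.node s - c)) • y) ?_ s
  · rw [Matrix.mulVec_sub, Matrix.mulVec_smul, Matrix.mulVec_smul, sub_eq_zero] at key
    exact key
  have h0 := hE.M_mono_mono hk c (i := m + 1) (j := 0) (l := m + 1) (by omega) (by omega)
    (by omega) (by omega)
  have h1 := hE.M_mono_mono hk c (i := m) (j := 1) (l := m + 1) (by omega) (by omega)
    (by omega) (by omega)
  have h1' := hE.M_mono_mono hk c (i := m + 1) (j := 1) (l := m) (by omega) (by omega)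
    (by omega) (by omega)
  have h2 := hE.M_mono_mono hk c (i := m) (j := 2) (l := m) (by omega) (by omega)
    (by omega) (by omega)
  rw [← hy] at h1 h1' h2
  rw [← hy'] at h0 h1 h1'
  have hexp : ∀ s, ((m : ℝ) • y' - (((m : ℝ) + 1) * (E.node s - c)) • y) ⬝ᵥ
      (E.Mbar s *ᵥ ((m : ℝ) • y' - (((m : ℝ) + 1) * (E.node s - c)) • y)) =
      (m : ℝ) ^ 2 * ((Jet.mono c 0).1 (E.node s) * (y' ⬝ᵥ (E.Mbar s *ᵥ y'))) -
      m * (m + 1) * ((Jet.mono c 1).1 (E.node s) * (y' ⬝ᵥ (E.Mbar s *ᵥ y))) -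
      m * (m + 1) * ((Jet.mono c 1).1 (E.node s) * (y ⬝ᵥ (E.Mbar s *ᵥ y'))) +
      (m + 1) ^ 2 * ((Jet.mono c 2).1 (E.node s) * (y ⬝ᵥ (E.Mbar s *ᵥ y))) := by
    intro s
    simp only [Matrix.mulVec_sub, Matrix.mulVec_smul, dotProduct_sub, sub_dotProduct,
      smul_dotProduct, dotProduct_smul, smul_eq_mul, Jet.mono]
    ring
  simp only [hexp, Finset.sum_add_distrib, Finset.sum_sub_distrib, ← Finset.mul_sum]
  rw [h0, h1, h1', h2]
  simp only [Finset.mul_sum, ← Finset.sum_add_distrib, ← Finset.sum_sub_distrib]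
  refine Finset.sum_eq_zero fun s _ => ?_
  obtain ⟨k, rfl⟩ : ∃ k, m = k + 1 := ⟨m - 1, by omega⟩
  simp only [Jet.mono, Nat.add_sub_cancel]
  push_cast
  ring

/-- By positivity, `M̄_s` sees a polynomial only through its derivative at the node `s`. -/
theorem Mbar_mulVec_mono (hE : E.IsSBP p) (hk : E.IsNarrow p ∨ E.IsWide) (c : ℝ) {m : ℕ}
    (hmp : m ≤ p) (s : Fin n) :
    E.Mbar s *ᵥ E.restrict (Jet.mono c m).1 =
      (Jet.mono c m).2 (E.node s) • (E.Mbar s *ᵥ E.restrict (Jet.mono c 1).1) := by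
  induction m with
  | zero => rw [hE.Mbar_mulVec_one hk]; simp [Jet.mono]
  | succ m ih =>
    rcases m with _ | m
    · simp [Jet.mono]
    · have h := hE.Mbar_mulVec_succ hk c (m := m + 1) (by omega) (by omega) s
      rw [ih (by omega), smul_smul] at h
      have hm : ((m + 1 : ℕ) : ℝ) ≠ 0 := by positivity
      rw [← smul_right_injective _ hm |>.eq_iff]
      rw [h, smul_smul]
      congr 1
      simp only [Jet.mono, Nat.add_sub_cancel]
      push_cast
      ring

/-- The power (x_s-c)^t may be distributed at will between λ and the test polynomial, since M̄_s
sees the latter only through its derivative. So λ of high degree is traded for a test polynomial of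
higher degree, where exactness is available. -/
theorem sum_Mbar_pow (hE : E.IsSBP p) (hp : 1 ≤ p) (hk : E.IsNarrow p ∨ E.IsWide) (c : ℝ)
    {t : ℕ} (ht : t + 1 ≤ 2 * p) :
    ∑ s, (E.node s - c) ^ t * (E.restrict (Jet.mono c 1).1 ⬝ᵥ
      (E.Mbar s *ᵥ E.restrict (Jet.mono c 1).1)) = ∑ s, E.w s * (E.node s - c) ^ t := by
  -- The test polynomial of degree l+1 takes as much as possible; the rest j ≤ p is within the
  -- degree i + j ≤ p + 1 allowed for λ P with i = 1.
  obtain ⟨l, j, hl, hj, rfl⟩ : ∃ l j, l + 1 ≤ p ∧ j ≤ p ∧ t = j + l :=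
    ⟨min t (p - 1), t - min t (p - 1), by omega, by omega, by omega⟩
  have h := hE.M_mono_mono hk c (i := 1) (j := j) (l := l + 1) hp hl (by omega) (by omega)
  have e : ∀ s, (Jet.mono c j).1 (E.node s) * (E.restrict (Jet.mono c (l + 1)).1 ⬝ᵥ
      (E.Mbar s *ᵥ E.restrict (Jet.mono c 1).1)) = ((l + 1 : ℕ) : ℝ) *
        ((E.node s - c) ^ (j + l) * (E.restrict (Jet.mono c 1).1 ⬝ᵥ
      (E.Mbar s *ᵥ E.restrict (Jet.mono c 1).1))) := by
    intro s
    rw [hE.Mbar_symm hk, hE.Mbar_mulVec_mono hk c hl, dotProduct_smul, smul_eq_mul]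
    simp only [Jet.mono, Nat.add_sub_cancel, pow_add]
    ring
  have e' : ∀ s, E.w s * ((Jet.mono c j).1 (E.node s) *
        ((Jet.mono c (l + 1)).2 (E.node s) * (Jet.mono c 1).2 (E.node s))) =
        ((l + 1 : ℕ) : ℝ) * (E.w s * (E.node s - c) ^ (j + l)) := by
    intro s
    simp only [Jet.mono, Nat.add_sub_cancel, pow_add, pow_one, Nat.cast_one, tsub_self, pow_zero]
    ring
  simp only [e, e', ← Finset.mul_sum] at h
  exact mul_left_cancel₀ (by positivity) h

end IsSBP

/-- The defect of `M(f)` as an approximation of the form `∫ f u' v'` on the element, corrected by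
the extrapolation errors at its ends. -/
def formDefect (E : SBPElement n) (f u v : Jet) : ℝ :=
  E.restrict v.1 ⬝ᵥ (E.M f.1 *ᵥ E.restrict u.1) -
    ∑ i, E.w i * (f.1 (E.node i) * (u.2 (E.node i) * v.2 (E.node i))) -
    ∑ γ : Side, γ.normal * (f.1 (E.bdry γ) *
      (u.2 (E.bdry γ) * (E.R γ ⬝ᵥ E.restrict v.1 - v.1 (E.bdry γ)) +
        v.2 (E.bdry γ) * (E.R γ ⬝ᵥ E.restrict u.1 - u.1 (E.bdry γ))))

namespace IsSBP

theorem formDefect_symm (hE : E.IsSBP p) (hk : E.IsNarrow p ∨ E.IsWide) (f u v : Jet) :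
    E.formDefect f u v = E.formDefect f v u := by
  unfold formDefect
  rw [hE.M_symm hk]
  congr 1
  · congr 1
    exact Finset.sum_congr rfl fun i _ => by ring
  · exact Finset.sum_congr rfl fun γ _ => by ring

theorem formDefect_one (hE : E.IsSBP p) (hk : E.IsNarrow p ∨ E.IsWide) (c : ℝ) (f v : Jet) :
    E.formDefect f (Jet.mono c 0) v = 0 := by
  simp only [formDefect, dotProduct_M_mulVec, hE.Mbar_mulVec_one hk, hE.R_mono c (Nat.zero_le p)]
  simp [Jet.mono]

/-- Now j + l ≤ p, so M can be applied to the factor of degree l. R is not exact on the factor of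
degree i; the correction in `formDefect` replaces its extrapolated value by the true end value,
after which quadrature is exact. -/
theorem formDefect_mono_aux (hE : E.IsSBP p) (hk : E.IsNarrow p ∨ E.IsWide) (c : ℝ)
    {i j l : ℕ} (hi : p < i) (hijl : i + j + l ≤ 2 * p + 1) :
    E.formDefect (Jet.mono c j) (Jet.mono c i) (Jet.mono c l) = 0 := by
  have hl : l ≤ p := by omega
  rcases l with _ | l
  · rw [hE.formDefect_symm hk, hE.formDefect_one hk]
  rw [formDefect, hE.M_symm hk, hE.M_mulVec_mono hk c hl (by omega)]
  have hq := hE.quadrature_mono c (m := i + (j + l)) (by omega)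
  simp only [hE.R_mono c hl, sub_self, mul_zero, zero_add, Nat.add_sub_cancel]
  have hr : ∀ x y z w : ℝ, x - y - z - w = (x - w) - (y + z) := fun x y z w => by ring
  rw [hr, ← Finset.sum_sub_distrib, ← Finset.sum_add_distrib]
  have e : ∀ γ : Side, γ.normal * (E.R γ ⬝ᵥ E.restrict (Jet.mono c i).1 *
      (((l + 1 : ℕ) : ℝ) * (Jet.mono c (j + l)).1 (E.bdry γ))) -
      γ.normal * ((Jet.mono c j).1 (E.bdry γ) * ((Jet.mono c (l + 1)).2 (E.bdry γ) *
        (E.R γ ⬝ᵥ E.restrict (Jet.mono c i).1 - (Jet.mono c i).1 (E.bdry γ)))) =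
      ((l + 1 : ℕ) : ℝ) * (γ.normal * (Jet.mono c (i + (j + l))).1 (E.bdry γ)) := by
    intro γ
    simp only [Jet.mono, Nat.add_sub_cancel, pow_add]
    ring
  simp only [e]
  rw [← Finset.mul_sum, ← hq, Finset.mul_sum, sub_eq_zero]
  refine Finset.sum_congr rfl fun s _ => ?_
  simp only [Jet.mono, Nat.add_sub_cancel, pow_mul_pow_derivative _ i (j + l), restrict_apply]
  rw [pow_add _ j l]
  ring

/-- When both i, l ≤ p the extrapolation corrections vanish, and `Mbar_mulVec_mono` in both
arguments reduces the claim to `sum_Mbar_pow` whatever the degree of λ. -/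
theorem formDefect_mono (hE : E.IsSBP p) (hp : 1 ≤ p) (hk : E.IsNarrow p ∨ E.IsWide) (c : ℝ)
    {i j l : ℕ} (hijl : i + j + l ≤ 2 * p + 1) :
    E.formDefect (Jet.mono c j) (Jet.mono c i) (Jet.mono c l) = 0 := by
  by_cases hi : p < i
  · exact hE.formDefect_mono_aux hk c hi hijl
  by_cases hl : p < l
  · rw [hE.formDefect_symm hk]
    exact hE.formDefect_mono_aux hk c hl (by omega)
  rcases i with _ | i
  · exact hE.formDefect_one hk ..
  rcases l with _ | l
  · rw [hE.formDefect_symm hk, hE.formDefect_one hk]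
  have h := hE.sum_Mbar_pow hp hk c (t := j + i + l) (by omega)
  simp only [formDefect, hE.R_mono c (not_lt.mp hi), hE.R_mono c (not_lt.mp hl), sub_self,
    mul_zero, add_zero, Finset.sum_const_zero, sub_zero, dotProduct_M_mulVec]
  have e : ∀ s, (Jet.mono c j).1 (E.node s) * (E.restrict (Jet.mono c (l + 1)).1 ⬝ᵥ
      (E.Mbar s *ᵥ E.restrict (Jet.mono c (i + 1)).1)) =
      (((l + 1 : ℕ) : ℝ) * ((i + 1 : ℕ) : ℝ)) *
        ((E.node s - c) ^ (j + i + l) * (E.restrict (Jet.mono c 1).1 ⬝ᵥ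
      (E.Mbar s *ᵥ E.restrict (Jet.mono c 1).1))) := by
    intro s
    rw [hE.Mbar_mulVec_mono hk c (not_lt.mp hi), dotProduct_smul, smul_eq_mul, hE.Mbar_symm hk,
      hE.Mbar_mulVec_mono hk c (not_lt.mp hl), dotProduct_smul, smul_eq_mul]
    simp only [Jet.mono, Nat.add_sub_cancel, pow_add]
    ring
  simp only [e]
  rw [← Finset.mul_sum, h, Finset.mul_sum, sub_eq_zero]
  refine Finset.sum_congr rfl fun s _ => ?_
  simp only [Jet.mono, Nat.add_sub_cancel, pow_add]
  ring

end IsSBP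

end SBPElement

end

/-! ### Consistency estimates on one element at scale ρ. -/

noncomputable section

section IsLinearMap

variable {J ι : Type*} [AddCommGroup J] [Module ℝ J]

theorem isLinearMap_add {f g : J → ℝ} (hf : IsLinearMap ℝ f) (hg : IsLinearMap ℝ g) :
    IsLinearMap ℝ fun x => f x + g x :=
  (hf.mk' f + hg.mk' g).isLinear

theorem isLinearMap_sub {f g : J → ℝ} (hf : IsLinearMap ℝ f) (hg : IsLinearMap ℝ g) :
    IsLinearMap ℝ fun x => f x - g x :=
  (hf.mk' f - hg.mk' g).isLinear

theorem isLinearMap_const_mul {f : J → ℝ} (c : ℝ) (hf : IsLinearMap ℝ f) :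
    IsLinearMap ℝ fun x => c * f x :=
  (c • hf.mk' f).isLinear

theorem isLinearMap_mul_const {f : J → ℝ} (c : ℝ) (hf : IsLinearMap ℝ f) :
    IsLinearMap ℝ fun x => f x * c := by
  simpa only [mul_comm] using isLinearMap_const_mul c hf

theorem isLinearMap_sum [Fintype ι] {f : ι → J → ℝ} (hf : ∀ i, IsLinearMap ℝ (f i)) :
    IsLinearMap ℝ fun x => ∑ i, f i x := by
  have := (∑ i, (hf i).mk' (f i)).isLinear
  convert this using 2
  simp

theorem Jet.isLinearMap_fst (x : ℝ) : IsLinearMap ℝ fun f : Jet => f.1 x :=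
  ⟨fun _ _ => rfl, fun _ _ => rfl⟩

theorem Jet.isLinearMap_snd (x : ℝ) : IsLinearMap ℝ fun f : Jet => f.2 x :=
  ⟨fun _ _ => rfl, fun _ _ => rfl⟩

end IsLinearMap

theorem abs_sum_fin_le {n : ℕ} {f : Fin n → ℝ} {M : ℝ} (h : ∀ i, |f i| ≤ M) :
    |∑ i, f i| ≤ n * M := by
  refine (Finset.abs_sum_le_sum_abs _ _).trans ?_
  exact (Finset.sum_le_card_nsmul _ _ M fun i _ => h i).trans (by simp)

theorem Side.sum_eq (f : Side → ℝ) : ∑ γ, f γ = f Side.left + f Side.right := by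
  change ∑ γ ∈ {Side.left, Side.right}, f γ = _
  rw [Finset.sum_pair (by simp)]

theorem abs_sum_side_le {f : Side → ℝ} {M : ℝ} (h : ∀ γ, |f γ| ≤ M) :
    |∑ γ, f γ| ≤ 2 * M := by
  rw [Side.sum_eq]
  have := abs_add_le (f Side.left) (f Side.right)
  linarith [h Side.left, h Side.right]

@[simp] theorem Side.abs_normal (γ : Side) : |γ.normal| = 1 := by
  cases γ <;> simp [Side.normal]

theorem abs_mul_le_mul {x y X Y : ℝ} (hx : |x| ≤ X) (hy : |y| ≤ Y) : |x * y| ≤ X * Y := by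
  rw [abs_mul]
  exact mul_le_mul hx hy (abs_nonneg _) ((abs_nonneg _).trans hx)

theorem abs_sub_le_add {x y X Y : ℝ} (hx : |x| ≤ X) (hy : |y| ≤ Y) : |x - y| ≤ X + Y :=
  (abs_sub x y).trans (add_le_add hx hy)

theorem abs_add_le_add {x y X Y : ℝ} (hx : |x| ≤ X) (hy : |y| ≤ Y) : |x + y| ≤ X + Y :=
  (abs_add_le x y).trans (add_le_add hx hy)

namespace SBPElement

variable {n : ℕ}

/-- The operators on the element are bounded by `B` at the scale `ρ`, and its nodes and end points
lie in `[a, b]` within distance `ρ` of the node `c`. -/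
structure IsRegular (E : SBPElement n) (p : ℕ) (a b B c ρ : ℝ) : Prop where
  isSBP : E.IsSBP p
  kind : E.IsNarrow p ∨ E.IsWide
  ρ_pos : 0 < ρ
  ρ_le : ρ ≤ B
  c_mem : c ∈ Icc a b
  node_mem : ∀ i, E.node i ∈ Icc a b
  node_near : ∀ i, |E.node i - c| ≤ ρ
  bdry_mem : ∀ γ, E.bdry γ ∈ Icc a b
  bdry_near : ∀ γ, |E.bdry γ - c| ≤ ρ
  R_le : ∀ γ i, |E.R γ i| ≤ B
  w_le : ∀ i, E.w i ≤ B * ρ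
  D_le : ∀ i j, |E.D i j| ≤ B / ρ
  Db_le : ∀ i j, |E.Db i j| ≤ B / ρ
  Mbar_le : ∀ l i j, |E.Mbar l i j| ≤ B / ρ

namespace IsRegular

variable {E : SBPElement n} {p : ℕ} {a b B c ρ : ℝ}

theorem abs_R_dotProduct_le (h : E.IsRegular p a b B c ρ) (γ : Side) {v : Fin n → ℝ} {μ : ℝ}
    (hv : ∀ i, |v i| ≤ μ) : |E.R γ ⬝ᵥ v| ≤ n * (B * μ) :=
  abs_sum_fin_le fun i => abs_mul_le_mul (h.R_le γ i) (hv i)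

theorem abs_w_le (h : E.IsRegular p a b B c ρ) (i : Fin n) : |E.w i| ≤ B * ρ := by
  rw [abs_of_pos (h.isSBP.w_pos i)]
  exact h.w_le i

theorem abs_mulVec_le {A : Matrix (Fin n) (Fin n) ℝ} (hA : ∀ i j, |A i j| ≤ B / ρ)
    {v : Fin n → ℝ} {μ : ℝ} (hv : ∀ i, |v i| ≤ μ) (i : Fin n) :
    |(A *ᵥ v) i| ≤ n * (B / ρ * μ) :=
  abs_sum_fin_le fun j => abs_mul_le_mul (hA i j) (hv j)

theorem abs_fst_node (h : E.IsRegular p a b B c ρ) {f : Jet} {μ : ℝ}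
    (hf : Jet.BoundedBy a b c ρ f μ) (i : Fin n) : |f.1 (E.node i)| ≤ μ :=
  (hf _ (h.node_mem i) (h.node_near i)).1

theorem abs_fst_bdry (h : E.IsRegular p a b B c ρ) {f : Jet} {μ : ℝ}
    (hf : Jet.BoundedBy a b c ρ f μ) (γ : Side) : |f.1 (E.bdry γ)| ≤ μ :=
  (hf _ (h.bdry_mem γ) (h.bdry_near γ)).1

theorem abs_snd_node (h : E.IsRegular p a b B c ρ) {f : Jet} {μ : ℝ}
    (hf : Jet.BoundedBy a b c ρ f μ) (i : Fin n) : |f.2 (E.node i)| ≤ μ / ρ := by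
  rw [le_div_iff₀' h.ρ_pos]
  exact (hf _ (h.node_mem i) (h.node_near i)).2

theorem abs_snd_bdry (h : E.IsRegular p a b B c ρ) {f : Jet} {μ : ℝ}
    (hf : Jet.BoundedBy a b c ρ f μ) (γ : Side) : |f.2 (E.bdry γ)| ≤ μ / ρ := by
  rw [le_div_iff₀' h.ρ_pos]
  exact (hf _ (h.bdry_mem γ) (h.bdry_near γ)).2

/-- All three parts scale like 1/ρ: M through M̄, the quadrature sum as ρ · ρ⁻¹ · ρ⁻¹, the faces
through one derivative. Only values of f enter, so no bound on its derivative is asked. -/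
theorem abs_formDefect_le (h : E.IsRegular p a b B c ρ) {f u v : Jet} {κ μ ν : ℝ}
    (hf : ∀ x ∈ Icc a b, |x - c| ≤ ρ → |f.1 x| ≤ κ) (hu : Jet.BoundedBy a b c ρ u μ)
    (hv : Jet.BoundedBy a b c ρ v ν) :
    |E.formDefect f u v| ≤ (n ^ 3 * B + n * B + 4 * (n * B + 1)) / ρ * (κ * (μ * ν)) := by
  have hρ := h.ρ_pos
  have e1 : |E.restrict v.1 ⬝ᵥ (E.M f.1 *ᵥ E.restrict u.1)| ≤
      n * (κ * (n * (ν * (n * (B / ρ * μ))))) := by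
    rw [dotProduct_M_mulVec]
    refine abs_sum_fin_le fun l => abs_mul_le_mul (hf _ (h.node_mem l) (h.node_near l)) ?_
    exact abs_sum_fin_le fun i => abs_mul_le_mul (h.abs_fst_node hv i)
      (abs_mulVec_le (h.Mbar_le l) (fun j => h.abs_fst_node hu j) i)
  have e2 : |∑ i, E.w i * (f.1 (E.node i) * (u.2 (E.node i) * v.2 (E.node i)))| ≤
      n * (B * ρ * (κ * (μ / ρ * (ν / ρ)))) :=
    abs_sum_fin_le fun i => abs_mul_le_mul (h.abs_w_le i) (abs_mul_le_mul (hf _ (h.node_mem i)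
      (h.node_near i)) (abs_mul_le_mul (h.abs_snd_node hu i) (h.abs_snd_node hv i)))
  have e3 : |∑ γ : Side, γ.normal * (f.1 (E.bdry γ) *
      (u.2 (E.bdry γ) * (E.R γ ⬝ᵥ E.restrict v.1 - v.1 (E.bdry γ)) +
        v.2 (E.bdry γ) * (E.R γ ⬝ᵥ E.restrict u.1 - u.1 (E.bdry γ))))| ≤
      2 * (1 * (κ * (μ / ρ * (n * (B * ν) + ν) + ν / ρ * (n * (B * μ) + μ)))) := by
    refine abs_sum_side_le fun γ => abs_mul_le_mul (Side.abs_normal γ).le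
      (abs_mul_le_mul (hf _ (h.bdry_mem γ) (h.bdry_near γ)) (abs_add_le_add ?_ ?_))
    · exact abs_mul_le_mul (h.abs_snd_bdry hu γ) (abs_sub_le_add
        (h.abs_R_dotProduct_le γ fun i => h.abs_fst_node hv i) (h.abs_fst_bdry hv γ))
    · exact abs_mul_le_mul (h.abs_snd_bdry hv γ) (abs_sub_le_add
        (h.abs_R_dotProduct_le γ fun i => h.abs_fst_node hu i) (h.abs_fst_bdry hu γ))
  refine (abs_sub_le_add (abs_sub_le_add e1 e2) e3).trans (le_of_eq ?_)
  field_simp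
  ring

end IsRegular

section Estimates

variable {p : ℕ} {a b B : ℝ}

theorem extrapolation_estimate (n : ℕ) (hab : a < b) (hB : 0 ≤ B) {V : ℝ → ℝ} {m : ℕ}
    (hm : 1 ≤ m) (hmp : m ≤ p + 1) (hV : ContDiffOn ℝ (m : WithTop ℕ∞) V (Icc a b)) :
    ∃ K, 0 ≤ K ∧ ∀ (E : SBPElement n) (c ρ : ℝ), E.IsRegular p a b B c ρ → ∀ γ,
      |E.R γ ⬝ᵥ E.restrict V - V (E.bdry γ)| ≤ K * ρ ^ m := by
  obtain ⟨K, hK, hest⟩ := jet_estimate hab hV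
  refine ⟨K * (n * B + 1), by positivity, fun E c ρ h γ => ?_⟩
  have hρ := h.ρ_pos
  rw [mul_assoc]
  refine hest m hm le_rfl c h.c_mem ρ hρ
    (fun f => E.R γ ⬝ᵥ E.restrict f.1 - f.1 (E.bdry γ)) ?_ _ (n * B + 1) (by positivity)
    (fun i hi => ?_) (fun f μ hf => ?_) le_rfl
  · exact isLinearMap_sub (isLinearMap_sum fun i => isLinearMap_const_mul _
      (Jet.isLinearMap_fst _)) (Jet.isLinearMap_fst _)
  · rw [h.isSBP.R_mono c (by omega), sub_self, abs_zero]
    positivity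
  · refine (abs_sub_le_add (h.abs_R_dotProduct_le γ fun i => h.abs_fst_node hf i)
      (h.abs_fst_bdry hf γ)).trans (le_of_eq ?_)
    ring

/-- Stated for a derivative, so that the integral is a difference of end values and telescopes over
the mesh. -/
theorem quadrature_estimate (n : ℕ) (hab : a < b) (hB : 0 ≤ B) {V : ℝ → ℝ}
    (hV : ContDiffOn ℝ ((2 * p + 1 : ℕ) : WithTop ℕ∞) V (Icc a b)) :
    ∃ K, 0 ≤ K ∧ ∀ (E : SBPElement n) (c ρ : ℝ), E.IsRegular p a b B c ρ →
      |∑ i, E.w i * derivWithin V (Icc a b) (E.node i) - ∑ γ : Side, γ.normal * V (E.bdry γ)|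
        ≤ K * ρ ^ (2 * p + 1) := by
  obtain ⟨K, hK, hest⟩ := jet_estimate hab hV
  refine ⟨K * (n * B + 2), by positivity, fun E c ρ h => ?_⟩
  have hρ := h.ρ_pos
  rw [mul_assoc]
  refine hest (2 * p + 1) (by omega) le_rfl c h.c_mem ρ hρ
    (fun f => ∑ i, E.w i * f.2 (E.node i) - ∑ γ : Side, γ.normal * f.1 (E.bdry γ)) ?_ _
    (n * B + 2) (by positivity) (fun i hi => ?_) (fun f μ hf => ?_) le_rfl
  · exact isLinearMap_sub (isLinearMap_sum fun i => isLinearMap_const_mul _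
      (Jet.isLinearMap_snd _)) (isLinearMap_sum fun γ => isLinearMap_const_mul _
      (Jet.isLinearMap_fst _))
  · rw [h.isSBP.quadrature_mono c (by omega), sub_self, abs_zero]
    positivity
  · refine (abs_sub_le_add
      (abs_sum_fin_le fun i => abs_mul_le_mul (h.abs_w_le i) (h.abs_snd_node hf i))
      (abs_sum_side_le fun γ => abs_mul_le_mul (Side.abs_normal γ).le
        (h.abs_fst_bdry hf γ))).trans (le_of_eq ?_)
    field_simp

theorem contDiffOn_flux (hab : a < b) {lam U : ℝ → ℝ} {N : ℕ}
    (hlam : ContDiffOn ℝ (N : WithTop ℕ∞) lam (Icc a b))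
    (hU : ContDiffOn ℝ ((N + 1 : ℕ) : WithTop ℕ∞) U (Icc a b)) :
    ContDiffOn ℝ (N : WithTop ℕ∞) (flux a b lam U) (Icc a b) :=
  hlam.mul (hU.derivWithin_Icc hab)

theorem Db_mono {E : SBPElement n} (hE : E.IsSBP p) (hk : E.IsNarrow p ∨ E.IsWide) (c : ℝ)
    {m : ℕ} (hm : m ≤ p) {i : Fin n} {γ : Side} (hi : E.R γ i ≠ 0) :
    (E.Db *ᵥ E.restrict (Jet.mono c m).1) i = (Jet.mono c m).2 (E.node i) := by
  rcases hk with hk | hk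
  · have := hk.Db_accurate ((X - C c) ^ m) (by simp; omega) i ⟨γ, hi⟩
    simpa [Polynomial.derivative_X_sub_C_pow, Jet.mono] using this
  · rw [hk.Db_eq, hE.D_mono c hm, restrict_apply]

/-- Two errors: that of D_b as a derivative at the nodes seen by R, of order p + 1 less the factor
1/ρ; and that of extrapolating the exact flux, which is of class C^p here. -/
theorem flux_estimate (n : ℕ) (hab : a < b) (hp : 1 ≤ p) (hB : 0 ≤ B) {lam U : ℝ → ℝ}
    (hlam : ContDiffOn ℝ (p : WithTop ℕ∞) lam (Icc a b))
    (hU : ContDiffOn ℝ ((p + 1 : ℕ) : WithTop ℕ∞) U (Icc a b)) :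
    ∃ K, 0 ≤ K ∧ ∀ (E : SBPElement n) (c ρ : ℝ), E.IsRegular p a b B c ρ → ∀ γ,
      |E.Dn lam γ ⬝ᵥ E.restrict U - γ.normal * flux a b lam U (E.bdry γ)| ≤ K * ρ ^ p := by
  obtain ⟨K, hK, hest⟩ := jet_estimate hab hU
  obtain ⟨K', hK', hest'⟩ := extrapolation_estimate n hab hB hp (Nat.le_succ p)
    (contDiffOn_flux hab hlam hU)
  obtain ⟨Λ, hΛ0, hΛ⟩ := exists_abs_le_of_continuousOn hlam.continuousOn
  refine ⟨K * (n * (B * (Λ * (n * B + 1)))) + K', by positivity, fun E c ρ h γ => ?_⟩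
  have hρ := h.ρ_pos
  have h1 : |∑ i, E.R γ i * (lam (E.node i) * ((E.Db *ᵥ E.restrict U) i -
      derivWithin U (Icc a b) (E.node i)))| ≤ K * (n * (B * (Λ * (n * B + 1))) * ρ ^ p) := by
    refine hest (p + 1) (by omega) le_rfl c h.c_mem ρ hρ
      (fun f => ∑ i, E.R γ i * (lam (E.node i) * ((E.Db *ᵥ E.restrict f.1) i -
        f.2 (E.node i)))) ?_ _ (n * (B * (Λ * (n * B + 1))) / ρ) (by positivity)
      (fun i hi => ?_) (fun f μ hf => ?_) ?_
    · simp only [mulVec, dotProduct, restrict_apply]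
      exact isLinearMap_sum fun i => isLinearMap_const_mul _ (isLinearMap_const_mul _
        (isLinearMap_sub (isLinearMap_sum fun j => isLinearMap_const_mul _
          (Jet.isLinearMap_fst _)) (Jet.isLinearMap_snd _)))
    · rw [Finset.sum_eq_zero, abs_zero]
      · positivity
      · intro l _
        by_cases hl : E.R γ l = 0
        · rw [hl, zero_mul]
        · rw [Db_mono h.isSBP h.kind c (by omega) hl, sub_self, mul_zero, mul_zero]
    · refine (abs_sum_fin_le fun i => abs_mul_le_mul (h.R_le γ i) (abs_mul_le_mul
        (hΛ _ (h.node_mem i)) (abs_sub_le_add (IsRegular.abs_mulVec_le h.Db_le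
          (fun j => h.abs_fst_node hf j) i) (h.abs_snd_node hf i)))).trans (le_of_eq ?_)
      field_simp
    · rw [pow_succ]
      exact le_of_eq (by field_simp)
  have h2 := hest' E c ρ h γ
  have h3 : E.Dn lam γ ⬝ᵥ E.restrict U - γ.normal * flux a b lam U (E.bdry γ) =
      γ.normal * (∑ i, E.R γ i * (lam (E.node i) * ((E.Db *ᵥ E.restrict U) i -
      derivWithin U (Icc a b) (E.node i))) +
      (E.R γ ⬝ᵥ E.restrict (flux a b lam U) - flux a b lam U (E.bdry γ))) := by
    rw [dotProduct_Dn]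
    simp only [mul_sub, Finset.sum_sub_distrib, dotProduct, restrict_apply, flux, mul_add]
    ring
  rw [h3]
  refine (abs_mul_le_mul (Side.abs_normal γ).le (abs_add_le_add h1 h2)).trans (le_of_eq ?_)
  ring

theorem IsRegular.abs_Dn_le {E : SBPElement n} {c ρ Λ μ : ℝ} {lam : ℝ → ℝ}
    (h : E.IsRegular p a b B c ρ) (hΛ : ∀ x ∈ Icc a b, |lam x| ≤ Λ) (γ : Side)
    {v : Fin n → ℝ} (hv : ∀ i, |v i| ≤ μ) :
    |E.Dn lam γ ⬝ᵥ v| ≤ n * (B * (Λ * (n * B))) / ρ * μ := by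
  rw [dotProduct_Dn]
  refine (abs_mul_le_mul (Side.abs_normal γ).le (abs_sum_fin_le fun i =>
    abs_mul_le_mul (h.R_le γ i) (abs_mul_le_mul (hΛ _ (h.node_mem i))
      (IsRegular.abs_mulVec_le h.Db_le hv i)))).trans (le_of_eq ?_)
  ring

/-- The symmetric-form estimate: `M` is accurate of order `2 p` on pairs of smooth functions. -/
theorem formDefect_estimate (n : ℕ) (hab : a < b) (hp : 1 ≤ p) (hB : 0 ≤ B)
    {lam U V : ℝ → ℝ}
    (hlam : ContDiffOn ℝ ((2 * p + 1 : ℕ) : WithTop ℕ∞) lam (Icc a b))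
    (hU : ContDiffOn ℝ ((2 * p + 2 : ℕ) : WithTop ℕ∞) U (Icc a b))
    (hV : ContDiffOn ℝ ((2 * p + 2 : ℕ) : WithTop ℕ∞) V (Icc a b)) :
    ∃ K, 0 ≤ K ∧ ∀ (E : SBPElement n) (c ρ : ℝ), E.IsRegular p a b B c ρ →
      |E.formDefect (Jet.of a b lam) (Jet.of a b U) (Jet.of a b V)| ≤ K * ρ ^ (2 * p + 1) := by
  obtain ⟨Kl, hKl, hestl⟩ := jet_estimate hab hlam
  obtain ⟨Ku, hKu, hestu⟩ := jet_estimate hab hU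
  obtain ⟨Kv, hKv, hestv⟩ := jet_estimate hab hV
  obtain ⟨Λ, hΛ0, hΛ⟩ := exists_abs_le_of_continuousOn hlam.continuousOn
  obtain ⟨V₀, hV₀0, hV₀⟩ := exists_abs_le_of_continuousOn hV.continuousOn
  obtain ⟨V₁, hV₁0, hV₁⟩ :=
    exists_abs_le_of_continuousOn (hV.derivWithin_Icc hab).continuousOn
  set K₀ : ℝ := n ^ 3 * B + n * B + 4 * (n * B + 1) with hK₀
  have hK₀0 : 0 ≤ K₀ := by positivity
  set q : ℝ := 2 * p + 2 with hq
  have hq0 : 0 ≤ q := by positivity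
  set K₁ : ℝ := Kl * (K₀ * (q * q)) with hK₁
  set K₂ : ℝ := Kv * (K₁ + K₀ * (Λ * q)) with hK₂
  refine ⟨Ku * (K₂ + K₀ * (Λ * (V₀ + B * V₁))), by positivity, fun E c ρ h => ?_⟩
  have hρ := h.ρ_pos
  have hVb : Jet.BoundedBy a b c ρ (Jet.of a b V) (V₀ + B * V₁) := by
    intro x hx _
    constructor
    · exact (hV₀ x hx).trans (by have := mul_nonneg hB hV₁0; linarith)
    · have : ρ * |derivWithin V (Icc a b) x| ≤ B * V₁ :=
        mul_le_mul h.ρ_le (hV₁ x hx) (abs_nonneg _) hB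
      exact this.trans (by linarith)
  have hiq : ∀ i : ℕ, i < 2 * p + 2 → (i : ℝ) + 1 ≤ q := by
    intro i hi
    rw [hq]; exact_mod_cast hi
  -- `jet_estimate` is applied to one argument at a time: λ against two monomials, then V against
  -- one, then U. Each time the order is what the degrees already used leave of 2p+2, and the factor
  -- 1/ρ of the form reduces 2p+2 to 2p+1.
  have step₁ : ∀ i l, i + l < 2 * p + 2 →
      |E.formDefect (Jet.of a b lam) (Jet.mono c i) (Jet.mono c l)| ≤ K₁ * ρ ^ (2 * p + 1) := by
    intro i l hil
    -- Constants are disposed of first: with i, l ≥ 1 the order required of λ is at most 2p, within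
    -- its smoothness, whereas i = l = 0 would ask for 2p+2.
    rcases i with _ | i
    · rw [h.isSBP.formDefect_one h.kind, abs_zero]; positivity
    rcases l with _ | l
    · rw [h.isSBP.formDefect_symm h.kind, h.isSBP.formDefect_one h.kind, abs_zero]; positivity
    rw [hK₁, mul_assoc Kl]
    refine hestl (2 * p + 2 - (i + 1) - (l + 1)) (by omega) (by omega) c h.c_mem ρ hρ
      (fun f => E.formDefect f (Jet.mono c (i + 1)) (Jet.mono c (l + 1))) ?_ _
      (K₀ / ρ * ((((i + 1 : ℕ) : ℝ) + 1) * ρ ^ (i + 1) *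
        ((((l + 1 : ℕ) : ℝ) + 1) * ρ ^ (l + 1)))) (by positivity)
      (fun j hj => ?_) (fun f μ hf => ?_) ?_
    · simp only [formDefect, dotProduct_M_mulVec]
      exact isLinearMap_sub (isLinearMap_sub (isLinearMap_sum fun i => isLinearMap_mul_const _
        (Jet.isLinearMap_fst _)) (isLinearMap_sum fun i => isLinearMap_const_mul _
        (isLinearMap_mul_const _ (Jet.isLinearMap_fst _)))) (isLinearMap_sum fun γ =>
        isLinearMap_const_mul _ (isLinearMap_mul_const _ (Jet.isLinearMap_fst _)))
    · rw [h.isSBP.formDefect_mono hp h.kind c (by omega), abs_zero]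
      positivity
    · exact (h.abs_formDefect_le (fun x hx hxc => (hf x hx hxc).1)
        (Jet.boundedBy_mono a b c hρ (i + 1)) (Jet.boundedBy_mono a b c hρ (l + 1))).trans
        (le_of_eq (by ring))
    · have e' : ρ ^ (2 * p + 1) * ρ = ρ ^ (i + 1) * ρ ^ (l + 1) *
          ρ ^ (2 * p + 2 - (i + 1) - (l + 1)) := by
        rw [← pow_succ, ← pow_add, ← pow_add]
        congr 1
        omega
      calc _ = K₀ * (((((i + 1 : ℕ) : ℝ) + 1) * (((l + 1 : ℕ) : ℝ) + 1))) *
            (ρ ^ (i + 1) * ρ ^ (l + 1) * ρ ^ (2 * p + 2 - (i + 1) - (l + 1))) / ρ := by ring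
        _ = K₀ * (((((i + 1 : ℕ) : ℝ) + 1) * (((l + 1 : ℕ) : ℝ) + 1))) *
            ρ ^ (2 * p + 1) := by rw [← e']; field_simp
        _ ≤ _ := by
          have h1 := hiq (i + 1) (by omega)
          have h2 := hiq (l + 1) (by omega)
          gcongr
  have step₂ : ∀ i, i < 2 * p + 2 →
      |E.formDefect (Jet.of a b lam) (Jet.mono c i) (Jet.of a b V)| ≤ K₂ * ρ ^ (2 * p + 1) := by
    intro i hi
    rw [hK₂, mul_assoc Kv]
    refine hestv (2 * p + 2 - i) (by omega) (by omega) c h.c_mem ρ hρ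
      (fun f => E.formDefect (Jet.of a b lam) (Jet.mono c i) f) ?_ _
      (K₀ / ρ * (Λ * (((i : ℝ) + 1) * ρ ^ i))) (by positivity)
      (fun j hj => ?_) (fun f μ hf => ?_) ?_
    · simp only [formDefect, dotProduct_M_mulVec]
      refine isLinearMap_sub (isLinearMap_sub (isLinearMap_sum fun i => isLinearMap_const_mul _
        (isLinearMap_sum fun j => isLinearMap_mul_const _ (Jet.isLinearMap_fst _)))
        (isLinearMap_sum fun i => isLinearMap_const_mul _
        (isLinearMap_const_mul _ (isLinearMap_const_mul _ (Jet.isLinearMap_snd _)))))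
        (isLinearMap_sum fun γ =>
        isLinearMap_const_mul _ (isLinearMap_const_mul _ (isLinearMap_add
          (isLinearMap_const_mul _ (isLinearMap_sub (isLinearMap_sum fun i =>
            isLinearMap_const_mul _ (Jet.isLinearMap_fst _)) (Jet.isLinearMap_fst _)))
          (isLinearMap_mul_const _ (Jet.isLinearMap_snd _)))))
    · refine (step₁ i j (by omega)).trans ?_
      have : 0 ≤ K₀ * (Λ * q) := by positivity
      gcongr
      linarith
    · exact (h.abs_formDefect_le (fun x hx _ => hΛ x hx) (Jet.boundedBy_mono a b c hρ i) hf).trans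
        (le_of_eq (by ring))
    · have e' : ρ ^ (2 * p + 1) * ρ = ρ ^ i * ρ ^ (2 * p + 2 - i) := by
        rw [← pow_succ, ← pow_add]
        congr 1
        omega
      calc _ = K₀ * (Λ * ((i : ℝ) + 1)) * (ρ ^ i * ρ ^ (2 * p + 2 - i)) / ρ := by ring
        _ = K₀ * (Λ * ((i : ℝ) + 1)) * ρ ^ (2 * p + 1) := by rw [← e']; field_simp
        _ ≤ _ := by
          have h1 := hiq i (by omega)
          have : 0 ≤ K₁ := by positivity
          gcongr
          have : K₀ * (Λ * ((i : ℝ) + 1)) ≤ K₀ * (Λ * q) := by gcongr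
          linarith
  rw [mul_assoc Ku]
  refine hestu (2 * p + 2) (by omega) (by omega) c h.c_mem ρ hρ
    (fun f => E.formDefect (Jet.of a b lam) f (Jet.of a b V)) ?_ _
    (K₀ / ρ * (Λ * (V₀ + B * V₁))) (by positivity)
    (fun j hj => ?_) (fun f μ hf => ?_) ?_
  · simp only [h.isSBP.formDefect_symm h.kind _ _ (Jet.of a b V)]
    simp only [formDefect, dotProduct_M_mulVec]
    refine isLinearMap_sub (isLinearMap_sub (isLinearMap_sum fun i => isLinearMap_const_mul _
      (isLinearMap_sum fun j => isLinearMap_mul_const _ (Jet.isLinearMap_fst _)))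
      (isLinearMap_sum fun i => isLinearMap_const_mul _
      (isLinearMap_const_mul _ (isLinearMap_const_mul _ (Jet.isLinearMap_snd _)))))
      (isLinearMap_sum fun γ =>
      isLinearMap_const_mul _ (isLinearMap_const_mul _ (isLinearMap_add
        (isLinearMap_const_mul _ (isLinearMap_sub (isLinearMap_sum fun i =>
          isLinearMap_const_mul _ (Jet.isLinearMap_fst _)) (Jet.isLinearMap_fst _)))
        (isLinearMap_mul_const _ (Jet.isLinearMap_snd _)))))
  · refine (step₂ j hj).trans ?_
    have : 0 ≤ K₀ * (Λ * (V₀ + B * V₁)) := by positivity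
    gcongr
    linarith
  · exact (h.abs_formDefect_le (fun x hx _ => hΛ x hx) hf hVb).trans (le_of_eq (by ring))
  · have : 0 ≤ K₂ := by positivity
    calc _ = K₀ * (Λ * (V₀ + B * V₁)) * (ρ ^ (2 * p + 1) * ρ) / ρ := by
          rw [← pow_succ]; ring
      _ = K₀ * (Λ * (V₀ + B * V₁)) * ρ ^ (2 * p + 1) := by field_simp
      _ ≤ _ := by gcongr; linarith

/-- The residual of the second-derivative operator, tested with `ε`, where the fluxes at the ends
of the element are exact. -/
def residualForm (E : SBPElement n) (ε : Fin n → ℝ) (f u : Jet) : ℝ :=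
  ε ⬝ᵥ (E.M f.1 *ᵥ E.restrict u.1) -
    ∑ γ : Side, γ.normal * ((E.R γ ⬝ᵥ ε) * (f.1 (E.bdry γ) * u.2 (E.bdry γ))) +
    ∑ i, E.w i * ε i * (E.D *ᵥ E.restrict (fun x => f.1 x * u.2 x)) i

/-- `M_mulVec_mono` holds for every test vector, and D is exact on λ P', of degree at most p. -/
theorem IsSBP.residualForm_mono {E : SBPElement n} (hE : E.IsSBP p)
    (hk : E.IsNarrow p ∨ E.IsWide) (c : ℝ) {i j : ℕ} (hi : i ≤ p) (hij : i + j ≤ p + 1)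
    (ε : Fin n → ℝ) : E.residualForm ε (Jet.mono c j) (Jet.mono c i) = 0 := by
  rw [residualForm, hE.M_mulVec_mono hk c hi hij]
  have e1 : (fun x => (Jet.mono c j).1 x * (Jet.mono c i).2 x) =
      fun x => (i : ℝ) * (Jet.mono c (j + (i - 1))).1 x := by
    ext x
    simp only [Jet.mono, pow_add]
    ring
  have e2 : E.D *ᵥ E.restrict (fun x => (i : ℝ) * (Jet.mono c (j + (i - 1))).1 x) =
      E.restrict (fun x => (i : ℝ) * (Jet.mono c (j + (i - 1))).2 x) := by
    have : ∀ g : ℝ → ℝ, E.restrict (fun x => (i : ℝ) * g x) = (i : ℝ) • E.restrict g :=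
      fun g => rfl
    rw [this, this, Matrix.mulVec_smul]
    rcases i with _ | i
    · simp
    · rw [hE.D_mono c (by omega)]
  rw [e1, e2]
  have e3 : ∀ x, (Jet.mono c j).1 x * (Jet.mono c i).2 x =
      (i : ℝ) * (Jet.mono c (j + (i - 1))).1 x := fun x => congrFun e1 x
  simp only [e3, restrict_apply]
  ring

theorem IsRegular.abs_residualForm_le {E : SBPElement n} {c ρ : ℝ}
    (h : E.IsRegular p a b B c ρ) {ε : Fin n → ℝ} {f u : Jet} {κ μ ν : ℝ}
    (hε : ∀ i, |ε i| ≤ ν) (hf : ∀ x ∈ Icc a b, |x - c| ≤ ρ → |f.1 x| ≤ κ)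
    (hu : Jet.BoundedBy a b c ρ u μ) :
    |E.residualForm ε f u| ≤ (n ^ 3 * B + 2 * (n * B) + n * (B * (n * B))) * ν / ρ * (κ * μ) := by
  have hρ := h.ρ_pos
  have e1 : |ε ⬝ᵥ (E.M f.1 *ᵥ E.restrict u.1)| ≤
      n * (κ * (n * (ν * (n * (B / ρ * μ))))) := by
    rw [dotProduct_M_mulVec]
    refine abs_sum_fin_le fun l => abs_mul_le_mul (hf _ (h.node_mem l) (h.node_near l)) ?_
    exact abs_sum_fin_le fun i => abs_mul_le_mul (hε i)
      (abs_mulVec_le (h.Mbar_le l) (fun j => h.abs_fst_node hu j) i)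
  have e2 : |∑ γ : Side, γ.normal * ((E.R γ ⬝ᵥ ε) * (f.1 (E.bdry γ) * u.2 (E.bdry γ)))| ≤
      2 * (1 * (n * (B * ν) * (κ * (μ / ρ)))) :=
    abs_sum_side_le fun γ => abs_mul_le_mul (Side.abs_normal γ).le
      (abs_mul_le_mul (h.abs_R_dotProduct_le γ hε) (abs_mul_le_mul
        (hf _ (h.bdry_mem γ) (h.bdry_near γ)) (h.abs_snd_bdry hu γ)))
  have e3 : |∑ i, E.w i * ε i * (E.D *ᵥ E.restrict (fun x => f.1 x * u.2 x)) i| ≤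
      n * (B * ρ * ν * (n * (B / ρ * (κ * (μ / ρ))))) :=
    abs_sum_fin_le fun i => abs_mul_le_mul (abs_mul_le_mul (h.abs_w_le i) (hε i))
      (abs_mulVec_le h.D_le (fun j => abs_mul_le_mul (hf _ (h.node_mem j) (h.node_near j))
        (h.abs_snd_node hu j)) i)
  refine (abs_add_le_add (abs_sub_le_add e1 e2) e3).trans (le_of_eq ?_)
  field_simp

theorem residualForm_estimate (n : ℕ) (hab : a < b) (hB : 0 ≤ B) {lam U : ℝ → ℝ}
    (hlam : ContDiffOn ℝ ((p + 1 : ℕ) : WithTop ℕ∞) lam (Icc a b))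
    (hU : ContDiffOn ℝ ((p + 1 : ℕ) : WithTop ℕ∞) U (Icc a b)) :
    ∃ K, 0 ≤ K ∧ ∀ (E : SBPElement n) (c ρ : ℝ), E.IsRegular p a b B c ρ →
      ∀ ε ν, 0 ≤ ν → (∀ i, |ε i| ≤ ν) →
      |E.residualForm ε (Jet.of a b lam) (Jet.of a b U)| ≤ K * (ν * ρ ^ p) := by
  obtain ⟨Kl, hKl, hestl⟩ := jet_estimate hab hlam
  obtain ⟨Ku, hKu, hestu⟩ := jet_estimate hab hU
  obtain ⟨Λ, hΛ0, hΛ⟩ := exists_abs_le_of_continuousOn hlam.continuousOn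
  set K₀ : ℝ := n ^ 3 * B + 2 * (n * B) + n * (B * (n * B)) with hK₀
  have hK₀0 : 0 ≤ K₀ := by positivity
  set q : ℝ := p + 1 with hq
  set K₁ : ℝ := Kl * (K₀ * q) with hK₁
  have hK₁0 : 0 ≤ K₁ := by positivity
  refine ⟨Ku * (K₁ + K₀ * Λ), by positivity, fun E c ρ h ε ν hν0 hν => ?_⟩
  have hρ := h.ρ_pos
  have step₁ : ∀ i, i < p + 1 →
      |E.residualForm ε (Jet.of a b lam) (Jet.mono c i)| ≤ K₁ * (ν * ρ ^ p) := by
    intro i hi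
    rw [hK₁, mul_assoc Kl]
    refine hestl (p + 1 - i) (by omega) (by omega) c h.c_mem ρ hρ
      (fun f => E.residualForm ε f (Jet.mono c i)) ?_ _
      (K₀ * ν / ρ * (((i : ℝ) + 1) * ρ ^ i)) (by positivity)
      (fun j hj => ?_) (fun f μ hf => ?_) ?_
    · simp only [residualForm, dotProduct_M_mulVec]
      simp only [mulVec, dotProduct, restrict_apply]
      exact isLinearMap_add (isLinearMap_sub (isLinearMap_sum fun i => isLinearMap_mul_const _
        (Jet.isLinearMap_fst _)) (isLinearMap_sum fun γ => isLinearMap_const_mul _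
        (isLinearMap_const_mul _ (isLinearMap_mul_const _ (Jet.isLinearMap_fst _)))))
        (isLinearMap_sum fun i => isLinearMap_const_mul _ (isLinearMap_sum fun j =>
          isLinearMap_const_mul _ (isLinearMap_mul_const _ (Jet.isLinearMap_fst _))))
    · rw [h.isSBP.residualForm_mono h.kind c (by omega) (by omega), abs_zero]
      positivity
    · exact (h.abs_residualForm_le hν (fun x hx hxc => (hf x hx hxc).1)
        (Jet.boundedBy_mono a b c hρ i)).trans (le_of_eq (by ring))
    · have e' : ρ ^ p * ρ = ρ ^ i * ρ ^ (p + 1 - i) := by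
        rw [← pow_succ, ← pow_add]
        congr 1
        omega
      calc _ = K₀ * ((i : ℝ) + 1) * ν * (ρ ^ i * ρ ^ (p + 1 - i)) / ρ := by ring
        _ = K₀ * ((i : ℝ) + 1) * (ν * ρ ^ p) := by rw [← e']; field_simp
        _ ≤ _ := by
          have h1 : (i : ℝ) + 1 ≤ q := by rw [hq]; exact_mod_cast hi
          gcongr
  rw [mul_assoc Ku]
  refine hestu (p + 1) (by omega) le_rfl c h.c_mem ρ hρ
    (fun f => E.residualForm ε (Jet.of a b lam) f) ?_ _
    (K₀ * ν / ρ * Λ) (by positivity) (fun j hj => ?_) (fun f μ hf => ?_) ?_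
  · simp only [residualForm, dotProduct_M_mulVec]
    simp only [mulVec, dotProduct, restrict_apply]
    exact isLinearMap_add (isLinearMap_sub (isLinearMap_sum fun i => isLinearMap_const_mul _
      (isLinearMap_sum fun j => isLinearMap_const_mul _ (isLinearMap_sum fun k =>
        isLinearMap_const_mul _ (Jet.isLinearMap_fst _))))
      (isLinearMap_sum fun γ => isLinearMap_const_mul _
      (isLinearMap_const_mul _ (isLinearMap_const_mul _ (Jet.isLinearMap_snd _)))))
      (isLinearMap_sum fun i => isLinearMap_const_mul _ (isLinearMap_sum fun j =>
        isLinearMap_const_mul _ (isLinearMap_const_mul _ (Jet.isLinearMap_snd _))))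
  · refine (step₁ j hj).trans ?_
    gcongr
    have : 0 ≤ K₀ * Λ := by positivity
    linarith
  · exact (h.abs_residualForm_le hν (fun x hx _ => hΛ x hx) hf).trans (le_of_eq (by ring))
  · calc _ = K₀ * Λ * ν * (ρ ^ p * ρ) / ρ := by rw [← pow_succ]; ring
      _ = K₀ * Λ * (ν * ρ ^ p) := by field_simp
      _ ≤ _ := by gcongr; linarith

/-- The residual of the second-derivative operator on a smooth function, tested with `ε`, where the
fluxes at the ends of the element are exact. -/
theorem residual_estimate (n : ℕ) (hab : a < b) (hp : 1 ≤ p) (hB : 0 ≤ B) {lam U : ℝ → ℝ}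
    (hlam : ContDiffOn ℝ ((p + 1 : ℕ) : WithTop ℕ∞) lam (Icc a b))
    (hU : ContDiffOn ℝ ((p + 1 : ℕ) : WithTop ℕ∞) U (Icc a b)) :
    ∃ K, 0 ≤ K ∧ ∀ (E : SBPElement n) (c ρ : ℝ), E.IsRegular p a b B c ρ →
      ∀ ε ν, 0 ≤ ν → (∀ i, |ε i| ≤ ν) →
      |ε ⬝ᵥ (E.M lam *ᵥ E.restrict U) -
        ∑ γ : Side, γ.normal * ((E.R γ ⬝ᵥ ε) * flux a b lam U (E.bdry γ)) +
        ∑ i, E.w i * ε i * derivWithin (flux a b lam U) (Icc a b) (E.node i)|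
        ≤ K * (ν * ρ ^ p) := by
  obtain ⟨K, hK, hest⟩ := residualForm_estimate (p := p) n hab hB hlam hU
  obtain ⟨K', hK', hest'⟩ := jet_estimate hab
    (contDiffOn_flux hab (hlam.of_le (by norm_cast; omega)) hU)
  refine ⟨K + K' * (n * (B * (n * B + 1))), by positivity, fun E c ρ h ε ν hν0 hν => ?_⟩
  have hρ := h.ρ_pos
  have h1 := hest E c ρ h ε ν hν0 hν
  -- `residualForm` contains D(λU') instead of (λU')', since a jet carries only first derivatives.
  -- The difference is estimated by treating the flux, of class C^p, as a function in its own right.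
  have h2 : |∑ i, E.w i * ε i * ((E.D *ᵥ E.restrict (flux a b lam U)) i -
      derivWithin (flux a b lam U) (Icc a b) (E.node i))| ≤
      K' * (n * (B * (n * B + 1)) * (ν * ρ ^ p)) := by
    refine hest' p hp le_rfl c h.c_mem ρ hρ (fun f => ∑ i, E.w i * ε i *
      ((E.D *ᵥ E.restrict f.1) i - f.2 (E.node i))) ?_ _ (n * (B * (n * B + 1)) * ν)
      (by positivity) (fun i hi => ?_) (fun f μ hf => ?_) (le_of_eq (by ring))
    · simp only [mulVec, dotProduct, restrict_apply]
      exact isLinearMap_sum fun i => isLinearMap_const_mul _ (isLinearMap_sub (isLinearMap_sum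
        fun j => isLinearMap_const_mul _ (Jet.isLinearMap_fst _)) (Jet.isLinearMap_snd _))
    · simp only [h.isSBP.D_mono c hi.le, restrict_apply, sub_self, mul_zero,
        Finset.sum_const_zero, abs_zero]
      positivity
    · refine (abs_sum_fin_le fun i => abs_mul_le_mul (abs_mul_le_mul (h.abs_w_le i) (hν i))
        (abs_sub_le_add (IsRegular.abs_mulVec_le h.D_le (fun j => h.abs_fst_node hf j) i)
          (h.abs_snd_node hf i))).trans (le_of_eq ?_)
      field_simp
  have h3 : ε ⬝ᵥ (E.M lam *ᵥ E.restrict U) -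
        ∑ γ : Side, γ.normal * ((E.R γ ⬝ᵥ ε) * flux a b lam U (E.bdry γ)) +
        ∑ i, E.w i * ε i * derivWithin (flux a b lam U) (Icc a b) (E.node i) =
      E.residualForm ε (Jet.of a b lam) (Jet.of a b U) -
      ∑ i, E.w i * ε i * ((E.D *ᵥ E.restrict (flux a b lam U)) i -
      derivWithin (flux a b lam U) (Icc a b) (E.node i)) := by
    simp only [mul_sub, Finset.sum_sub_distrib]
    change _ = ε ⬝ᵥ (E.M lam *ᵥ E.restrict U) -
        ∑ γ : Side, γ.normal * ((E.R γ ⬝ᵥ ε) * flux a b lam U (E.bdry γ)) +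
        ∑ i, E.w i * ε i * (E.D *ᵥ E.restrict (flux a b lam U)) i - _
    ring
  rw [h3]
  exact (abs_sub_le_add h1 h2).trans (le_of_eq (by ring))

end Estimates

end SBPElement

end

/-! ### Geometry of the mesh and sums over elements and faces. -/

noncomputable section

@[simp] theorem Side.opp_opp (γ : Side) : γ.opp.opp = γ := by cases γ <;> rfl

@[simp] theorem Side.normal_opp (γ : Side) : γ.opp.normal = -γ.normal := by
  cases γ <;> simp [Side.opp, Side.normal]

theorem Side.opp_ne (γ : Side) : γ.opp ≠ γ := by cases γ <;> simp [Side.opp]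

namespace SBPElement

variable {n p : ℕ} {E : SBPElement n}

theorem abs_node_sub_le (E : SBPElement n) (i j : Fin n) : |E.node i - E.node j| ≤ E.size := by
  rw [← Real.dist_eq]
  exact Metric.dist_le_diam_of_mem (Set.finite_range E.node).isBounded (Set.mem_range_self i)
    (Set.mem_range_self j)

namespace IsSBP

theorem exists_node (hE : E.IsSBP p) : Nonempty (Fin n) := by
  by_contra hn
  rw [not_nonempty_iff] at hn
  have := hE.extrapolation Side.left 1 (by simp)
  simp [dotProduct] at this

/-- If all nodes coincided at x_i, then x - x_i would vanish at the nodes while D must return 1. -/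
theorem size_pos (hE : E.IsSBP p) (hp : 1 ≤ p) : 0 < E.size := by
  obtain ⟨i⟩ := hE.exists_node
  by_contra hs
  have hnode : ∀ j, E.node j = E.node i := fun j => by
    have := (E.abs_node_sub_le j i).trans (not_lt.mp hs)
    exact sub_eq_zero.mp (abs_eq_zero.mp (le_antisymm this (abs_nonneg _)))
  have h := congrFun (hE.D_mono (E.node i) hp) i
  have h0 : E.restrict (Jet.mono (E.node i) 1).1 = 0 := by
    ext j
    simp [Jet.mono, hnode j]
  rw [h0] at h
  simp [Jet.mono] at h

/-- The end points need not be near the nodes a priori; exactness of R on x - x_i bounds their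
distance. -/
theorem abs_bdry_sub_le (hE : E.IsSBP p) (hp : 1 ≤ p) {C : ℝ} (hC : ∀ γ i, |E.R γ i| ≤ C)
    (γ : Side) (i : Fin n) : |E.bdry γ - E.node i| ≤ n * (C * E.size) := by
  have h := hE.R_mono (E.node i) hp γ
  have h' : E.bdry γ - E.node i = E.R γ ⬝ᵥ E.restrict (Jet.mono (E.node i) 1).1 := by
    rw [h]; simp [Jet.mono]
  rw [h']
  refine abs_sum_fin_le fun j => abs_mul_le_mul (hC γ j) ?_
  simpa [Jet.mono] using E.abs_node_sub_le j i

end IsSBP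

end SBPElement

namespace Discretization

variable {n p : ℕ} {d : Discretization n} {a b : ℝ}

theorem nbr_left (d : Discretization n) (k : Fin d.ne) : d.nbr Side.left k =
    if 0 < (k : ℕ) then some ⟨(k : ℕ) - 1, lt_of_le_of_lt (Nat.sub_le _ _) k.isLt⟩ else none :=
  rfl

theorem nbr_right (d : Discretization n) (k : Fin d.ne) : d.nbr Side.right k =
    if h : (k : ℕ) + 1 < d.ne then some ⟨(k : ℕ) + 1, h⟩ else none :=
  rfl

theorem nbr_opp {γ : Side} {k m : Fin d.ne} (h : d.nbr γ k = some m) :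
    d.nbr γ.opp m = some k := by
  cases γ
  · rw [nbr_left] at h
    split_ifs at h with h0
    simp only [Option.some.injEq] at h
    subst h
    simp only [Side.opp, nbr_right]
    rw [dif_pos (by omega)]
    simp only [Option.some.injEq, Fin.ext_iff]
    omega
  · rw [nbr_right] at h
    split_ifs at h with h0
    simp only [Option.some.injEq] at h
    subst h
    simp [Side.opp, nbr_left]

/-- Face terms that vanish at the ends of the domain and cancel at the interfaces sum to zero. -/
theorem sum_faces_eq_zero (Z : Side → Fin d.ne → ℝ) (hZ : ∀ γ k, d.nbr γ k = none → Z γ k = 0)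
    (hZ' : ∀ γ k m, d.nbr γ k = some m → Z γ k + Z γ.opp m = 0) :
    ∑ k, ∑ γ : Side, Z γ k = 0 := by
  rw [← Fintype.sum_prod_type' (f := fun k γ => Z γ k)]
  -- A face is paired with the same face seen from the neighbour; the fixed points are the ends of
  -- the domain, where Z vanishes.
  refine Finset.sum_involution
    (fun x _ => (d.nbr x.2 x.1).elim x fun m => (m, x.2.opp)) ?_ ?_ ?_ ?_
  · rintro ⟨k, γ⟩ -
    rcases h : d.nbr γ k with _ | m
    · simp [hZ γ k h]
    · simp [hZ' γ k m h]
  · rintro ⟨k, γ⟩ - hne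
    rcases h : d.nbr γ k with _ | m
    · exact absurd (hZ γ k h) hne
    · simp [Side.opp_ne]
  · intros; exact Finset.mem_univ _
  · rintro ⟨k, γ⟩ -
    rcases h : d.nbr γ k with _ | m
    · simp [h]
    · simp [nbr_opp h]

theorem sum_ends (hd : 0 < d.ne) (Y : Side → ℝ) :
    ∑ k, ∑ γ : Side, (d.nbr γ k).elim (Y γ) (fun _ => 0) = ∑ γ, Y γ := by
  rw [Finset.sum_comm]
  refine Finset.sum_congr rfl fun γ _ => ?_
  cases γ
  · rw [Finset.sum_eq_single ⟨0, hd⟩]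
    · simp [nbr_left]
    · intro k _ hk
      have : 0 < (k : ℕ) := Nat.pos_of_ne_zero fun h => hk (Fin.ext h)
      simp [nbr_left, this]
    · simp
  · rw [Finset.sum_eq_single ⟨d.ne - 1, by omega⟩]
    · rw [nbr_right, dif_neg (by simp only; omega)]
      rfl
    · intro k _ hk
      have : (k : ℕ) + 1 < d.ne := by
        have h1 : (k : ℕ) ≠ d.ne - 1 := fun h => hk (Fin.ext h)
        omega
      simp [nbr_right, this]
    · simp

namespace Tessellates

theorem left_ge (hT : d.Tessellates a b) (hE : ∀ k, (d.elem k).IsSBP p) :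
    ∀ m (hm : m < d.ne), a ≤ (d.elem ⟨m, hm⟩).bdry Side.left := by
  intro m
  induction m with
  | zero =>
    intro hm
    exact (hT.boundary Side.left ⟨0, hm⟩ (by simp [nbr_left])).ge
  | succ m ih =>
    intro hm
    have h := hT.interior Side.left ⟨m + 1, hm⟩ ⟨m, by omega⟩ (by simp [nbr_left])
    rw [h]
    exact (ih (by omega)).trans (hE _).bdry_lt.le

theorem right_le (hT : d.Tessellates a b) (hE : ∀ k, (d.elem k).IsSBP p) :
    ∀ j m (hm : m < d.ne), m + j + 1 = d.ne → (d.elem ⟨m, hm⟩).bdry Side.right ≤ b := by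
  intro j
  induction j with
  | zero =>
    intro m hm hj
    exact (hT.boundary Side.right ⟨m, hm⟩ (by
      rw [nbr_right, dif_neg (by simp only; omega)])).le
  | succ j ih =>
    intro m hm hj
    have h := hT.interior Side.right ⟨m, hm⟩ ⟨m + 1, by omega⟩ (by
      rw [nbr_right, dif_pos (by simp only; omega)])
    rw [h]
    exact (hE _).bdry_lt.le.trans (ih (m + 1) (by omega) (by omega))

theorem bdry_mem (hT : d.Tessellates a b) (hE : ∀ k, (d.elem k).IsSBP p) (k : Fin d.ne)
    (γ : Side) : (d.elem k).bdry γ ∈ Icc a b := by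
  have h1 := hT.left_ge hE k k.2
  have h2 := hT.right_le hE (d.ne - k - 1) k k.2 (by omega)
  have h3 := (hE k).bdry_lt
  cases γ
  · exact ⟨h1, h3.le.trans h2⟩
  · exact ⟨h1.trans h3.le, h2⟩

theorem sum_normal (hT : d.Tessellates a b) (Φ : ℝ → ℝ) :
    ∑ k, ∑ γ : Side, γ.normal * Φ ((d.elem k).bdry γ) =
      ∑ γ : Side, γ.normal * Φ (domainEnd a b γ) := by
  rw [← d.sum_ends hT.ne_pos (fun γ => γ.normal * Φ (domainEnd a b γ)), ← sub_eq_zero]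
  simp only [← Finset.sum_sub_distrib]
  refine d.sum_faces_eq_zero (fun γ k => γ.normal * Φ ((d.elem k).bdry γ) -
    (d.nbr γ k).elim (γ.normal * Φ (domainEnd a b γ)) fun _ => 0)
    (fun γ k h => ?_) (fun γ k m h => ?_)
  · simp [h, hT.boundary γ k h]
  · simp [h, nbr_opp h, hT.interior γ k m h]

end Tessellates

/-- All elements are regular, at scales `ρ k` comparable between neighbours, and the SAT coefficients
are bounded by `B` at these scales. -/
structure IsRegular (d : Discretization n) (p : ℕ) (bc : Side → BC) (a b B : ℝ)
    (c ρ : Fin d.ne → ℝ) : Prop where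
  elem : ∀ k, (d.elem k).IsRegular p a b B (c k) (ρ k)
  one_le : 1 ≤ B
  ρ_nbr : ∀ γ k m, d.nbr γ k = some m → ρ m ≤ B * ρ k
  ρ_le : ∀ k, ρ k ≤ B * d.h
  sum_ρ : ∑ k, ρ k ≤ B * (b - a)
  T1_le : ∀ γ k m, d.nbr γ k = some m → |d.T1 γ k| ≤ B / ρ k
  T2_le : ∀ γ k m, d.nbr γ k = some m → |d.T2 γ k| ≤ B
  T3_le : ∀ γ k m, d.nbr γ k = some m → |d.T3 γ k| ≤ B
  T4_le : ∀ γ k m, d.nbr γ k = some m → |d.T4 γ k| ≤ B * ρ k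
  TD_le : ∀ γ k, d.nbr γ k = none → bc γ = BC.dirichlet → |d.TD γ| ≤ B / ρ k

theorem size_le_h (d : Discretization n) (k : Fin d.ne) : (d.elem k).size ≤ d.h :=
  le_ciSup (f := fun k => (d.elem k).size) (Set.finite_range _).bddAbove k

theorem h_nonneg (d : Discretization n) : 0 ≤ d.h :=
  Real.iSup_nonneg fun _ => Metric.diam_nonneg

theorem exists_isRegular (n p : ℕ) (hp : 1 ≤ p) (hab : a < b) (bc : Side → BC) {C : ℝ}
    (hC : 0 ≤ C) : ∃ B, ∀ d : Discretization n, d.Tessellates a b →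
      (∀ k, (d.elem k).IsSBP p) → (∀ k, (d.elem k).IsNarrow p ∨ (d.elem k).IsWide) →
      d.Scaled bc C → ∃ c ρ, d.IsRegular p bc a b B c ρ := by
  -- The scale will be ρ = κ · size: within κ · size of any node lie all nodes and, by
  -- `abs_bdry_sub_le`, both end points.
  set κ : ℝ := n * C + 1 with hκ
  have hκ1 : 1 ≤ κ := by
    have : 0 ≤ (n : ℝ) * C := by positivity
    linarith
  have hκ0 : 0 < κ := by linarith
  have hba : 0 < b - a := sub_pos.mpr hab
  set B : ℝ := (C + 1) * κ * (1 + (b - a)) with hB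
  have hB1 : (C + 1) * κ ≤ B := le_mul_of_one_le_right (by positivity) (by linarith)
  have hBκC : C * κ ≤ B := le_trans (by gcongr; linarith) hB1
  have hBC : C ≤ B := (le_mul_of_one_le_right hC hκ1).trans hBκC
  have hBκ : κ ≤ B := (le_mul_of_one_le_left hκ0.le (by linarith)).trans hB1
  have hBκab : κ * (b - a) ≤ B := by
    have h1 : κ * (b - a) ≤ (C + 1) * κ * (b - a) := by
      gcongr
      exact le_mul_of_one_le_left hκ0.le (by linarith)
    refine h1.trans ?_
    rw [hB]
    gcongr
    linarith
  have hB0 : 0 ≤ B := hC.trans hBC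
  refine ⟨B, fun d hT hE hk hS => ?_⟩
  have i₀ : Fin d.ne → Fin n := fun k => (hE k).exists_node.some
  have hs : ∀ k, 0 < (d.elem k).size := fun k => (hE k).size_pos hp
  have hdiv : ∀ k, ∀ x : ℝ, x * (d.elem k).size ≤ C → x ≤ B / (κ * (d.elem k).size) := by
    intro k x hx
    rw [le_div_iff₀ (mul_pos hκ0 (hs k))]
    calc x * (κ * (d.elem k).size) = (x * (d.elem k).size) * κ := by ring
      _ ≤ C * κ := by gcongr
      _ ≤ B := hBκC
  have hself : ∀ k, (d.elem k).size ≤ κ * (d.elem k).size := fun k =>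
    le_mul_of_one_le_left (hs k).le hκ1
  have hmul : ∀ k, C * (d.elem k).size ≤ B * (κ * (d.elem k).size) := fun k =>
    mul_le_mul hBC (hself k) (hs k).le hB0
  refine ⟨fun k => (d.elem k).node (i₀ k), fun k => κ * (d.elem k).size,
    { elem := fun k => ?_, one_le := hκ1.trans hBκ, ρ_nbr := fun γ k m h => ?_,
      ρ_le := fun k => ?_, sum_ρ := ?_, T1_le := fun γ k m h => hdiv k _ (hS.T1_le γ k m h),
      T2_le := fun γ k m h => (hS.T2_le γ k m h).trans hBC,
      T3_le := fun γ k m h => (hS.T3_le γ k m h).trans hBC,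
      T4_le := fun γ k m h => (hS.T4_le γ k m h).trans (hmul k),
      TD_le := fun γ k h hD => hdiv k _ (hS.TD_le γ k h hD) }⟩
  · have hsize : (d.elem k).size ≤ b - a := by
      rw [← Real.diam_Icc hab.le]
      refine Metric.diam_mono ?_ (Metric.isBounded_Icc a b)
      rintro _ ⟨i, rfl⟩
      exact hT.node_mem k i
    exact
      { isSBP := hE k
        kind := hk k
        ρ_pos := mul_pos hκ0 (hs k)
        ρ_le := (mul_le_mul_of_nonneg_left hsize hκ0.le).trans hBκab
        c_mem := hT.node_mem k _
        node_mem := hT.node_mem k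
        node_near := fun i => ((d.elem k).abs_node_sub_le i _).trans (hself k)
        bdry_mem := hT.bdry_mem hE k
        bdry_near := fun γ => ((hE k).abs_bdry_sub_le hp (hS.R_le k) γ _).trans (by
          rw [hκ]; nlinarith [hs k])
        R_le := fun γ i => (hS.R_le k γ i).trans hBC
        w_le := fun i => (hS.w_le k i).trans (hmul k)
        D_le := fun i j => hdiv k _ (hS.D_le k i j)
        Db_le := fun i j => hdiv k _ (hS.Db_le k i j)
        Mbar_le := fun l i j => hdiv k _ (hS.Mbar_le k l i j) }
  · have h1 := hS.size_le_nbr γ.opp m k (nbr_opp h)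
    calc κ * (d.elem m).size ≤ κ * (C * (d.elem k).size) := by gcongr
      _ = C * (κ * (d.elem k).size) := by ring
      _ ≤ B * (κ * (d.elem k).size) := by
        have := hs k
        gcongr
  · exact mul_le_mul hBκ (d.size_le_h k) (hs k).le hB0
  · have h1 : ∀ k ∈ Finset.univ, κ * (d.elem k).size ≤
        κ * C * ∑ γ : Side, γ.normal * (d.elem k).bdry γ := fun k _ => by
      rw [Side.sum_eq, mul_assoc]
      have := hS.size_le k
      simp only [Side.normal]
      gcongr
      exact this.trans (le_of_eq (by ring))
    refine (Finset.sum_le_sum h1).trans ?_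
    rw [← Finset.mul_sum, hT.sum_normal fun x => x, Side.sum_eq]
    simp only [Side.normal, domainEnd]
    have : -1 * a + 1 * b = b - a := by ring
    rw [this]
    gcongr
    linarith

/-- One factor ρ is spent on ∑ ρ ≤ B (b - a), the others become powers of h. No quasi-uniformity of
the mesh is needed. -/
theorem IsRegular.sum_le {bc : Side → BC} {B : ℝ} {c ρ : Fin d.ne → ℝ}
    (h : d.IsRegular p bc a b B c ρ) {x : Fin d.ne → ℝ} {K : ℝ} (hK : 0 ≤ K) {s : ℕ}
    (hx : ∀ k, |x k| ≤ K * ρ k ^ (s + 1)) :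
    |∑ k, x k| ≤ K * B ^ (s + 1) * (b - a) * d.h ^ s := by
  have hB : 0 ≤ B := zero_le_one.trans h.one_le
  have hh := d.h_nonneg
  calc |∑ k, x k| ≤ ∑ k, |x k| := Finset.abs_sum_le_sum_abs _ _
    _ ≤ ∑ k, K * (B * d.h) ^ s * ρ k := by
      refine Finset.sum_le_sum fun k _ => (hx k).trans ?_
      have hρ := (h.elem k).ρ_pos.le
      have := h.ρ_le k
      rw [pow_succ, ← mul_assoc]
      gcongr
    _ = K * (B * d.h) ^ s * ∑ k, ρ k := by rw [Finset.mul_sum]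
    _ ≤ K * (B * d.h) ^ s * (B * (b - a)) := by gcongr; exact h.sum_ρ
    _ = _ := by rw [mul_pow]; ring

end Discretization

end

/-! ### Discrete duality and the exact error representation. -/

noncomputable section

namespace Discretization

variable {n p : ℕ} {a b : ℝ}

/-- The discretization with the SAT coefficients of the discrete adjoint problem. -/
def dual (d : Discretization n) : Discretization n :=
  { d with T2 := fun γ k => d.T3 γ k - 1, T3 := fun γ k => d.T2 γ k + 1 }

/-- The numerical flux terms of the primal discretization at the face `γ` of element `k`, tested
with `v`. -/
def faceForm (d : Discretization n) (bc : Side → BC) (lam : ℝ → ℝ) (data : Side → ℝ)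
    (x v : Fin d.ne → Fin n → ℝ) (γ : Side) (k : Fin d.ne) : ℝ :=
  (d.nbr γ k).elim
    (match bc γ with
      | BC.dirichlet =>
          (d.tr x γ k - data γ) * (d.TD γ * d.tr v γ k - d.fl lam v γ k)
      | BC.neumann => (d.fl lam x γ k - data γ) * d.tr v γ k)
    (fun m =>
      (d.T1 γ k * (d.tr x γ k - d.tr x γ.opp m) +
        d.T3 γ k * (d.fl lam x γ k + d.fl lam x γ.opp m)) * d.tr v γ k +
      (d.T2 γ k * (d.tr x γ k - d.tr x γ.opp m) +
        d.T4 γ k * (d.fl lam x γ k + d.fl lam x γ.opp m)) * d.fl lam v γ k)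

theorem dual_faceForm (d : Discretization n) (bc : Side → BC) (lam : ℝ → ℝ) (data : Side → ℝ)
    (x v : Fin d.ne → Fin n → ℝ) (γ : Side) (k : Fin d.ne) :
    d.dual.faceForm bc lam data x v γ k = (d.nbr γ k).elim
    (match bc γ with
      | BC.dirichlet =>
          (d.tr x γ k - data γ) * (d.TD γ * d.tr v γ k - d.fl lam v γ k)
      | BC.neumann => (d.fl lam x γ k - data γ) * d.tr v γ k)
    (fun m =>
      (d.T1 γ k * (d.tr x γ k - d.tr x γ.opp m) +
        (d.T2 γ k + 1) * (d.fl lam x γ k + d.fl lam x γ.opp m)) * d.tr v γ k +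
      ((d.T3 γ k - 1) * (d.tr x γ k - d.tr x γ.opp m) +
        d.T4 γ k * (d.fl lam x γ k + d.fl lam x γ.opp m)) * d.fl lam v γ k) :=
  rfl

/-- The residual of the primal discretization on element `k` at `x`, tested with `v`. -/
def residual (d : Discretization n) (bc : Side → BC) (lam : ℝ → ℝ) (data : Side → ℝ)
    (F : ℝ → ℝ) (x v : Fin d.ne → Fin n → ℝ) (k : Fin d.ne) : ℝ :=
  v k ⬝ᵥ ((d.elem k).M lam *ᵥ x k) +
    ∑ γ : Side, (d.faceForm bc lam data x v γ k - d.tr v γ k * d.fl lam x γ k) -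
    ∑ i, (d.elem k).w i * v k i * F ((d.elem k).node i)

variable {d : Discretization n} {bc : Side → BC} {lam : ℝ → ℝ} {data : Side → ℝ} {F : ℝ → ℝ}

theorem dotProduct_sat (x v : Fin d.ne → Fin n → ℝ) (k : Fin d.ne) :
    v k ⬝ᵥ d.sat bc lam data x k = ∑ γ : Side, d.faceForm bc lam data x v γ k := by
  rw [sat, dotProduct_sum]
  refine Finset.sum_congr rfl fun γ _ => ?_
  have hR : v k ⬝ᵥ (d.elem k).R γ = d.tr v γ k := dotProduct_comm _ _
  have hD : v k ⬝ᵥ (d.elem k).Dn lam γ = d.fl lam v γ k := dotProduct_comm _ _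
  unfold faceForm
  rcases h : d.nbr γ k with _ | m
  · rcases hb : bc γ with _ | _ <;>
    simp only [boundarySAT, hb, Option.elim, dotProduct_smul, dotProduct_sub, hR, hD, smul_eq_mul]
  · simp only [interfaceSAT, Option.elim, dotProduct_smul, dotProduct_add, hR, hD, smul_eq_mul]

/-- The equation is multiplied by vᵀ H; `residual` is minus the result, with D⁽²⁾ split into M and
the end fluxes by `H_mulVec_D2`. -/
theorem SolvesPrimal.residual_eq_zero {x : Fin d.ne → Fin n → ℝ}
    (hx : d.SolvesPrimal bc lam data x F) (hE : ∀ k, (d.elem k).IsSBP p)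
    (v : Fin d.ne → Fin n → ℝ) (k : Fin d.ne) : d.residual bc lam data F x v k = 0 := by
  have h1 := congrArg (fun y => ∑ i, (d.elem k).w i * v k i * y i) (hx k)
  simp only [Pi.sub_apply, Pi.add_apply, mul_sub, mul_add, Finset.sum_sub_distrib,
    Finset.sum_add_distrib, Pi.zero_apply, mul_zero, Finset.sum_const_zero] at h1
  rw [(hE k).H_mulVec_D2, ← SBPElement.dotProduct_H_mulVec _ (v k) ((d.elem k).H⁻¹ *ᵥ _),
    Matrix.mulVec_mulVec, Matrix.mul_nonsing_inv _ (hE k).isUnit_det_H, Matrix.one_mulVec,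
    dotProduct_sat] at h1
  rw [residual, Finset.sum_sub_distrib]
  simp only [tr, fl, SBPElement.restrict_apply] at h1 ⊢
  linarith

theorem residual_sub {x v v' : Fin d.ne → Fin n → ℝ} (k : Fin d.ne) :
    d.residual bc lam data F x v k - d.residual bc lam data F x v' k =
      d.residual bc lam data F x (v - v') k := by
  have htr : ∀ γ k, d.tr (v - v') γ k = d.tr v γ k - d.tr v' γ k := fun γ k => by
    simp [tr, dotProduct_sub]
  have hfl : ∀ γ k, d.fl lam (v - v') γ k = d.fl lam v γ k - d.fl lam v' γ k := fun γ k => by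
    simp [fl, dotProduct_sub]
  have hface : ∀ γ, d.faceForm bc lam data x (v - v') γ k - d.tr (v - v') γ k * d.fl lam x γ k =
      (d.faceForm bc lam data x v γ k - d.tr v γ k * d.fl lam x γ k) -
      (d.faceForm bc lam data x v' γ k - d.tr v' γ k * d.fl lam x γ k) := by
    intro γ
    unfold faceForm
    rcases d.nbr γ k with _ | m
    · rcases bc γ with _ | _ <;> simp only [Option.elim, htr, hfl] <;> ring
    · simp only [Option.elim, htr, hfl]; ring
  simp only [residual, hface, Finset.sum_sub_distrib, Pi.sub_apply, sub_dotProduct, mul_sub,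
    sub_mul]
  ring

/-- Adjoint consistency turns the neighbour's coefficients into those of element k, so that the
adjoint SAT becomes one in jumps of values and sums of normal fluxes; symmetry of M removes the
extra volume term. -/
theorem SolvesAdjoint.solvesPrimal_dual {x : Fin d.ne → Fin n → ℝ}
    (hx : d.SolvesAdjoint bc lam data x F) (hA : d.AdjointConsistent lam) :
    d.dual.SolvesPrimal bc lam data x F := by
  intro k
  have h := hx k
  have hM : (d.elem k).M lam - ((d.elem k).M lam)ᵀ = 0 := by
    rw [← hA.M_symm k, sub_self]
  rw [hM, Matrix.zero_mulVec, Matrix.mulVec_zero, add_zero] at h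
  have hsat : d.dual.sat bc lam data x k = d.satAdj bc lam data x k := by
    refine Finset.sum_congr rfl fun γ _ => ?_
    rcases hn : d.nbr γ k with _ | m
    · have hn' : d.dual.nbr γ k = none := hn
      rw [hn']; rfl
    · have hn' : d.dual.nbr γ k = some m := hn
      rw [hn']
      change d.dual.interfaceSAT lam x γ k m = d.interfaceSATAdj lam x γ k m
      have e1 := hA.T1_eq γ k m hn
      have e2 := hA.T2_eq γ k m hn
      have e3 := hA.T3_eq γ k m hn
      have e4 := hA.T4_eq γ k m hn
      simp only [interfaceSAT, interfaceSATAdj]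
      change (d.T1 γ k * (d.tr x γ k - d.tr x γ.opp m) +
        (d.T2 γ k + 1) * (d.fl lam x γ k + d.fl lam x γ.opp m)) • (d.elem k).R γ +
        ((d.T3 γ k - 1) * (d.tr x γ k - d.tr x γ.opp m) +
        d.T4 γ k * (d.fl lam x γ k + d.fl lam x γ.opp m)) • (d.elem k).Dn lam γ = _
      have e2' : d.T2 γ.opp m = -(d.T2 γ k + 1) := by linarith
      have e3' : d.T3 γ.opp m = -(d.T3 γ k - 1) := by linarith
      rw [← e1, e2', e3', ← e4]
      congr 2 <;> ring
  rw [← hsat] at h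
  exact h

theorem SolvesPrimal.dual_dual {x : Fin d.ne → Fin n → ℝ}
    (hx : d.SolvesPrimal bc lam data x F) : d.dual.dual.SolvesPrimal bc lam data x F := by
  obtain ⟨ne, elem, T1, T2, T3, T4, TD⟩ := d
  have h2 : (fun γ k => T2 γ k + 1 - 1) = T2 := by ext; simp
  have h3 : (fun γ k => T3 γ k - 1 + 1) = T3 := by ext; simp
  simp only [dual]
  rw [h2, h3]
  exact hx

theorem AdjointConsistent.dual (hA : d.AdjointConsistent lam) : d.dual.AdjointConsistent lam where
  T1_eq := hA.T1_eq
  T2_eq γ k m h := by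
    have := hA.T3_eq γ k m h
    simp only [Discretization.dual]
    linarith
  T3_eq γ k m h := by
    have := hA.T2_eq γ k m h
    simp only [Discretization.dual]
    linarith
  T4_eq := hA.T4_eq
  M_symm := hA.M_symm

/-- The terms of the discrete functional at the face `γ` of element `k`. -/
def faceFunctional (d : Discretization n) (bc : Side → BC) (lam : ℝ → ℝ) (data dataF : Side → ℝ)
    (x : Fin d.ne → Fin n → ℝ) (γ : Side) (k : Fin d.ne) : ℝ :=
  (d.nbr γ k).elim
    (match bc γ with
      | BC.dirichlet =>
          -(dataF γ * d.fl lam x γ k) + dataF γ * d.TD γ * (d.tr x γ k - data γ)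
      | BC.neumann => dataF γ * d.tr x γ k)
    (fun _ => 0)

theorem discreteFunctional_eq (x : Fin d.ne → Fin n → ℝ) (W : ℝ → ℝ) (dataF : Side → ℝ) :
    d.discreteFunctional bc lam data x W dataF =
      ∑ k, (∑ i, (d.elem k).w i * x k i * W ((d.elem k).node i) +
        ∑ γ : Side, d.faceFunctional bc lam data dataF x γ k) := by
  rw [discreteFunctional, Finset.sum_add_distrib]
  congr 1
  · refine Finset.sum_congr rfl fun k _ => ?_
    rw [SBPElement.dotProduct_H_mulVec]
    exact Finset.sum_congr rfl fun i _ => by rw [SBPElement.restrict_apply]; ring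
  · refine Finset.sum_congr rfl fun k _ => Finset.sum_congr rfl fun γ _ => ?_
    unfold faceFunctional
    rcases d.nbr γ k with _ | m
    · rcases bc γ with _ | _ <;> rfl
    · rfl

/-- The change of the discrete functional is the primal residual tested with the discrete adjoint
solution. -/
theorem discreteFunctional_sub {uh ψh : Fin d.ne → Fin n → ℝ} {G : ℝ → ℝ} {dataF : Side → ℝ}
    (hE : ∀ k, (d.elem k).IsSBP p) (hk : ∀ k, (d.elem k).IsNarrow p ∨ (d.elem k).IsWide)
    (hA : d.AdjointConsistent lam) (hu : d.SolvesPrimal bc lam data uh F)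
    (hψ : d.dual.SolvesPrimal bc lam dataF ψh G) (u : Fin d.ne → Fin n → ℝ) :
    d.discreteFunctional bc lam data u G dataF - d.discreteFunctional bc lam data uh G dataF =
      ∑ k, d.residual bc lam data F u ψh k := by
  have h1 := fun k => hu.residual_eq_zero hE ψh k
  have h2 := fun k => hψ.residual_eq_zero hE u k
  have h3 := fun k => hψ.residual_eq_zero hE uh k
  -- The dual equations tested with u and u_h replace the sums against G by M, whose symmetry
  -- matches them with the primal form. Only these face terms remain.
  have hz := d.sum_faces_eq_zero (fun γ k =>
      d.faceFunctional bc lam data dataF u γ k - d.faceFunctional bc lam data dataF uh γ k -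
      (d.faceForm bc lam data u ψh γ k - d.tr ψh γ k * d.fl lam u γ k) +
      (d.faceForm bc lam data uh ψh γ k - d.tr ψh γ k * d.fl lam uh γ k) +
      (d.dual.faceForm bc lam dataF ψh u γ k - d.tr u γ k * d.fl lam ψh γ k) -
      (d.dual.faceForm bc lam dataF ψh uh γ k - d.tr uh γ k * d.fl lam ψh γ k)) ?_ ?_
  · rw [discreteFunctional_eq, discreteFunctional_eq, ← sub_eq_zero, ← Finset.sum_sub_distrib,
      ← Finset.sum_sub_distrib]
    refine (Finset.sum_congr rfl fun k _ => ?_).trans hz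
    have h1k := h1 k
    have h2k : u k ⬝ᵥ ((d.elem k).M lam *ᵥ ψh k) +
      ∑ γ : Side, (d.dual.faceForm bc lam dataF ψh u γ k - d.tr u γ k * d.fl lam ψh γ k) -
      ∑ i, (d.elem k).w i * u k i * G ((d.elem k).node i) = 0 := h2 k
    have h3k : uh k ⬝ᵥ ((d.elem k).M lam *ᵥ ψh k) +
      ∑ γ : Side, (d.dual.faceForm bc lam dataF ψh uh γ k - d.tr uh γ k * d.fl lam ψh γ k) -
      ∑ i, (d.elem k).w i * uh k i * G ((d.elem k).node i) = 0 := h3 k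
    rw [residual] at h1k ⊢
    have s1 := (hE k).M_symm (hk k) lam (u k) (ψh k)
    have s2 := (hE k).M_symm (hk k) lam (uh k) (ψh k)
    simp only [Finset.sum_add_distrib, Finset.sum_sub_distrib] at h1k h2k h3k ⊢
    linarith
  · intro γ k h
    simp only [dual_faceForm]
    simp only [faceForm, faceFunctional, h, Option.elim]
    rcases bc γ with _ | _ <;> ring
  · intro γ k m h
    have e1 := hA.T1_eq γ k m h
    have e2 := hA.T2_eq γ k m h
    have e3 := hA.T3_eq γ k m h
    have e4 := hA.T4_eq γ k m h
    have e2' : d.T2 γ.opp m = -(d.T2 γ k + 1) := by linarith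
    have e3' : d.T3 γ.opp m = 1 - d.T3 γ k := by linarith
    simp only [dual_faceForm]
    simp only [faceForm, faceFunctional, h, nbr_opp h, Option.elim, Side.opp_opp]
    rw [← e1, e2', e3', ← e4]
    ring

/-- Restriction of a function to all the nodes. -/
def restr (d : Discretization n) (V : ℝ → ℝ) : Fin d.ne → Fin n → ℝ :=
  fun k => (d.elem k).restrict V

/-- The extrapolation error at the face `γ` of element `k`. -/
def trErr (d : Discretization n) (V : ℝ → ℝ) (γ : Side) (k : Fin d.ne) : ℝ :=
  d.tr (d.restr V) γ k - V ((d.elem k).bdry γ)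

/-- The error of the numerical flux at the face `γ` of element `k`. -/
def flErr (d : Discretization n) (a b : ℝ) (lam V : ℝ → ℝ) (γ : Side) (k : Fin d.ne) : ℝ :=
  d.fl lam (d.restr V) γ k - γ.normal * flux a b lam V ((d.elem k).bdry γ)

/-- The part of the consistency error of the functional that stems from the face `γ` of
element `k`: a sum of products of a primal and an adjoint error. -/
def faceErr (d : Discretization n) (a b : ℝ) (bc : Side → BC) (lam U ψ : ℝ → ℝ) (γ : Side)
    (k : Fin d.ne) : ℝ :=
  (d.nbr γ k).elim
    (match bc γ with
      | BC.dirichlet => d.TD γ * (d.trErr ψ γ k * d.trErr U γ k) -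
          d.trErr ψ γ k * d.flErr a b lam U γ k - d.flErr a b lam ψ γ k * d.trErr U γ k
      | BC.neumann => 0)
    (fun m =>
      d.trErr ψ γ k * (d.T1 γ k * (d.trErr U γ k - d.trErr U γ.opp m) +
        d.T3 γ k * (d.flErr a b lam U γ k + d.flErr a b lam U γ.opp m)) +
      d.flErr a b lam ψ γ k * (d.T2 γ k * (d.trErr U γ k - d.trErr U γ.opp m) +
        d.T4 γ k * (d.flErr a b lam U γ k + d.flErr a b lam U γ.opp m)) -
      d.trErr ψ γ k * d.flErr a b lam U γ k)

/-- The error of the quadrature rule `H` for the derivative of `V`. -/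
def quadErr (E : SBPElement n) (a b : ℝ) (V : ℝ → ℝ) : ℝ :=
  ∑ i, E.w i * derivWithin V (Icc a b) (E.node i) - ∑ γ : Side, γ.normal * V (E.bdry γ)

/-- Here Φ is a primitive of G U. The H-sum of G U is thereby a quadrature of Φ', and the H-sum of
λU'ψ' - Fψ a quadrature of (λU'ψ)'. The end values then cancel or telescope, and adjoint consistency
with the exact boundary data leaves only products of errors at the faces. -/
theorem functional_sub_add_residual {G U ψ Φ : ℝ → ℝ} {uB ψB : Side → ℝ}
    (hT : d.Tessellates a b) (hA : d.AdjointConsistent lam)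
    (hU : SolvesDiffusion a b bc lam F U uB) (hψ : SolvesDiffusion a b bc lam G ψ ψB)
    (hΦ : ∀ x ∈ Icc a b, derivWithin Φ (Icc a b) x = G x * U x)
    (hΦI : ∫ x in a..b, G x * U x = Φ b - Φ a)
    (hprod : ∀ x ∈ Icc a b, derivWithin (fun x => flux a b lam U x * ψ x) (Icc a b) x =
      flux a b lam U x * derivWithin ψ (Icc a b) x - F x * ψ x) :
    functional a b bc lam G ψB U - d.discreteFunctional bc lam uB (d.restr U) G ψB +
      ∑ k, d.residual bc lam uB F (d.restr U) (d.restr ψ) k =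
    ∑ k, ((d.elem k).formDefect (Jet.of a b lam) (Jet.of a b U) (Jet.of a b ψ) +
      quadErr (d.elem k) a b (fun x => flux a b lam U x * ψ x) - quadErr (d.elem k) a b Φ +
      ∑ γ : Side, d.faceErr a b bc lam U ψ γ k) := by
  -- The continuous functional consists of end values only, hence can be distributed over faces like
  -- the discrete one.
  have hI : functional a b bc lam G ψB U = ∑ k, ∑ γ : Side, (d.nbr γ k).elim
      (γ.normal * Φ (domainEnd a b γ) + match bc γ with
        | BC.dirichlet => -(ψB γ * normalFlux a b lam U γ)
        | BC.neumann => ψB γ * U (domainEnd a b γ)) (fun _ => 0) := by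
    rw [sum_ends hT.ne_pos (fun γ => γ.normal * Φ (domainEnd a b γ) + match bc γ with
        | BC.dirichlet => -(ψB γ * normalFlux a b lam U γ)
        | BC.neumann => ψB γ * U (domainEnd a b γ)), functional, hΦI, Finset.sum_add_distrib]
    congr 1
    rw [Side.sum_eq]
    simp only [Side.normal, domainEnd]
    ring
  have hz := d.sum_faces_eq_zero (fun γ k =>
      (d.nbr γ k).elim
      (γ.normal * Φ (domainEnd a b γ) + match bc γ with
        | BC.dirichlet => -(ψB γ * normalFlux a b lam U γ)
        | BC.neumann => ψB γ * U (domainEnd a b γ)) (fun _ => 0) -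
      d.faceFunctional bc lam uB ψB (d.restr U) γ k +
      (d.faceForm bc lam uB (d.restr U) (d.restr ψ) γ k -
        d.tr (d.restr ψ) γ k * d.fl lam (d.restr U) γ k) +
      γ.normal * (flux a b lam U ((d.elem k).bdry γ) * d.trErr ψ γ k +
        flux a b lam ψ ((d.elem k).bdry γ) * d.trErr U γ k) +
      γ.normal * (flux a b lam U ((d.elem k).bdry γ) * ψ ((d.elem k).bdry γ)) -
      γ.normal * Φ ((d.elem k).bdry γ) - d.faceErr a b bc lam U ψ γ k) ?_ ?_
  · rw [hI, discreteFunctional_eq, ← sub_eq_zero, ← Finset.sum_sub_distrib,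
      ← Finset.sum_add_distrib, ← Finset.sum_sub_distrib]
    refine (Finset.sum_congr rfl fun k _ => ?_).trans hz
    have q1 : ∑ i, (d.elem k).w i * derivWithin Φ (Icc a b) ((d.elem k).node i) =
        ∑ i, (d.elem k).w i * d.restr U k i * G ((d.elem k).node i) :=
      Finset.sum_congr rfl fun i _ => by
        rw [hΦ _ (hT.node_mem k i), restr, SBPElement.restrict_apply]; ring
    have q2 : ∑ i, (d.elem k).w i * derivWithin (fun x => flux a b lam U x * ψ x) (Icc a b)
          ((d.elem k).node i) =
        ∑ i, (d.elem k).w i * ((Jet.of a b lam).1 ((d.elem k).node i) *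
          ((Jet.of a b U).2 ((d.elem k).node i) * (Jet.of a b ψ).2 ((d.elem k).node i))) -
        ∑ i, (d.elem k).w i * d.restr ψ k i * F ((d.elem k).node i) := by
      rw [← Finset.sum_sub_distrib]
      refine Finset.sum_congr rfl fun i _ => ?_
      rw [hprod _ (hT.node_mem k i), restr, SBPElement.restrict_apply]
      simp only [Jet.of, flux]
      ring
    have q3 : (d.elem k).formDefect (Jet.of a b lam) (Jet.of a b U) (Jet.of a b ψ) =
        d.restr ψ k ⬝ᵥ ((d.elem k).M lam *ᵥ d.restr U k) -
        ∑ i, (d.elem k).w i * ((Jet.of a b lam).1 ((d.elem k).node i) *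
          ((Jet.of a b U).2 ((d.elem k).node i) * (Jet.of a b ψ).2 ((d.elem k).node i))) -
        ∑ γ : Side, γ.normal * (flux a b lam U ((d.elem k).bdry γ) * d.trErr ψ γ k +
          flux a b lam ψ ((d.elem k).bdry γ) * d.trErr U γ k) := by
      rw [SBPElement.formDefect]
      congr 1
      refine Finset.sum_congr rfl fun γ _ => ?_
      simp only [Jet.of, flux, trErr, tr, restr]
      ring
    rw [residual, quadErr, quadErr, q1, q2, q3]
    simp only [Finset.sum_add_distrib, Finset.sum_sub_distrib]
    ring
  · intro γ k h
    have hb := hT.boundary γ k h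
    simp only [faceForm, faceFunctional, faceErr, h, Option.elim, trErr, flErr, hb, normalFlux]
    rcases hbc : bc γ with _ | _
    · rw [← hU.dirichlet γ hbc, ← hψ.dirichlet γ hbc]
      simp only
      ring
    · rw [← hU.neumann γ hbc, ← hψ.neumann γ hbc]
      simp only [normalFlux]
      ring
  · intro γ k m h
    have e1 := hA.T1_eq γ k m h
    have e2 := hA.T2_eq γ k m h
    have e3 := hA.T3_eq γ k m h
    have e4 := hA.T4_eq γ k m h
    have e2' : d.T2 γ.opp m = -(d.T2 γ k + 1) := by linarith
    have e3' : d.T3 γ.opp m = 1 - d.T3 γ k := by linarith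
    simp only [faceForm, faceFunctional, faceErr, h, nbr_opp h, Option.elim, Side.opp_opp, trErr,
      flErr, hT.interior γ k m h, Side.normal_opp]
    rw [← e1, e2', e3', ← e4]
    ring

end Discretization

end

/-! ### Duality of the continuous problem. -/

noncomputable section

variable {a b : ℝ}

theorem exists_primitive (hab : a < b) {W : ℝ → ℝ} {N : ℕ}
    (hW : ContDiffOn ℝ (N : WithTop ℕ∞) W (Icc a b)) :
    ∃ Φ : ℝ → ℝ, ContDiffOn ℝ ((N + 1 : ℕ) : WithTop ℕ∞) Φ (Icc a b) ∧
      (∀ x ∈ Icc a b, derivWithin Φ (Icc a b) x = W x) ∧ ∫ x in a..b, W x = Φ b - Φ a := by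
  -- The extension by constants is continuous on ℝ, so its integral is differentiable at the end
  -- points too.
  set g : ℝ → ℝ := IccExtend hab.le ((Icc a b).domRestrict W) with hg
  have hgc : Continuous g := (continuousOn_iff_continuous_domRestrict.mp hW.continuousOn).Icc_extend'
  have hgW : ∀ x ∈ Icc a b, g x = W x := fun x hx => by
    rw [hg, IccExtend_of_mem hab.le _ hx]; rfl
  have hd : ∀ x, HasDerivAt (fun x => ∫ t in a..x, g t) (g x) x := fun x =>
    intervalIntegral.integral_hasDerivAt_right (hgc.intervalIntegrable _ _)
      (hgc.stronglyMeasurableAtFilter _ _) hgc.continuousAt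
  have hd' : ∀ x ∈ Icc a b, derivWithin (fun x => ∫ t in a..x, g t) (Icc a b) x = W x :=
    fun x hx => by
      rw [(hd x).hasDerivWithinAt.derivWithin (uniqueDiffOn_Icc hab x hx), hgW x hx]
  refine ⟨fun x => ∫ t in a..x, g t, ?_, hd', ?_⟩
  · have hcast : ((N + 1 : ℕ) : WithTop ℕ∞) = (N : WithTop ℕ∞) + 1 := by push_cast; rfl
    rw [hcast, contDiffOn_succ_iff_derivWithin (uniqueDiffOn_Icc hab)]
    refine ⟨fun x _ => (hd x).differentiableAt.differentiableWithinAt, by simp, hW.congr hd'⟩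
  · simp only [intervalIntegral.integral_same, sub_zero]
    refine intervalIntegral.integral_congr fun x hx => ?_
    rw [uIcc_of_le hab.le] at hx
    exact (hgW x hx).symm

theorem hasDerivWithinAt_flux_mul (hab : a < b) {bc : Side → BC} {lam F U ψ : ℝ → ℝ}
    {uB : Side → ℝ} {p : ℕ} (hlam : ContDiffOn ℝ ((2 * p + 1 : ℕ) : WithTop ℕ∞) lam (Icc a b))
    (hUs : ContDiffOn ℝ ((2 * p + 2 : ℕ) : WithTop ℕ∞) U (Icc a b))
    (hψs : ContDiffOn ℝ ((2 * p + 2 : ℕ) : WithTop ℕ∞) ψ (Icc a b))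
    (hU : SolvesDiffusion a b bc lam F U uB) {x : ℝ} (hx : x ∈ Icc a b) :
    HasDerivWithinAt (fun x => flux a b lam U x * ψ x)
      (flux a b lam U x * derivWithin ψ (Icc a b) x - F x * ψ x) (Icc a b) x := by
  have h1 := (SBPElement.contDiffOn_flux hab hlam hUs).hasDerivWithinAt_Icc hx
  have h2 := hψs.hasDerivWithinAt_Icc hx
  refine (h1.mul h2).congr_deriv ?_
  rw [← hU.pde x hx]
  ring

/-- Duality of the functionals of the continuous problem. -/
theorem functional_eq (hab : a < b) {bc : Side → BC} {lam F G U ψ : ℝ → ℝ}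
    {uB ψB : Side → ℝ} {p : ℕ}
    (hlam : ContDiffOn ℝ ((2 * p + 1 : ℕ) : WithTop ℕ∞) lam (Icc a b))
    (hUs : ContDiffOn ℝ ((2 * p + 2 : ℕ) : WithTop ℕ∞) U (Icc a b))
    (hψs : ContDiffOn ℝ ((2 * p + 2 : ℕ) : WithTop ℕ∞) ψ (Icc a b))
    (hF : ContinuousOn F (Icc a b)) (hG : ContinuousOn G (Icc a b))
    (hU : SolvesDiffusion a b bc lam F U uB) (hψ : SolvesDiffusion a b bc lam G ψ ψB) :
    functional a b bc lam G ψB U = functional a b bc lam F uB ψ := by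
  have hGU : IntervalIntegrable (fun x => G x * U x) MeasureTheory.volume a b :=
    (hG.mul hUs.continuousOn).intervalIntegrable_of_Icc hab.le
  have hFψ : IntervalIntegrable (fun x => F x * ψ x) MeasureTheory.volume a b :=
    (hF.mul hψs.continuousOn).intervalIntegrable_of_Icc hab.le
  -- Green's identity: the terms λU'ψ' cancel, and the boundary values of λU'ψ - λψ'U are the
  -- boundary terms of the two functionals.
  have hd : ∀ x ∈ Icc a b, HasDerivWithinAt
      (fun x => flux a b lam U x * ψ x - flux a b lam ψ x * U x)
      (G x * U x - F x * ψ x) (Icc a b) x := fun x hx => by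
    refine ((hasDerivWithinAt_flux_mul hab hlam hUs hψs hU hx).sub
      (hasDerivWithinAt_flux_mul hab hlam hψs hUs hψ hx)).congr_deriv ?_
    simp only [flux]
    ring
  have hI := intervalIntegral.integral_eq_sub_of_hasDerivAt_of_le hab.le
    (fun x hx => (hd x hx).continuousWithinAt)
    (fun x hx => (hd x (Ioo_subset_Icc_self hx)).hasDerivAt (Icc_mem_nhds hx.1 hx.2))
    (hGU.sub hFψ)
  rw [intervalIntegral.integral_sub hGU hFψ] at hI
  rw [functional, functional, ← sub_eq_zero, add_sub_add_comm, hI, ← Finset.sum_sub_distrib]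
  have hγ : ∀ γ : Side, ((match bc γ with
      | BC.dirichlet => -(ψB γ * normalFlux a b lam U γ)
      | BC.neumann => ψB γ * U (domainEnd a b γ)) - match bc γ with
      | BC.dirichlet => -(uB γ * normalFlux a b lam ψ γ)
      | BC.neumann => uB γ * ψ (domainEnd a b γ)) =
      -(γ.normal * (flux a b lam U (domainEnd a b γ) * ψ (domainEnd a b γ) -
        flux a b lam ψ (domainEnd a b γ) * U (domainEnd a b γ))) := by
    intro γ
    rcases hb : bc γ with _ | _
    · simp only
      rw [← hU.dirichlet γ hb, ← hψ.dirichlet γ hb, normalFlux, normalFlux]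
      ring
    · simp only
      rw [← hU.neumann γ hb, ← hψ.neumann γ hb, normalFlux, normalFlux]
      ring
  refine (congrArg (_ + ·) (Finset.sum_congr rfl fun γ _ => hγ γ)).trans ?_
  rw [Side.sum_eq]
  simp only [Side.normal, domainEnd]
  ring

/-! ### Bounds for the face terms. -/

namespace Discretization

variable {n p : ℕ} {d : Discretization n} {bc : Side → BC} {B K : ℝ} {c ρ : Fin d.ne → ℝ}

theorem IsRegular.jump_le (h : d.IsRegular p bc a b B c ρ) (hK : 0 ≤ K)
    {f : Side → Fin d.ne → ℝ} {s : ℕ} (hs : s ≤ p + 1) (hf : ∀ γ k, |f γ k| ≤ K * ρ k ^ s)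
    {γ : Side} {k m : Fin d.ne} (hm : d.nbr γ k = some m) :
    |f γ k| + |f γ.opp m| ≤ K * (1 + B ^ (p + 1)) * ρ k ^ s := by
  have hB := h.one_le
  have hρk := (h.elem k).ρ_pos
  have h1 : ρ m ^ s ≤ B ^ (p + 1) * ρ k ^ s := by
    calc ρ m ^ s ≤ (B * ρ k) ^ s := pow_le_pow_left₀ (h.elem m).ρ_pos.le (h.ρ_nbr γ k m hm) s
      _ = B ^ s * ρ k ^ s := mul_pow ..
      _ ≤ _ := by gcongr
  calc _ ≤ K * ρ k ^ s + K * (B ^ (p + 1) * ρ k ^ s) :=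
        add_le_add (hf γ k) ((hf γ.opp m).trans (by gcongr))
    _ = _ := by ring

/-- The scaling of the coefficients balances values (order p+1) against fluxes (order p): T⁽¹⁾ costs
a power of ρ and T⁽⁴⁾ gains one. Errors of the neighbour are converted by the comparability of
scales. -/
theorem IsRegular.abs_interface_le (h : d.IsRegular p bc a b B c ρ) (hK : 0 ≤ K)
    {f g : Side → Fin d.ne → ℝ} (hf : ∀ γ k, |f γ k| ≤ K * ρ k ^ (p + 1))
    (hg : ∀ γ k, |g γ k| ≤ K * ρ k ^ p) {γ : Side} {k m : Fin d.ne} (hm : d.nbr γ k = some m) :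
    |d.T1 γ k * (f γ k - f γ.opp m) + d.T3 γ k * (g γ k + g γ.opp m)| ≤
        2 * B * (K * (1 + B ^ (p + 1))) * ρ k ^ p ∧
    |d.T2 γ k * (f γ k - f γ.opp m) + d.T4 γ k * (g γ k + g γ.opp m)| ≤
        2 * B * (K * (1 + B ^ (p + 1))) * ρ k ^ (p + 1) := by
  have hρ := (h.elem k).ρ_pos
  have h1 := (abs_sub_le_add le_rfl le_rfl).trans (h.jump_le hK le_rfl hf hm)
  have h2 := (abs_add_le_add le_rfl le_rfl).trans (h.jump_le hK (Nat.le_succ p) hg hm)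
  constructor
  · refine (abs_add_le_add (abs_mul_le_mul (h.T1_le γ k m hm) h1)
      (abs_mul_le_mul (h.T3_le γ k m hm) h2)).trans (le_of_eq ?_)
    rw [pow_succ]
    field_simp
    ring
  · refine (abs_add_le_add (abs_mul_le_mul (h.T2_le γ k m hm) h1)
      (abs_mul_le_mul (h.T4_le γ k m hm) h2)).trans (le_of_eq ?_)
    ring

theorem IsRegular.abs_faceErr_le (h : d.IsRegular p bc a b B c ρ) (hK : 0 ≤ K)
    {lam U ψ : ℝ → ℝ} (hU : ∀ γ k, |d.trErr U γ k| ≤ K * ρ k ^ (p + 1))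
    (hU' : ∀ γ k, |d.flErr a b lam U γ k| ≤ K * ρ k ^ p)
    (hψ : ∀ γ k, |d.trErr ψ γ k| ≤ K * ρ k ^ (p + 1))
    (hψ' : ∀ γ k, |d.flErr a b lam ψ γ k| ≤ K * ρ k ^ p) (γ : Side) (k : Fin d.ne) :
    |d.faceErr a b bc lam U ψ γ k| ≤
      (4 * B * (K * (1 + B ^ (p + 1))) * K + (B + 2) * (K * K)) * ρ k ^ (2 * p + 1) := by
  have hρ := (h.elem k).ρ_pos
  have hB : 0 ≤ B := zero_le_one.trans h.one_le
  unfold faceErr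
  rcases hn : d.nbr γ k with _ | m
  · rcases hb : bc γ with _ | _
    · simp only [Option.elim]
      refine (abs_sub_le_add (abs_sub_le_add
        (abs_mul_le_mul (h.TD_le γ k hn hb) (abs_mul_le_mul (hψ γ k) (hU γ k)))
        (abs_mul_le_mul (hψ γ k) (hU' γ k))) (abs_mul_le_mul (hψ' γ k) (hU γ k))).trans ?_
      have e : B / ρ k * (K * ρ k ^ (p + 1) * (K * ρ k ^ (p + 1))) +
          K * ρ k ^ (p + 1) * (K * ρ k ^ p) + K * ρ k ^ p * (K * ρ k ^ (p + 1)) =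
          (B + 2) * (K * K) * ρ k ^ (2 * p + 1) := by
        field_simp
        ring
      rw [e]
      gcongr
      exact le_add_of_nonneg_left (by positivity)
    · simp only [Option.elim, abs_zero]
      positivity
  · simp only [Option.elim]
    obtain ⟨h1, h2⟩ := h.abs_interface_le hK hU hU' hn
    refine (abs_sub_le_add (abs_add_le_add (abs_mul_le_mul (hψ γ k) h1)
      (abs_mul_le_mul (hψ' γ k) h2)) (abs_mul_le_mul (hψ γ k) (hU' γ k))).trans ?_
    have e : K * ρ k ^ (p + 1) * (2 * B * (K * (1 + B ^ (p + 1))) * ρ k ^ p) +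
        K * ρ k ^ p * (2 * B * (K * (1 + B ^ (p + 1))) * ρ k ^ (p + 1)) +
        K * ρ k ^ (p + 1) * (K * ρ k ^ p) =
        (4 * B * (K * (1 + B ^ (p + 1))) * K + 1 * (K * K)) * ρ k ^ (2 * p + 1) := by
      ring
    rw [e]
    gcongr
    linarith

/-- U and its flux are continuous across interfaces and satisfy the boundary conditions, so the SATs
see only extrapolation and flux errors. -/
theorem residual_eq (hT : d.Tessellates a b) {lam F U : ℝ → ℝ} {uB : Side → ℝ}
    (hU : SolvesDiffusion a b bc lam F U uB) (v : Fin d.ne → Fin n → ℝ) (k : Fin d.ne) :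
    d.residual bc lam uB F (d.restr U) v k =
      (v k ⬝ᵥ ((d.elem k).M lam *ᵥ (d.elem k).restrict U) -
        ∑ γ : Side, γ.normal * (((d.elem k).R γ ⬝ᵥ v k) * flux a b lam U ((d.elem k).bdry γ)) +
        ∑ i, (d.elem k).w i * v k i *
          derivWithin (flux a b lam U) (Icc a b) ((d.elem k).node i)) +
      ∑ γ : Side, ((d.nbr γ k).elim
        (match bc γ with
          | BC.dirichlet => d.trErr U γ k * (d.TD γ * d.tr v γ k - d.fl lam v γ k)
          | BC.neumann => d.flErr a b lam U γ k * d.tr v γ k)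
        (fun m =>
          (d.T1 γ k * (d.trErr U γ k - d.trErr U γ.opp m) +
            d.T3 γ k * (d.flErr a b lam U γ k + d.flErr a b lam U γ.opp m)) * d.tr v γ k +
          (d.T2 γ k * (d.trErr U γ k - d.trErr U γ.opp m) +
            d.T4 γ k * (d.flErr a b lam U γ k + d.flErr a b lam U γ.opp m)) * d.fl lam v γ k) -
        d.tr v γ k * d.flErr a b lam U γ k) := by
  have hsrc : ∑ i, (d.elem k).w i * v k i * F ((d.elem k).node i) =
      -∑ i, (d.elem k).w i * v k i *
          derivWithin (flux a b lam U) (Icc a b) ((d.elem k).node i) := by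
    rw [← Finset.sum_neg_distrib]
    refine Finset.sum_congr rfl fun i _ => ?_
    rw [← hU.pde _ (hT.node_mem k i)]
    ring
  have hface : ∀ γ, d.faceForm bc lam uB (d.restr U) v γ k -
      d.tr v γ k * d.fl lam (d.restr U) γ k = (((d.nbr γ k).elim
        (match bc γ with
          | BC.dirichlet => d.trErr U γ k * (d.TD γ * d.tr v γ k - d.fl lam v γ k)
          | BC.neumann => d.flErr a b lam U γ k * d.tr v γ k)
        (fun m =>
          (d.T1 γ k * (d.trErr U γ k - d.trErr U γ.opp m) +
            d.T3 γ k * (d.flErr a b lam U γ k + d.flErr a b lam U γ.opp m)) * d.tr v γ k +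
          (d.T2 γ k * (d.trErr U γ k - d.trErr U γ.opp m) +
            d.T4 γ k * (d.flErr a b lam U γ k + d.flErr a b lam U γ.opp m)) * d.fl lam v γ k) -
        d.tr v γ k * d.flErr a b lam U γ k)) -
      γ.normal * (((d.elem k).R γ ⬝ᵥ v k) * flux a b lam U ((d.elem k).bdry γ)) := by
    intro γ
    have htr : (d.elem k).R γ ⬝ᵥ v k = d.tr v γ k := rfl
    rw [htr]
    unfold faceForm
    rcases hn : d.nbr γ k with _ | m
    · rcases hb : bc γ with _ | _
      · simp only [Option.elim, trErr, flErr, hT.boundary γ k hn, hU.dirichlet γ hb]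
        ring
      · have := hU.neumann γ hb
        rw [normalFlux] at this
        simp only [Option.elim, flErr, hT.boundary γ k hn, ← this]
        ring
    · simp only [Option.elim, trErr, flErr, hT.interior γ k m hn, Side.normal_opp]
      ring
  rw [residual, hsrc, Finset.sum_congr rfl fun γ _ => hface γ, Finset.sum_sub_distrib]
  simp only [restr]
  ring

theorem IsRegular.abs_face_le (h : d.IsRegular p bc a b B c ρ) (hK : 0 ≤ K)
    {lam U : ℝ → ℝ} {Λ ν : ℝ} (hΛ0 : 0 ≤ Λ) (hΛ : ∀ x ∈ Icc a b, |lam x| ≤ Λ) (hν0 : 0 ≤ ν)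
    (hU : ∀ γ k, |d.trErr U γ k| ≤ K * ρ k ^ (p + 1))
    (hU' : ∀ γ k, |d.flErr a b lam U γ k| ≤ K * ρ k ^ p)
    {v : Fin d.ne → Fin n → ℝ} (hv : ∀ k i, |v k i| ≤ ν) (γ : Side) (k : Fin d.ne) :
    |(d.nbr γ k).elim
        (match bc γ with
          | BC.dirichlet => d.trErr U γ k * (d.TD γ * d.tr v γ k - d.fl lam v γ k)
          | BC.neumann => d.flErr a b lam U γ k * d.tr v γ k)
        (fun m =>
          (d.T1 γ k * (d.trErr U γ k - d.trErr U γ.opp m) +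
            d.T3 γ k * (d.flErr a b lam U γ k + d.flErr a b lam U γ.opp m)) * d.tr v γ k +
          (d.T2 γ k * (d.trErr U γ k - d.trErr U γ.opp m) +
            d.T4 γ k * (d.flErr a b lam U γ k + d.flErr a b lam U γ.opp m)) * d.fl lam v γ k) -
        d.tr v γ k * d.flErr a b lam U γ k| ≤
      ((2 * B * (K * (1 + B ^ (p + 1))) + K * (B + 2)) *
        (n * B + n * (B * (Λ * (n * B))))) * (ν * ρ k ^ p) := by
  have hρ := (h.elem k).ρ_pos
  have hB : 0 ≤ B := zero_le_one.trans h.one_le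
  set L : ℝ := n * (B * (Λ * (n * B))) with hL
  have hL0 : 0 ≤ L := by positivity
  have htr : |d.tr v γ k| ≤ n * (B * ν) := (h.elem k).abs_R_dotProduct_le γ (hv k)
  have hfl : |d.fl lam v γ k| ≤ L / ρ k * ν := (h.elem k).abs_Dn_le hΛ γ (hv k)
  set K' : ℝ := 2 * B * (K * (1 + B ^ (p + 1))) with hK'
  have hK'0 : 0 ≤ K' := by positivity
  have hlast : |d.tr v γ k * d.flErr a b lam U γ k| ≤ K * (n * B) * (ν * ρ k ^ p) :=
    (abs_mul_le_mul htr (hU' γ k)).trans (le_of_eq (by ring))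
  have hfirst : |(d.nbr γ k).elim
        (match bc γ with
          | BC.dirichlet => d.trErr U γ k * (d.TD γ * d.tr v γ k - d.fl lam v γ k)
          | BC.neumann => d.flErr a b lam U γ k * d.tr v γ k)
        (fun m =>
          (d.T1 γ k * (d.trErr U γ k - d.trErr U γ.opp m) +
            d.T3 γ k * (d.flErr a b lam U γ k + d.flErr a b lam U γ.opp m)) * d.tr v γ k +
          (d.T2 γ k * (d.trErr U γ k - d.trErr U γ.opp m) +
            d.T4 γ k * (d.flErr a b lam U γ k + d.flErr a b lam U γ.opp m)) * d.fl lam v γ k)| ≤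
        ((K' + K * (B + 1)) * (n * B + L)) * (ν * ρ k ^ p) := by
    rcases hn : d.nbr γ k with _ | m
    · rcases hb : bc γ with _ | _
      · simp only [Option.elim]
        refine (abs_mul_le_mul (hU γ k) (abs_sub_le_add (abs_mul_le_mul (h.TD_le γ k hn hb) htr)
          hfl)).trans ?_
        have e : K * ρ k ^ (p + 1) * (B / ρ k * (n * (B * ν)) + L / ρ k * ν) =
            (K * (B * (n * B) + L)) * (ν * ρ k ^ p) := by
          rw [pow_succ]
          field_simp
        rw [e]
        refine mul_le_mul_of_nonneg_right ?_ (by positivity)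
        have h1 : 0 ≤ K' * (n * B + L) := by positivity
        have h2 : 0 ≤ K * (n * B + B * L) := by positivity
        linarith
      · simp only [Option.elim]
        refine (abs_mul_le_mul (hU' γ k) htr).trans ?_
        have e : K * ρ k ^ p * (n * (B * ν)) = (K * (n * B)) * (ν * ρ k ^ p) := by ring
        rw [e]
        refine mul_le_mul_of_nonneg_right ?_ (by positivity)
        have h1 : 0 ≤ K' * (n * B + L) := by positivity
        have h2 : 0 ≤ K * (B * (n * B) + B * L + L) := by positivity
        linarith
    · simp only [Option.elim]
      obtain ⟨h1, h2⟩ := h.abs_interface_le hK hU hU' hn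
      refine (abs_add_le_add (abs_mul_le_mul h1 htr) (abs_mul_le_mul h2 hfl)).trans ?_
      rw [← hK']
      have e : K' * ρ k ^ p * (n * (B * ν)) + K' * ρ k ^ (p + 1) * (L / ρ k * ν) =
          (K' * (n * B + L)) * (ν * ρ k ^ p) := by
        rw [pow_succ]
        field_simp
      rw [e]
      refine mul_le_mul_of_nonneg_right ?_ (by positivity)
      have h3 : 0 ≤ K * (B + 1) * (n * B + L) := by positivity
      linarith
  refine (abs_sub_le_add hfirst hlast).trans ?_
  rw [← add_mul]
  gcongr
  have : 0 ≤ K * L := by positivity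
  linarith

end Discretization

end

/-! ### The superconvergence estimate and its transfer to the adjoint. -/

noncomputable section

namespace Discretization

variable {n p : ℕ} {a b : ℝ} {bc : Side → BC} {B C : ℝ}

theorem face_estimates (n : ℕ) (hab : a < b) (hp : 1 ≤ p) (hB : 0 ≤ B) {lam U ψ : ℝ → ℝ}
    (hlam : ContDiffOn ℝ (p : WithTop ℕ∞) lam (Icc a b))
    (hU : ContDiffOn ℝ ((p + 1 : ℕ) : WithTop ℕ∞) U (Icc a b))
    (hψ : ContDiffOn ℝ ((p + 1 : ℕ) : WithTop ℕ∞) ψ (Icc a b)) :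
    ∃ K, 0 ≤ K ∧ ∀ (d : Discretization n) c ρ, d.IsRegular p bc a b B c ρ →
      (∀ γ k, |d.trErr U γ k| ≤ K * ρ k ^ (p + 1)) ∧
      (∀ γ k, |d.flErr a b lam U γ k| ≤ K * ρ k ^ p) ∧
      (∀ γ k, |d.trErr ψ γ k| ≤ K * ρ k ^ (p + 1)) ∧
      (∀ γ k, |d.flErr a b lam ψ γ k| ≤ K * ρ k ^ p) := by
  obtain ⟨K₁, h₁, e₁⟩ := SBPElement.extrapolation_estimate (p := p) n hab hB (by omega) le_rfl hU
  obtain ⟨K₂, h₂, e₂⟩ := SBPElement.flux_estimate n hab hp hB hlam hU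
  obtain ⟨K₃, h₃, e₃⟩ := SBPElement.extrapolation_estimate (p := p) n hab hB (by omega) le_rfl hψ
  obtain ⟨K₄, h₄, e₄⟩ := SBPElement.flux_estimate n hab hp hB hlam hψ
  refine ⟨K₁ + K₂ + K₃ + K₄, by positivity, fun d c ρ h => ⟨fun γ k => ?_, fun γ k => ?_,
    fun γ k => ?_, fun γ k => ?_⟩⟩ <;> have hρ := (h.elem k).ρ_pos
  · refine (e₁ _ _ _ (h.elem k) γ).trans ?_
    gcongr; linarith
  · refine (e₂ _ _ _ (h.elem k) γ).trans ?_
    gcongr; linarith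
  · refine (e₃ _ _ _ (h.elem k) γ).trans ?_
    gcongr; linarith
  · refine (e₄ _ _ _ (h.elem k) γ).trans ?_
    gcongr; linarith

/-- Superconvergence of the functional of the primal solution. -/
theorem functional_error_le (n : ℕ) (hab : a < b) (hp : 1 ≤ p) (hB : 0 ≤ B) (hC : 0 ≤ C)
    {lam F G U ψ : ℝ → ℝ} {uB ψB : Side → ℝ}
    (hUs : ContDiffOn ℝ ((2 * p + 2 : ℕ) : WithTop ℕ∞) U (Icc a b))
    (hψs : ContDiffOn ℝ ((2 * p + 2 : ℕ) : WithTop ℕ∞) ψ (Icc a b))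
    (hlams : ContDiffOn ℝ ((2 * p + 1 : ℕ) : WithTop ℕ∞) lam (Icc a b))
    (hGs : ContDiffOn ℝ ((2 * p : ℕ) : WithTop ℕ∞) G (Icc a b))
    (hU : SolvesDiffusion a b bc lam F U uB) (hψ : SolvesDiffusion a b bc lam G ψ ψB) :
    ∃ K : ℝ, ∀ d : Discretization n, d.Tessellates a b →
      (∃ c ρ, d.IsRegular p bc a b B c ρ) → d.AdjointConsistent lam →
      ∀ uh ψh : Fin d.ne → Fin n → ℝ, d.SolvesPrimal bc lam uB uh F →
        d.dual.SolvesPrimal bc lam ψB ψh G → d.Accurate ψh ψ (p + 1) C →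
        |functional a b bc lam G ψB U - d.discreteFunctional bc lam uB uh G ψB|
          ≤ K * d.h ^ (2 * p) := by
  have hlamp : ContDiffOn ℝ ((p + 1 : ℕ) : WithTop ℕ∞) lam (Icc a b) :=
    hlams.of_le (by norm_cast; omega)
  have hUp : ContDiffOn ℝ ((p + 1 : ℕ) : WithTop ℕ∞) U (Icc a b) :=
    hUs.of_le (by norm_cast; omega)
  have hψp : ContDiffOn ℝ ((p + 1 : ℕ) : WithTop ℕ∞) ψ (Icc a b) :=
    hψs.of_le (by norm_cast; omega)
  have hfluxψ : ContDiffOn ℝ ((2 * p + 1 : ℕ) : WithTop ℕ∞)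
      (fun x => flux a b lam U x * ψ x) (Icc a b) :=
    (SBPElement.contDiffOn_flux hab hlams hUs).mul (hψs.of_le (by norm_cast; omega))
  obtain ⟨Φ, hΦs, hΦ, hΦI⟩ := exists_primitive hab
    (hGs.mul (hUs.of_le (by norm_cast; omega)))
  obtain ⟨Λ, hΛ0, hΛ⟩ := exists_abs_le_of_continuousOn hlams.continuousOn
  obtain ⟨K₁, hK₁, face⟩ := face_estimates (bc := bc) n hab hp hB
    (hlamp.of_le (by norm_cast; omega)) hUp hψp
  obtain ⟨K₂, hK₂, form⟩ := SBPElement.formDefect_estimate n hab hp hB hlams hUs hψs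
  obtain ⟨K₃, hK₃, quad⟩ := SBPElement.quadrature_estimate n hab hB hfluxψ
  obtain ⟨K₄, hK₄, quad'⟩ := SBPElement.quadrature_estimate n hab hB hΦs
  obtain ⟨K₅, hK₅, res⟩ := SBPElement.residual_estimate n hab hp hB hlamp hUp
  set A₁ : ℝ := 4 * B * (K₁ * (1 + B ^ (p + 1))) * K₁ + (B + 2) * (K₁ * K₁) with hA₁
  set A₂ : ℝ := (2 * B * (K₁ * (1 + B ^ (p + 1))) + K₁ * (B + 2)) *
        (n * B + n * (B * (Λ * (n * B)))) with hA₂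
  refine ⟨(K₂ + K₃ + K₄ + 2 * A₁) * B ^ (2 * p + 1) * (b - a) +
    (K₅ + 2 * A₂) * C * B ^ p * (b - a), fun d hT ⟨c, ρ, hR⟩ hA uh ψh hu hψd hacc => ?_⟩
  obtain ⟨f₁, f₂, f₃, f₄⟩ := face d c ρ hR
  have hE := fun k => (hR.elem k).isSBP
  have hk := fun k => (hR.elem k).kind
  have hh := d.h_nonneg
  set ν : ℝ := C * d.h ^ (p + 1) with hν
  have hν0 : 0 ≤ ν := by positivity
  have hrep := discreteFunctional_sub hE hk hA hu hψd (d.restr U)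
  have hcons := functional_sub_add_residual hT hA hU hψ hΦ hΦI fun x hx =>
    (hasDerivWithinAt_flux_mul hab hlams hUs hψs hU hx).derivWithin (uniqueDiffOn_Icc hab x hx)
  have hsplit : functional a b bc lam G ψB U - d.discreteFunctional bc lam uB uh G ψB =
      ∑ k, ((d.elem k).formDefect (Jet.of a b lam) (Jet.of a b U) (Jet.of a b ψ) +
        quadErr (d.elem k) a b (fun x => flux a b lam U x * ψ x) - quadErr (d.elem k) a b Φ +
        ∑ γ : Side, d.faceErr a b bc lam U ψ γ k) -
      ∑ k, d.residual bc lam uB F (d.restr U) (d.restr ψ - ψh) k := by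
    rw [← hcons]
    simp only [← residual_sub, Finset.sum_sub_distrib]
    rw [← hrep]
    ring
  have hdefect : ∀ k, |(d.elem k).formDefect (Jet.of a b lam) (Jet.of a b U) (Jet.of a b ψ) +
        quadErr (d.elem k) a b (fun x => flux a b lam U x * ψ x) - quadErr (d.elem k) a b Φ +
        ∑ γ : Side, d.faceErr a b bc lam U ψ γ k| ≤
      (K₂ + K₃ + K₄ + 2 * A₁) * ρ k ^ (2 * p + 1) := fun k => by
    refine (abs_add_le_add (abs_sub_le_add (abs_add_le_add (form _ _ _ (hR.elem k))
      (quad _ _ _ (hR.elem k))) (quad' _ _ _ (hR.elem k)))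
      (abs_sum_side_le fun γ => hR.abs_faceErr_le hK₁ f₁ f₂ f₃ f₄ γ k)).trans (le_of_eq ?_)
    ring
  -- The exponent p is written p - 1 + 1 to suit `sum_le`; the surviving h^(p-1) meets the h^(p+1)
  -- in ν.
  have hres : ∀ k, |d.residual bc lam uB F (d.restr U) (d.restr ψ - ψh) k| ≤
      (K₅ + 2 * A₂) * ν * ρ k ^ (p - 1 + 1) := fun k => by
    rw [residual_eq hT hU]
    refine (abs_add_le_add (res _ _ _ (hR.elem k) _ ν hν0 (hacc k))
      (abs_sum_side_le fun γ => hR.abs_face_le hK₁ hΛ0 hΛ hν0 f₁ f₂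
        (fun k i => hacc k i) γ k)).trans (le_of_eq ?_)
    rw [Nat.sub_add_cancel hp]
    ring
  have hs₁ := hR.sum_le (by positivity) hdefect
  have hs₂ := hR.sum_le (by positivity) hres
  rw [hsplit]
  refine (abs_sub_le_add hs₁ hs₂).trans (le_of_eq ?_)
  rw [Nat.sub_add_cancel hp, hν]
  have e : d.h ^ (2 * p) = d.h ^ (p + 1) * d.h ^ (p - 1) := by
    rw [← pow_add]
    congr 1
    omega
  rw [e]
  ring

theorem Scaled.mono {d : Discretization n} (h : d.Scaled bc C) {C' : ℝ} (hC : C ≤ C')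
    (hE : ∀ k, (d.elem k).IsSBP p) : d.Scaled bc C' where
  size_le k := (h.size_le k).trans
    (mul_le_mul_of_nonneg_right hC (sub_nonneg.mpr (hE k).bdry_lt.le))
  size_le_nbr γ k v hv := (h.size_le_nbr γ k v hv).trans
    (mul_le_mul_of_nonneg_right hC Metric.diam_nonneg)
  R_le k γ i := (h.R_le k γ i).trans hC
  w_le k i := (h.w_le k i).trans (mul_le_mul_of_nonneg_right hC Metric.diam_nonneg)
  D_le k i j := (h.D_le k i j).trans hC
  Db_le k i j := (h.Db_le k i j).trans hC
  Mbar_le k l i j := (h.Mbar_le k l i j).trans hC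
  T1_le γ k v hv := (h.T1_le γ k v hv).trans hC
  T2_le γ k v hv := (h.T2_le γ k v hv).trans hC
  T3_le γ k v hv := (h.T3_le γ k v hv).trans hC
  T4_le γ k v hv := (h.T4_le γ k v hv).trans (mul_le_mul_of_nonneg_right hC Metric.diam_nonneg)
  TD_le γ k hv hb := (h.TD_le γ k hv hb).trans hC

theorem Scaled.dual {d : Discretization n} (h : d.Scaled bc C)
    (hE : ∀ k, (d.elem k).IsSBP p) : d.dual.Scaled bc (C + 1) :=
  have h' := h.mono (p := p) (le_add_of_nonneg_right zero_le_one) hE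
  { size_le := h'.size_le
    size_le_nbr := h'.size_le_nbr
    R_le := h'.R_le
    w_le := h'.w_le
    D_le := h'.D_le
    Db_le := h'.Db_le
    Mbar_le := h'.Mbar_le
    T1_le := h'.T1_le
    T2_le := fun γ k v hv => abs_sub_le_add (h.T3_le γ k v hv) abs_one.le
    T3_le := fun γ k v hv => abs_add_le_add (h.T2_le γ k v hv) abs_one.le
    T4_le := h'.T4_le
    TD_le := h'.TD_le }

theorem Tessellates.dual {d : Discretization n} (h : d.Tessellates a b) :
    d.dual.Tessellates a b :=
  ⟨h.ne_pos, h.interior, h.boundary, h.node_mem⟩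

theorem Accurate.mono {d : Discretization n} {v : Fin d.ne → Fin n → ℝ} {V : ℝ → ℝ} {r : ℕ}
    (h : d.Accurate v V r C) {C' : ℝ} (hC : C ≤ C') : d.Accurate v V r C' := fun k i =>
  (h k i).trans (mul_le_mul_of_nonneg_right hC (pow_nonneg d.h_nonneg r))

end Discretization

end

theorem theorem2 (p n : ℕ) (hp : 1 ≤ p) (a b : ℝ) (hab : a < b)
    (bc : Side → BC) (hbc : ∃ γ, bc γ = BC.dirichlet)
    (lam F G U ψ : ℝ → ℝ) (uB ψB : Side → ℝ)
    (hUs : ContDiffOn ℝ ((2 * p + 2 : ℕ) : WithTop ℕ∞) U (Icc a b))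
    (hψs : ContDiffOn ℝ ((2 * p + 2 : ℕ) : WithTop ℕ∞) ψ (Icc a b))
    (hlams : ContDiffOn ℝ ((2 * p + 1 : ℕ) : WithTop ℕ∞) lam (Icc a b))
    (hFs : ContDiffOn ℝ ((2 * p : ℕ) : WithTop ℕ∞) F (Icc a b))
    (hGs : ContDiffOn ℝ ((2 * p : ℕ) : WithTop ℕ∞) G (Icc a b))
    (hlam : ∀ x ∈ Icc a b, 0 < lam x)
    (hU : SolvesDiffusion a b bc lam F U uB)
    (hψ : SolvesDiffusion a b bc lam G ψ ψB) :
    functional a b bc lam G ψB U = functional a b bc lam F uB ψ ∧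
    ∀ C : ℝ, ∃ K : ℝ, ∀ d : Discretization n,
      d.Tessellates a b →
      (∀ k, (d.elem k).IsSBP p) →
      (∀ k, (d.elem k).IsNarrow p ∨ (d.elem k).IsWide) →
      d.Scaled bc C →
      d.AdjointConsistent lam →
      ∀ uh ψh : Fin d.ne → Fin n → ℝ,
        d.SolvesPrimal bc lam uB uh F →
        d.SolvesAdjoint bc lam ψB ψh G →
        d.Accurate uh U (p + 1) C →
        d.Accurate ψh ψ (p + 1) C →
        |functional a b bc lam G ψB U - d.discreteFunctional bc lam uB uh G ψB|
            ≤ K * d.h ^ (2 * p) ∧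
        |functional a b bc lam F uB ψ - d.discreteFunctional bc lam ψB ψh F uB|
            ≤ K * d.h ^ (2 * p) := by
  refine ⟨functional_eq hab hlams hUs hψs hFs.continuousOn hGs.continuousOn hU hψ, fun C => ?_⟩
  -- The extra 1 lets the same B serve `d.dual`, whose coefficients T⁽²⁾ and T⁽³⁾ are shifted by
  -- one.
  obtain ⟨B, hB⟩ := Discretization.exists_isRegular n p hp hab bc
    (show (0 : ℝ) ≤ |C| + 1 by positivity)
  have hC : C ≤ |C| := le_abs_self C
  -- B ≥ 1 is known only once a discretization is given, while the constants must be chosen before;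
  -- hence |B|.
  obtain ⟨K₁, h₁⟩ := Discretization.functional_error_le (B := |B|) n hab hp (abs_nonneg B)
    (abs_nonneg C) hUs hψs hlams hGs hU hψ
  obtain ⟨K₂, h₂⟩ := Discretization.functional_error_le (B := |B|) n hab hp (abs_nonneg B)
    (abs_nonneg C) hψs hUs hlams hFs hψ hU
  refine ⟨max K₁ K₂, fun d hT hE hk hS hA uh ψh hu hψd hua hψa => ?_⟩
  obtain ⟨c, ρ, hR⟩ := hB d hT hE hk (hS.mono (by linarith) hE)
  obtain ⟨c', ρ', hR'⟩ := hB d.dual hT.dual hE hk ((hS.mono hC hE).dual hE)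
  have hBB : |B| = B := abs_of_nonneg (zero_le_one.trans hR.one_le)
  rw [hBB] at h₁ h₂
  have hψp := hψd.solvesPrimal_dual hA
  have hh : 0 ≤ d.h ^ (2 * p) := pow_nonneg d.h_nonneg _
  -- The functional involves no interface coefficients, only T⁽ᴰ⁾, which `dual` keeps.
  have hdual : d.dual.discreteFunctional bc lam ψB ψh F uB =
      d.discreteFunctional bc lam ψB ψh F uB :=
    (Discretization.discreteFunctional_eq (d := d.dual) ψh F uB).trans
      (Discretization.discreteFunctional_eq (d := d) ψh F uB).symm
  constructor
  · exact (h₁ d hT ⟨c, ρ, hR⟩ hA uh ψh hu hψp (hψa.mono hC)).trans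
      (mul_le_mul_of_nonneg_right (le_max_left _ _) hh)
  · rw [← hdual]
    exact (h₂ d.dual hT.dual ⟨c', ρ', hR'⟩ hA.dual ψh uh hψp hu.dual_dual (hua.mono hC)).trans
      (mul_le_mul_of_nonneg_right (le_max_right _ _) hh)
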